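/- Let $\mathbb F$ be a field of characteristic $0$. A *Jacobi diagram* (2-coloured) is a finite uni-trivalent graph (loops and multiple edges allowed) with a cyclic order of the edges at every trivalent vertex, every univalent vertex ("leg") labelled by one of two colours, and at least one leg in every connected component. Let $\mathcal B(2)$ be the $\mathbb F$-vector space generated by the isomorphism classes of these diagrams modulo the antisymmetry and IHX relations; it is a commutative algebra under disjoint union. Let $\mathcal A(2)$ be the $\mathbb F$-vector space generated by generalized chord diagrams on two oriented strands (Jacobi diagrams whose legs of colour $i$ are attached to distinct points of the $i$-th strand) modulo the STU relation (and its consequences antisymmetry and IHX); it is an algebra under stacking. Let $\chi:\mathcal B(2)\to\mathcal A(2)$ be the linear symmetrization map, which sends a diagram with $k$ legs of colour 1 and $l$ legs of colour 2 to the average of the $k!\,l!$ ways to attach its legs to the strands according to their colours; it is a linear isomorphism. For $i=1,2$ let $a_i\in\mathcal A(2)$ be the diagram consisting of one chord with both ends on strand $i$, and let $b_i\in\mathcal B(2)$ be the strut (a single edge) with both ends of colour $i$. Let $\mathcal A'(2)\subset\mathcal A(2)$ be the subalgebra generated by all connected diagrams (those whose graph, without the strands, is connected) except $a_1$ and $a_2$.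 The projection $\mathcal A(2)\to\mathcal A(2)/\langle a_1,a_2\rangle$ onto the quotient by the two-sided ideal of the 1-term relations restricts to an isomorphism on $\mathcal A'(2)$, so that $\mathcal A'(2)$ is this quotient, realized as a subalgebra of $\mathcal A(2)$. **Lemma.** The subspace $\chi^{-1}(\mathcal A'(2))$ of $\mathcal B(2)$ coincides with the subalgebra $\mathcal B'(2)$ of $\mathcal B(2)$ generated by all connected Jacobi diagrams except $b_1$ and $b_2$. In particular the heptapus $H$ (a circle with seven legs pointing outward, coloured cyclically $1,1,2,1,2,2,2$) satisfies $H\in\mathcal B'(2)$ and $\chi(H)\in\mathcal A'(2)$. -/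

import Mathlib

/-! ## Jacobi diagrams with legs of `p` colours -/

/-- A `p`-coloured Jacobi diagram, that is, a finite uni-trivalent graph (loops and multiple edges
allowed) with a cyclic order of the edges at every trivalent vertex, a colour on every univalent
vertex ("leg"), and at least one leg in every connected component.
The graph is given by its half-edges: `edge` sends a half-edge to the other half of its edge, and
`next` to the counterclockwise next half-edge at the same vertex. So the vertices are the orbits of
`next`, which have one element (legs) or three (trivalent vertices). A leg is identified with its
half-edge. The values of `color` at half-edges that are not legs are irrelevant: isomorphisms of
diagrams ignore them. -/
structure JacobiDiagram (p : ℕ) : Type 1 where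
  H : Type
  finite : Finite H
  edge : Equiv.Perm H
  next : Equiv.Perm H
  color : H → Fin p
  edge_edge : ∀ h, edge (edge h) = h
  edge_ne : ∀ h, edge h ≠ h
  next_next_next : ∀ h, next (next (next h)) = h
  legged : ∀ h, ∃ l, next l = l ∧ Relation.EqvGen (fun a b => b = edge a ∨ b = next a) h l

namespace JacobiDiagram

variable {p : ℕ}

/-- The half-edge `h` ends at a univalent vertex. -/
def IsLeg (D : JacobiDiagram p) (h : D.H) : Prop := D.next h = h

/-- Two half-edges lie in the same connected component of the graph. -/
def Joined (D : JacobiDiagram p) : D.H → D.H → Prop :=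
  Relation.EqvGen (fun a b => b = D.edge a ∨ b = D.next a)

/-- The graph is connected (and nonempty). -/
def Connected (D : JacobiDiagram p) : Prop := Nonempty D.H ∧ ∀ a b, D.Joined a b

/-- Via the bijection `f` of half-edges, the diagram `E` is obtained from `D` by keeping the
vertices, the colours of the legs and the cyclic orders, and replacing the edges `{a, edge a}` by
`{π a, π (edge a)}`: whatever was attached at the end `a` is now attached at the end `π a`. -/
structure IsRegluing (D E : JacobiDiagram p) (π : Equiv.Perm D.H) (f : D.H ≃ E.H) : Prop where
  next : ∀ h, E.next (f h) = f (D.next h)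
  edge : ∀ h, E.edge (f (π h)) = f (π (D.edge h))
  color : ∀ h, D.IsLeg h → E.color (f h) = D.color h

/-- Isomorphism of coloured Jacobi diagrams. -/
def Iso (D E : JacobiDiagram p) : Prop := ∃ f : D.H ≃ E.H, IsRegluing D E 1 f

open Classical in
/-- The exchange of the two half-edges that follow `h` at its (trivalent) vertex. -/
noncomputable def flip (D : JacobiDiagram p) (h : D.H) : Equiv.Perm D.H :=
  Equiv.swap (D.next h) (D.next (D.next h))

/-- The edge of `h` joins two different trivalent vertices. -/
def IsInner (D : JacobiDiagram p) (h : D.H) : Prop :=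
  ¬ D.IsLeg h ∧ ¬ D.IsLeg (D.edge h) ∧ D.edge h ≠ D.next h ∧ D.edge h ≠ D.next (D.next h)

open Classical in
/-- For an edge `{h, k}` joining the vertices `(h, a, b)` and `(k, c, d)`, the cyclic permutation
`a ↦ b ↦ c ↦ a`. -/
noncomputable def turn (D : JacobiDiagram p) (h : D.H) : Equiv.Perm D.H :=
  Equiv.swap (D.next h) (D.next (D.next h)) *
    Equiv.swap (D.next (D.next h)) (D.next (D.edge h))

/-- Disjoint union. -/
def union (D E : JacobiDiagram p) : JacobiDiagram p where
  H := D.H ⊕ E.H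
  finite := by
    have := D.finite
    have := E.finite
    infer_instance
  edge := Equiv.sumCongr D.edge E.edge
  next := Equiv.sumCongr D.next E.next
  color := Sum.elim D.color E.color
  edge_edge := by rintro (h | h) <;> simp [D.edge_edge, E.edge_edge]
  edge_ne := by rintro (h | h) <;> simp [D.edge_ne, E.edge_ne]
  next_next_next := by rintro (h | h) <;> simp [D.next_next_next, E.next_next_next]
  legged := by
    rintro (h | h)
    · obtain ⟨l, hl, hc⟩ := D.legged h
      refine ⟨Sum.inl l, by simp [hl], ?_⟩
      clear hl
      induction hc with
      | rel a b hab => exact .rel _ _ (by rcases hab with rfl | rfl <;> simp)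
      | refl a => exact .refl _
      | symm a b _ ih => exact .symm _ _ ih
      | trans a b c _ _ ih1 ih2 => exact .trans _ _ _ ih1 ih2
    · obtain ⟨l, hl, hc⟩ := E.legged h
      refine ⟨Sum.inr l, by simp [hl], ?_⟩
      clear hl
      induction hc with
      | rel a b hab => exact .rel _ _ (by rcases hab with rfl | rfl <;> simp)
      | refl a => exact .refl _
      | symm a b _ ih => exact .symm _ _ ih
      | trans a b c _ _ ih1 ih2 => exact .trans _ _ _ ih1 ih2

/-- The empty diagram. -/
def empty (p : ℕ) : JacobiDiagram p where
  H := Empty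
  finite := inferInstance
  edge := 1
  next := 1
  color := Empty.elim
  edge_edge := by rintro ⟨⟩
  edge_ne := by rintro ⟨⟩
  next_next_next := by rintro ⟨⟩
  legged := by rintro ⟨⟩

/-- The strut: a single edge, both of whose ends are legs of colour `i`. -/
def strut (i : Fin p) : JacobiDiagram p where
  H := Bool
  finite := inferInstance
  edge := Equiv.boolNot
  next := 1
  color := fun _ => i
  edge_edge := by simp
  edge_ne := by simp
  next_next_next := by simp
  legged := fun h => ⟨h, rfl, .refl _⟩

theorem Iso.refl (D : JacobiDiagram p) : Iso D D := ⟨Equiv.refl _, ⟨by simp, by simp, by simp⟩⟩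

theorem IsRegluing.isLeg_iff {D E : JacobiDiagram p} {π : Equiv.Perm D.H} {f : D.H ≃ E.H}
    (hf : IsRegluing D E π f) (h : D.H) : E.IsLeg (f h) ↔ D.IsLeg h := by
  simp [IsLeg, hf.next]

theorem IsRegluing.symm {D E : JacobiDiagram p} {f : D.H ≃ E.H}
    (hf : IsRegluing D E 1 f) : IsRegluing E D 1 f.symm where
  next h := by
    have := hf.next (f.symm h)
    rw [Equiv.apply_symm_apply] at this
    rw [this, Equiv.symm_apply_apply]
  edge h := by
    have := hf.edge (f.symm h)
    simp only [Equiv.Perm.coe_one, id_eq, Equiv.apply_symm_apply] at this ⊢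
    rw [this, Equiv.symm_apply_apply]
  color h hh := by
    have := hf.color (f.symm h) (by rw [← hf.isLeg_iff]; simpa using hh)
    simpa using this.symm

theorem IsRegluing.trans {D E G : JacobiDiagram p} {f : D.H ≃ E.H} {g : E.H ≃ G.H}
    (hf : IsRegluing D E 1 f) (hg : IsRegluing E G 1 g) : IsRegluing D G 1 (f.trans g) where
  next h := by simp [hg.next, hf.next]
  edge h := by
    have h1 := hf.edge h
    have h2 := hg.edge (f h)
    simp only [Equiv.Perm.coe_one, id_eq] at h1 h2 ⊢
    simp [h1, h2]
  color h hh := by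
    simp [hg.color _ ((hf.isLeg_iff h).2 hh), hf.color _ hh]

theorem IsRegluing.union {D D' E E' : JacobiDiagram p} {π : Equiv.Perm D.H} {ρ : Equiv.Perm E.H}
    {f : D.H ≃ D'.H} {g : E.H ≃ E'.H} (hf : IsRegluing D D' π f) (hg : IsRegluing E E' ρ g) :
    IsRegluing (D.union E) (D'.union E') (Equiv.sumCongr π ρ) (Equiv.sumCongr f g) where
  next := by
    rintro (h | h)
    · exact congrArg Sum.inl (hf.next h)
    · exact congrArg Sum.inr (hg.next h)
  edge := by
    rintro (h | h)
    · exact congrArg Sum.inl (hf.edge h)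
    · exact congrArg Sum.inr (hg.edge h)
  color := by
    rintro (h | h) hh
    · exact hf.color h (Sum.inl_injective hh)
    · exact hg.color h (Sum.inr_injective hh)

theorem IsRegluing.refl (D : JacobiDiagram p) : IsRegluing D D 1 (Equiv.refl _) :=
  ⟨by simp, by simp, by simp⟩

theorem IsRegluing.one_union {D D' E E' : JacobiDiagram p}
    {f : D.H ≃ D'.H} {g : E.H ≃ E'.H} (hf : IsRegluing D D' 1 f) (hg : IsRegluing E E' 1 g) :
    IsRegluing (D.union E) (D'.union E') 1 (Equiv.sumCongr f g) := by
  have h := hf.union hg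
  rwa [show Equiv.sumCongr (1 : Equiv.Perm D.H) (1 : Equiv.Perm E.H) = 1 from
    Equiv.Perm.sumCongr_one] at h

theorem isRegluing_assoc (D E G : JacobiDiagram p) :
    IsRegluing ((D.union E).union G) (D.union (E.union G)) 1 (Equiv.sumAssoc _ _ _) := by
  constructor <;> rintro ((h | h) | h) <;> first | rfl | exact fun _ => rfl

theorem isRegluing_comm (D E : JacobiDiagram p) :
    IsRegluing (D.union E) (E.union D) 1 (Equiv.sumComm _ _) := by
  constructor <;> rintro (h | h) <;> first | rfl | exact fun _ => rfl

theorem isRegluing_empty_union (D : JacobiDiagram p) :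
    IsRegluing ((empty p).union D) D 1 (Equiv.emptySum Empty _) := by
  constructor <;> rintro (⟨⟨⟩⟩ | h) <;> first | rfl | exact fun _ => rfl

theorem isRegluing_union_empty (D : JacobiDiagram p) :
    IsRegluing (D.union (empty p)) D 1 (Equiv.sumEmpty _ Empty) := by
  constructor <;> rintro (h | ⟨⟨⟩⟩) <;> first | rfl | exact fun _ => rfl

theorem swap_inl {α β : Type} {_ : DecidableEq α} {_ : DecidableEq (α ⊕ β)} (i j : α) :
    Equiv.swap (Sum.inl i : α ⊕ β) (Sum.inl j) = Equiv.sumCongr (Equiv.swap i j) 1 := by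
  classical
  refine Eq.trans ?_ (Equiv.Perm.sumCongr_swap_one i j).symm
  congr!

theorem swap_inr {α β : Type} {_ : DecidableEq β} {_ : DecidableEq (α ⊕ β)} (i j : β) :
    Equiv.swap (Sum.inr i : α ⊕ β) (Sum.inr j) = Equiv.sumCongr 1 (Equiv.swap i j) := by
  classical
  refine Eq.trans ?_ (Equiv.Perm.sumCongr_one_swap i j).symm
  congr!

theorem flip_union_inl (D E : JacobiDiagram p) (h : D.H) :
    (D.union E).flip (Sum.inl h) = Equiv.sumCongr (D.flip h) 1 :=
  swap_inl (β := E.H) (D.next h) (D.next (D.next h))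

theorem flip_union_inr (D E : JacobiDiagram p) (h : E.H) :
    (D.union E).flip (Sum.inr h) = Equiv.sumCongr 1 (E.flip h) :=
  swap_inr (α := D.H) (E.next h) (E.next (E.next h))

theorem turn_union_inl (D E : JacobiDiagram p) (h : D.H) :
    (D.union E).turn (Sum.inl h) = Equiv.sumCongr (D.turn h) 1 :=
  (congrArg₂ (· * ·) (swap_inl (β := E.H) (D.next h) (D.next (D.next h)))
    (swap_inl (β := E.H) (D.next (D.next h)) (D.next (D.edge h)))).trans
    (Equiv.Perm.sumCongr_mul _ _ _ _)

theorem turn_union_inr (D E : JacobiDiagram p) (h : E.H) :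
    (D.union E).turn (Sum.inr h) = Equiv.sumCongr 1 (E.turn h) :=
  (congrArg₂ (· * ·) (swap_inr (α := D.H) (E.next h) (E.next (E.next h)))
    (swap_inr (α := D.H) (E.next (E.next h)) (E.next (E.edge h)))).trans
    (Equiv.Perm.sumCongr_mul _ _ _ _)

theorem sumCongr_one_inv {α β : Type} (π : Equiv.Perm α) :
    (Equiv.sumCongr π (1 : Equiv.Perm β) : Equiv.Perm (α ⊕ β))⁻¹ = Equiv.sumCongr π⁻¹ 1 := rfl

theorem one_sumCongr_inv {α β : Type} (π : Equiv.Perm β) :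
    (Equiv.sumCongr (1 : Equiv.Perm α) π : Equiv.Perm (α ⊕ β))⁻¹ = Equiv.sumCongr 1 π⁻¹ := rfl

theorem isLeg_union_inl (D E : JacobiDiagram p) (h : D.H) :
    (D.union E).IsLeg (Sum.inl h) ↔ D.IsLeg h := Sum.inl_injective.eq_iff

theorem isLeg_union_inr (D E : JacobiDiagram p) (h : E.H) :
    (D.union E).IsLeg (Sum.inr h) ↔ E.IsLeg h := Sum.inr_injective.eq_iff

theorem IsInner.union_inl {D : JacobiDiagram p} {h : D.H} (hh : D.IsInner h)
    (E : JacobiDiagram p) : (D.union E).IsInner (Sum.inl h) :=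
  ⟨fun h1 => hh.1 (Sum.inl_injective h1), fun h1 => hh.2.1 (Sum.inl_injective h1),
    fun h1 => hh.2.2.1 (Sum.inl_injective h1), fun h1 => hh.2.2.2 (Sum.inl_injective h1)⟩

theorem IsInner.union_inr {E : JacobiDiagram p} {h : E.H} (hh : E.IsInner h)
    (D : JacobiDiagram p) : (D.union E).IsInner (Sum.inr h) :=
  ⟨fun h1 => hh.1 (Sum.inr_injective h1), fun h1 => hh.2.1 (Sum.inr_injective h1),
    fun h1 => hh.2.2.1 (Sum.inr_injective h1), fun h1 => hh.2.2.2 (Sum.inr_injective h1)⟩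

instance setoid (p : ℕ) : Setoid (JacobiDiagram p) where
  r := Iso
  iseqv := ⟨Iso.refl, fun ⟨_, hf⟩ => ⟨_, hf.symm⟩, fun ⟨_, hf⟩ ⟨_, hg⟩ => ⟨_, hf.trans hg⟩⟩

end JacobiDiagram

/-- Isomorphism classes of `p`-coloured Jacobi diagrams, a commutative monoid under disjoint
union. -/
def JacobiClass (p : ℕ) : Type 1 := Quotient (JacobiDiagram.setoid p)

namespace JacobiClass

variable {p : ℕ}

def mk (D : JacobiDiagram p) : JacobiClass p := Quotient.mk _ D

instance : CommMonoid (JacobiClass p) where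
  mul := Quotient.map₂ JacobiDiagram.union
    (fun _ _ ⟨_, hf⟩ _ _ ⟨_, hg⟩ => ⟨_, hf.one_union hg⟩)
  one := mk (JacobiDiagram.empty p)
  mul_assoc := by
    rintro ⟨a⟩ ⟨b⟩ ⟨c⟩
    exact Quotient.sound ⟨_, JacobiDiagram.isRegluing_assoc a b c⟩
  one_mul := by
    rintro ⟨a⟩
    exact Quotient.sound ⟨_, JacobiDiagram.isRegluing_empty_union a⟩
  mul_one := by
    rintro ⟨a⟩
    exact Quotient.sound ⟨_, JacobiDiagram.isRegluing_union_empty a⟩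
  mul_comm := by
    rintro ⟨a⟩ ⟨b⟩
    exact Quotient.sound ⟨_, JacobiDiagram.isRegluing_comm a b⟩

theorem mk_mul (D E : JacobiDiagram p) : mk D * mk E = mk (D.union E) := rfl

end JacobiClass

/-! ## Generalized chord diagrams on `p` strands -/

/-- The relation `lt` is a way of attaching the legs of `D` to `p` oriented strands: for every `i`
it is a strict linear order on the set of legs of colour `i` (the order in which they meet strand
`i`), and it relates nothing else. -/
structure JacobiDiagram.IsAttachment {p : ℕ} (D : JacobiDiagram p) (lt : D.H → D.H → Prop) :
    Prop where
  legs : ∀ a b, lt a b → D.IsLeg a ∧ D.IsLeg b ∧ D.color a = D.color b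
  irrefl : ∀ a, ¬ lt a a
  trans : ∀ a b c, lt a b → lt b c → lt a c
  total : ∀ a b, D.IsLeg a → D.IsLeg b → D.color a = D.color b → a ≠ b → lt a b ∨ lt b a

/-- A generalized chord diagram on `p` numbered oriented strands: a uni-trivalent graph whose legs
of colour `i` are attached to distinct points of strand `i`. Ordinary chord diagrams are those
with no trivalent vertex. -/
structure StrandDiagram (p : ℕ) : Type 1 extends JacobiDiagram p where
  lt : H → H → Prop
  attached : toJacobiDiagram.IsAttachment lt

namespace StrandDiagram

variable {p : ℕ}

/-- `E` is obtained from `D` by the regluing `π` of edges, with the same position of the legs on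
the strands. -/
def IsRegluing (D E : StrandDiagram p) (π : Equiv.Perm D.H) (f : D.H ≃ E.H) : Prop :=
  D.toJacobiDiagram.IsRegluing E.toJacobiDiagram π f ∧ ∀ a b, E.lt (f a) (f b) ↔ D.lt a b

/-- Isomorphism of generalized chord diagrams. -/
def Iso (D E : StrandDiagram p) : Prop := ∃ f : D.H ≃ E.H, IsRegluing D E 1 f

/-- Stacking: on every strand, the legs of `D` precede those of `E`. -/
def stack (D E : StrandDiagram p) : StrandDiagram p where
  toJacobiDiagram := D.toJacobiDiagram.union E.toJacobiDiagram
  lt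
    | .inl a, .inl b => D.lt a b
    | .inr a, .inr b => E.lt a b
    | .inl a, .inr b => D.IsLeg a ∧ E.IsLeg b ∧ D.color a = E.color b
    | .inr _, .inl _ => False
  attached := by
    constructor
    · rintro (a | a) (b | b) h
      · obtain ⟨h1, h2, h3⟩ := D.attached.legs a b h
        exact ⟨congrArg Sum.inl h1, congrArg Sum.inl h2, h3⟩
      · exact ⟨congrArg Sum.inl h.1, congrArg Sum.inr h.2.1, h.2.2⟩
      · exact h.elim
      · obtain ⟨h1, h2, h3⟩ := E.attached.legs a b h
        exact ⟨congrArg Sum.inr h1, congrArg Sum.inr h2, h3⟩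
    · rintro (a | a) h
      · exact D.attached.irrefl a h
      · exact E.attached.irrefl a h
    · rintro (a | a) (b | b) (c | c) h1 h2
      · exact D.attached.trans a b c h1 h2
      · obtain ⟨h3, h4, h5⟩ := D.attached.legs a b h1
        exact ⟨h3, h2.2.1, h5.trans h2.2.2⟩
      · exact h2.elim
      · obtain ⟨h3, h4, h5⟩ := E.attached.legs b c h2
        exact ⟨h1.1, h4, h1.2.2.trans h5⟩
      · exact h1.elim
      · exact h1.elim
      · exact h2.elim
      · exact E.attached.trans a b c h1 h2
    · rintro (a | a) (b | b) ha hb hc hab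
      · exact D.attached.total a b (Sum.inl_injective ha) (Sum.inl_injective hb) hc
          (fun h => hab (congrArg _ h))
      · exact Or.inl ⟨Sum.inl_injective ha, Sum.inr_injective hb, hc⟩
      · exact Or.inr ⟨Sum.inl_injective hb, Sum.inr_injective ha, hc.symm⟩
      · exact E.attached.total a b (Sum.inr_injective ha) (Sum.inr_injective hb) hc
          (fun h => hab (congrArg _ h))

/-- The diagram without chords. -/
def empty (p : ℕ) : StrandDiagram p where
  toJacobiDiagram := JacobiDiagram.empty p
  lt _ _ := False
  attached := ⟨by rintro ⟨⟩, by rintro ⟨⟩, by rintro ⟨⟩, by rintro ⟨⟩⟩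

/-- The diagram with one chord, both of whose ends lie on strand `i`. -/
def chord (i : Fin p) : StrandDiagram p where
  toJacobiDiagram := JacobiDiagram.strut i
  lt a b := (show Bool from a) = false ∧ (show Bool from b) = true
  attached := by
    constructor
    · intro a b _
      exact ⟨rfl, rfl, rfl⟩
    · rintro a ⟨h1, h2⟩
      exact Bool.false_ne_true (h1.symm.trans h2)
    · rintro a b c ⟨h1, h2⟩ ⟨h3, h4⟩
      exact ⟨h1, h4⟩
    · intro a b _ _ _ h
      change Bool at a b
      cases a <;> cases b
      · exact (h rfl).elim
      · exact Or.inl ⟨rfl, rfl⟩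
      · exact Or.inr ⟨rfl, rfl⟩
      · exact (h rfl).elim

/-- The half-edges `x`, `y` are legs meeting the same strand in neighbouring points, `x` first. -/
def Adjacent (D : StrandDiagram p) (x y : D.H) : Prop :=
  D.lt x y ∧ ¬ ∃ z, D.lt x z ∧ D.lt z y

/-- Merging two legs `x`, `y` of `D` (neighbours on a strand, `x` first) into one:
a new trivalent vertex `(stem, y, x)` is created, with `stem = g (inr false)`, whose stem leads to
the new leg `foot = g (inr true)`, which takes the place of `x` and `y` on the strand.
The other half-edges `h` of `D` become the half-edges `g (inl h)` of `E`. -/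
structure IsMerging (D : StrandDiagram p) (x y : D.H) (E : StrandDiagram p)
    (g : D.H ⊕ Bool ≃ E.H) : Prop where
  edge : ∀ h, E.edge (g (.inl h)) = g (.inl (D.edge h))
  edge_stem : E.edge (g (.inr false)) = g (.inr true)
  next : ∀ h, h ≠ x → h ≠ y → E.next (g (.inl h)) = g (.inl (D.next h))
  next_stem : E.next (g (.inr false)) = g (.inl y)
  next_y : E.next (g (.inl y)) = g (.inl x)
  next_x : E.next (g (.inl x)) = g (.inr false)
  next_foot : E.next (g (.inr true)) = g (.inr true)
  color : ∀ h, D.IsLeg h → h ≠ x → h ≠ y → E.color (g (.inl h)) = D.color h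
  color_foot : E.color (g (.inr true)) = D.color x
  lt : ∀ a b, a ≠ x → a ≠ y → b ≠ x → b ≠ y → (E.lt (g (.inl a)) (g (.inl b)) ↔ D.lt a b)
  lt_foot : ∀ a, a ≠ x → a ≠ y → (E.lt (g (.inl a)) (g (.inr true)) ↔ D.lt a x)
  foot_lt : ∀ b, b ≠ x → b ≠ y → (E.lt (g (.inr true)) (g (.inl b)) ↔ D.lt x b)

theorem IsRegluing.symm {D E : StrandDiagram p} {f : D.H ≃ E.H}
    (hf : IsRegluing D E 1 f) : IsRegluing E D 1 f.symm :=
  ⟨hf.1.symm, fun a b => by simp [← hf.2]⟩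

theorem IsRegluing.trans {D E G : StrandDiagram p} {f : D.H ≃ E.H} {g : E.H ≃ G.H}
    (hf : IsRegluing D E 1 f) (hg : IsRegluing E G 1 g) : IsRegluing D G 1 (f.trans g) :=
  ⟨hf.1.trans hg.1, fun a b => by simp [hg.2, hf.2]⟩

theorem IsRegluing.refl (D : StrandDiagram p) : IsRegluing D D 1 (Equiv.refl _) :=
  ⟨.refl _, by simp⟩

theorem stack_lt_iff {D D' E E' : StrandDiagram p} {π : Equiv.Perm D.H} {ρ : Equiv.Perm E.H}
    {f : D.H ≃ D'.H} {g : E.H ≃ E'.H} (hf : IsRegluing D D' π f) (hg : IsRegluing E E' ρ g)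
    (a b : (D.stack E).H) :
    (D'.stack E').lt (Equiv.sumCongr f g a) (Equiv.sumCongr f g b) ↔ (D.stack E).lt a b := by
  rcases a with a | a <;> rcases b with b | b
  · exact hf.2 a b
  · change (D'.IsLeg (f a) ∧ E'.IsLeg (g b) ∧ D'.color (f a) = E'.color (g b)) ↔
      (D.IsLeg a ∧ E.IsLeg b ∧ D.color a = E.color b)
    rw [hf.1.isLeg_iff, hg.1.isLeg_iff]
    refine and_congr_right fun ha => and_congr_right fun hb => ?_
    rw [hf.1.color a ha, hg.1.color b hb]
  · exact Iff.rfl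
  · exact hg.2 a b

theorem IsRegluing.stack {D D' E E' : StrandDiagram p} {π : Equiv.Perm D.H} {ρ : Equiv.Perm E.H}
    {f : D.H ≃ D'.H} {g : E.H ≃ E'.H} (hf : IsRegluing D D' π f) (hg : IsRegluing E E' ρ g) :
    IsRegluing (D.stack E) (D'.stack E') (Equiv.sumCongr π ρ) (Equiv.sumCongr f g) :=
  ⟨hf.1.union hg.1, stack_lt_iff hf hg⟩

theorem IsRegluing.one_stack {D D' E E' : StrandDiagram p}
    {f : D.H ≃ D'.H} {g : E.H ≃ E'.H} (hf : IsRegluing D D' 1 f) (hg : IsRegluing E E' 1 g) :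
    IsRegluing (D.stack E) (D'.stack E') 1 (Equiv.sumCongr f g) :=
  ⟨hf.1.one_union hg.1, stack_lt_iff hf hg⟩

instance setoid (p : ℕ) : Setoid (StrandDiagram p) where
  r := Iso
  iseqv := ⟨fun D => ⟨_, .refl D⟩, fun ⟨_, hf⟩ => ⟨_, hf.symm⟩,
    fun ⟨_, hf⟩ ⟨_, hg⟩ => ⟨_, hf.trans hg⟩⟩

theorem Adjacent.stack_inl {D : StrandDiagram p} {x y : D.H} (h : D.Adjacent x y)
    (E : StrandDiagram p) : (D.stack E).Adjacent (Sum.inl x) (Sum.inl y) := by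
  refine ⟨h.1, ?_⟩
  rintro ⟨z | z, h1, h2⟩
  · exact h.2 ⟨z, h1, h2⟩
  · exact h2

theorem Adjacent.stack_inr {E : StrandDiagram p} {x y : E.H} (h : E.Adjacent x y)
    (D : StrandDiagram p) : (D.stack E).Adjacent (Sum.inr x) (Sum.inr y) := by
  refine ⟨h.1, ?_⟩
  rintro ⟨z | z, h1, h2⟩
  · exact h1
  · exact h.2 ⟨z, h1, h2⟩

theorem IsMerging.isLeg_iff {T S : StrandDiagram p} {x y : T.H} {g : T.H ⊕ Bool ≃ S.H}
    (hg : T.IsMerging x y S g) (h : T.H) (hx : h ≠ x) (hy : h ≠ y) :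
    S.IsLeg (g (.inl h)) ↔ T.IsLeg h := by
  simp [JacobiDiagram.IsLeg, hg.next h hx hy]

theorem IsMerging.stack_left {T S : StrandDiagram p} {x y : T.H} {g : T.H ⊕ Bool ≃ S.H}
    (hg : T.IsMerging x y S g) (hxy : T.Adjacent x y) (A : StrandDiagram p) :
    (A.stack T).IsMerging (Sum.inr x) (Sum.inr y) (A.stack S)
      ((Equiv.sumAssoc A.H T.H Bool).trans (Equiv.sumCongr (Equiv.refl A.H) g)) where
  edge := by
    rintro (h | h)
    · rfl
    · exact congrArg Sum.inr (hg.edge h)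
  edge_stem := congrArg Sum.inr hg.edge_stem
  next := by
    rintro (h | h) hx hy
    · rfl
    · exact congrArg Sum.inr (hg.next h (fun e => hx (congrArg _ e)) (fun e => hy (congrArg _ e)))
  next_stem := congrArg Sum.inr hg.next_stem
  next_y := congrArg Sum.inr hg.next_y
  next_x := congrArg Sum.inr hg.next_x
  next_foot := congrArg Sum.inr hg.next_foot
  color := by
    rintro (h | h) hh hx hy
    · rfl
    · exact hg.color h (Sum.inr_injective hh) (fun e => hx (congrArg _ e))
        (fun e => hy (congrArg _ e))
  color_foot := hg.color_foot
  lt := by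
    rintro (a | a) (b | b) hax hay hbx hby
    · exact Iff.rfl
    · have hbx : b ≠ x := fun e => hbx (congrArg _ e)
      have hby : b ≠ y := fun e => hby (congrArg _ e)
      change (A.IsLeg a ∧ S.IsLeg (g (.inl b)) ∧ A.color a = S.color (g (.inl b))) ↔
        (A.IsLeg a ∧ T.IsLeg b ∧ A.color a = T.color b)
      rw [hg.isLeg_iff b hbx hby]
      refine and_congr_right fun _ => and_congr_right fun hb => ?_
      rw [hg.color b hb hbx hby]
    · exact Iff.rfl
    · exact hg.lt a b (fun e => hax (congrArg _ e)) (fun e => hay (congrArg _ e))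
        (fun e => hbx (congrArg _ e)) (fun e => hby (congrArg _ e))
  lt_foot := by
    rintro (a | a) hax hay
    · change (A.IsLeg a ∧ S.IsLeg (g (.inr true)) ∧ A.color a = S.color (g (.inr true))) ↔
        (A.IsLeg a ∧ T.IsLeg x ∧ A.color a = T.color x)
      rw [hg.color_foot]
      exact and_congr_right fun _ => and_congr_left fun _ =>
        iff_of_true hg.next_foot (T.attached.legs x y hxy.1).1
    · exact hg.lt_foot a (fun e => hax (congrArg _ e)) (fun e => hay (congrArg _ e))
  foot_lt := by
    rintro (b | b) hbx hby
    · exact Iff.rfl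
    · exact hg.foot_lt b (fun e => hbx (congrArg _ e)) (fun e => hby (congrArg _ e))

theorem IsMerging.stack_right {T S : StrandDiagram p} {x y : T.H} {g : T.H ⊕ Bool ≃ S.H}
    (hg : T.IsMerging x y S g) (hxy : T.Adjacent x y) (A : StrandDiagram p) :
    (T.stack A).IsMerging (Sum.inl x) (Sum.inl y) (S.stack A)
      (((Equiv.sumAssoc T.H A.H Bool).trans
        (Equiv.sumCongr (Equiv.refl T.H) (Equiv.sumComm A.H Bool))).trans
        ((Equiv.sumAssoc T.H Bool A.H).symm.trans (Equiv.sumCongr g (Equiv.refl A.H)))) where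
  edge := by
    rintro (h | h)
    · exact congrArg Sum.inl (hg.edge h)
    · rfl
  edge_stem := congrArg Sum.inl hg.edge_stem
  next := by
    rintro (h | h) hx hy
    · exact congrArg Sum.inl (hg.next h (fun e => hx (congrArg _ e)) (fun e => hy (congrArg _ e)))
    · rfl
  next_stem := congrArg Sum.inl hg.next_stem
  next_y := congrArg Sum.inl hg.next_y
  next_x := congrArg Sum.inl hg.next_x
  next_foot := congrArg Sum.inl hg.next_foot
  color := by
    rintro (h | h) hh hx hy
    · exact hg.color h (Sum.inl_injective hh) (fun e => hx (congrArg _ e))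
        (fun e => hy (congrArg _ e))
    · rfl
  color_foot := hg.color_foot
  lt := by
    rintro (a | a) (b | b) hax hay hbx hby
    · exact hg.lt a b (fun e => hax (congrArg _ e)) (fun e => hay (congrArg _ e))
        (fun e => hbx (congrArg _ e)) (fun e => hby (congrArg _ e))
    · have hax : a ≠ x := fun e => hax (congrArg _ e)
      have hay : a ≠ y := fun e => hay (congrArg _ e)
      change (S.IsLeg (g (.inl a)) ∧ A.IsLeg b ∧ S.color (g (.inl a)) = A.color b) ↔
        (T.IsLeg a ∧ A.IsLeg b ∧ T.color a = A.color b)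
      rw [hg.isLeg_iff a hax hay]
      refine and_congr_right fun ha => and_congr_right fun _ => ?_
      rw [hg.color a ha hax hay]
    · exact Iff.rfl
    · exact Iff.rfl
  lt_foot := by
    rintro (a | a) hax hay
    · exact hg.lt_foot a (fun e => hax (congrArg _ e)) (fun e => hay (congrArg _ e))
    · exact Iff.rfl
  foot_lt := by
    rintro (b | b) hbx hby
    · exact hg.foot_lt b (fun e => hbx (congrArg _ e)) (fun e => hby (congrArg _ e))
    · change (S.IsLeg (g (.inr true)) ∧ A.IsLeg b ∧ S.color (g (.inr true)) = A.color b) ↔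
        (T.IsLeg x ∧ A.IsLeg b ∧ T.color x = A.color b)
      rw [hg.color_foot]
      exact and_congr_left fun _ => iff_of_true hg.next_foot (T.attached.legs x y hxy.1).1

end StrandDiagram

/-- Isomorphism classes of generalized chord diagrams on `p` strands, a monoid under stacking. -/
def StrandClass (p : ℕ) : Type 1 := Quotient (StrandDiagram.setoid p)

namespace StrandClass

variable {p : ℕ}

def mk (D : StrandDiagram p) : StrandClass p := Quotient.mk _ D

instance : Monoid (StrandClass p) where
  mul := Quotient.map₂ StrandDiagram.stack
    (fun _ _ ⟨_, hf⟩ _ _ ⟨_, hg⟩ => ⟨_, hf.one_stack hg⟩)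
  one := mk (StrandDiagram.empty p)
  mul_assoc := by
    rintro ⟨a⟩ ⟨b⟩ ⟨c⟩
    refine Quotient.sound ⟨_, JacobiDiagram.isRegluing_assoc _ _ _, ?_⟩
    rintro ((x | x) | x) ((y | y) | y)
    · exact Iff.rfl
    · exact and_congr_right fun _ => and_congr_left fun _ => JacobiDiagram.isLeg_union_inl _ _ _
    · exact and_congr (JacobiDiagram.isLeg_union_inl _ _ _).symm
        (and_congr_left fun _ => JacobiDiagram.isLeg_union_inr _ _ _)
    · exact Iff.rfl
    · exact Iff.rfl
    · exact and_congr_left fun _ => (JacobiDiagram.isLeg_union_inr _ _ _).symm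
    · exact Iff.rfl
    · exact Iff.rfl
    · exact Iff.rfl
  one_mul := by
    rintro ⟨a⟩
    refine Quotient.sound ⟨_, JacobiDiagram.isRegluing_empty_union _, ?_⟩
    rintro (⟨⟨⟩⟩ | x) (⟨⟨⟩⟩ | y)
    exact Iff.rfl
  mul_one := by
    rintro ⟨a⟩
    refine Quotient.sound ⟨_, JacobiDiagram.isRegluing_union_empty _, ?_⟩
    rintro (x | ⟨⟨⟩⟩) (y | ⟨⟨⟩⟩)
    exact Iff.rfl

theorem mk_mul (D E : StrandDiagram p) : mk D * mk E = mk (D.stack E) := rfl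

end StrandClass

/-! ## The algebras `𝓑(p)` and `𝓐(p)` -/

section Algebras

open MonoidAlgebra (of)

/-- The linear span of a set of elements of a monoid algebra that is closed under left
multiplication by the elements of the monoid, as an ideal. -/
def spanIdeal {F : Type*} [Field F] {M : Type*} [Monoid M] (S : Set (MonoidAlgebra F M))
    (hS : ∀ m, ∀ x ∈ S, of F M m * x ∈ S) : Ideal (MonoidAlgebra F M) where
  carrier := Submodule.span F S
  add_mem' := Submodule.add_mem _
  zero_mem' := Submodule.zero_mem _
  smul_mem' c x hx := by
    change c * x ∈ Submodule.span F S
    induction c using MonoidAlgebra.induction_on with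
    | of m =>
      induction hx using Submodule.span_induction with
      | mem x hx => exact Submodule.subset_span (hS m x hx)
      | zero => simp
      | add x y _ _ h1 h2 => rw [mul_add]; exact Submodule.add_mem _ h1 h2
      | smul r x _ h => rw [mul_smul_comm]; exact Submodule.smul_mem _ _ h
    | add a b h1 h2 => rw [add_mul]; exact Submodule.add_mem _ h1 h2
    | smul r a h => rw [smul_mul_assoc]; exact Submodule.smul_mem _ _ h

theorem mem_spanIdeal {F : Type*} [Field F] {M : Type*} [Monoid M] {S : Set (MonoidAlgebra F M)}
    {hS : ∀ m, ∀ x ∈ S, of F M m * x ∈ S} {x : MonoidAlgebra F M} :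
    x ∈ spanIdeal S hS ↔ x ∈ Submodule.span F S := Iff.rfl

theorem spanIdeal_isTwoSided {F : Type*} [Field F] {M : Type*} [Monoid M]
    {S : Set (MonoidAlgebra F M)} {hS : ∀ m, ∀ x ∈ S, of F M m * x ∈ S}
    (hS' : ∀ m, ∀ x ∈ S, x * of F M m ∈ S) : (spanIdeal S hS).IsTwoSided where
  mul_mem_of_left {x} c hx := by
    rw [mem_spanIdeal] at hx ⊢
    induction c using MonoidAlgebra.induction_on with
    | of m =>
      induction hx using Submodule.span_induction with
      | mem x hx => exact Submodule.subset_span (hS' m x hx)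
      | zero => simp
      | add x y _ _ h1 h2 => rw [add_mul]; exact Submodule.add_mem _ h1 h2
      | smul r x _ h => rw [smul_mul_assoc]; exact Submodule.smul_mem _ _ h
    | add a b h1 h2 => rw [mul_add]; exact Submodule.add_mem _ h1 h2
    | smul r a h => rw [mul_smul_comm]; exact Submodule.smul_mem _ _ h

/-- The antisymmetry and IHX relations between coloured Jacobi diagrams. `as`: reversing the cyclic
order at one trivalent vertex (equivalently, exchanging what is attached to two of its half-edges)
changes the sign. `ihx`: if an edge joins two vertices `(h, a, b)` and `(k, c, d)`, then the sum
over the cyclic permutations of what is attached to `a`, `b`, `c` is zero. -/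
inductive JacobiRelation (F : Type*) [Field F] (p : ℕ) :
    MonoidAlgebra F (JacobiClass p) → Prop
  | as (D E : JacobiDiagram p) (h : D.H) (f : D.H ≃ E.H) (hh : ¬ D.IsLeg h)
      (hf : D.IsRegluing E (D.flip h) f) :
      JacobiRelation F p (of F _ (JacobiClass.mk D) + of F _ (JacobiClass.mk E))
  | ihx (D E G : JacobiDiagram p) (h : D.H) (f : D.H ≃ E.H) (g : D.H ≃ G.H) (hh : D.IsInner h)
      (hf : D.IsRegluing E (D.turn h) f) (hg : D.IsRegluing G (D.turn h)⁻¹ g) :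
      JacobiRelation F p (of F _ (JacobiClass.mk D) + of F _ (JacobiClass.mk E) +
        of F _ (JacobiClass.mk G))

theorem JacobiRelation.of_mul {F : Type*} [Field F] {p : ℕ} (m : JacobiClass p)
    (x : MonoidAlgebra F (JacobiClass p)) (hx : JacobiRelation F p x) :
    JacobiRelation F p (of F _ m * x) := by
  obtain ⟨A, rfl⟩ : ∃ A, JacobiClass.mk A = m := Quotient.exists_rep m
  cases hx with
  | as D E h f hh hf =>
    simp only [mul_add, ← map_mul, JacobiClass.mk_mul]
    refine .as _ _ (Sum.inr h) (Equiv.sumCongr (Equiv.refl _) f)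
      (by rwa [JacobiDiagram.isLeg_union_inr]) ?_
    rw [JacobiDiagram.flip_union_inr]
    exact (JacobiDiagram.IsRegluing.refl A).union hf
  | ihx D E G h f g hh hf hg =>
    simp only [mul_add, ← map_mul, JacobiClass.mk_mul]
    refine .ihx _ _ _ (Sum.inr h) (Equiv.sumCongr (Equiv.refl _) f)
      (Equiv.sumCongr (Equiv.refl _) g) (hh.union_inr A) ?_ ?_
    · rw [JacobiDiagram.turn_union_inr]
      exact (JacobiDiagram.IsRegluing.refl A).union hf
    · rw [JacobiDiagram.turn_union_inr]
      exact (JacobiDiagram.IsRegluing.refl A).union hg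

open Classical in
/-- The relations between generalized chord diagrams: antisymmetry, IHX, and
STU: `S = T - U`, where `T` has legs `x`, `y` in neighbouring points of a strand (`x` first), `U`
is `T` with what is attached to `x` and `y` exchanged, and `S` is `T` with `x` and `y` merged. -/
inductive StrandRelation (F : Type*) [Field F] (p : ℕ) :
    MonoidAlgebra F (StrandClass p) → Prop
  | as (D E : StrandDiagram p) (h : D.H) (f : D.H ≃ E.H) (hh : ¬ D.IsLeg h)
      (hf : D.IsRegluing E (D.flip h) f) :
      StrandRelation F p (of F _ (StrandClass.mk D) + of F _ (StrandClass.mk E))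
  | ihx (D E G : StrandDiagram p) (h : D.H) (f : D.H ≃ E.H) (g : D.H ≃ G.H) (hh : D.IsInner h)
      (hf : D.IsRegluing E (D.turn h) f) (hg : D.IsRegluing G (D.turn h)⁻¹ g) :
      StrandRelation F p (of F _ (StrandClass.mk D) + of F _ (StrandClass.mk E) +
        of F _ (StrandClass.mk G))
  | stu (S T U : StrandDiagram p) (x y : T.H) (f : T.H ≃ U.H) (g : T.H ⊕ Bool ≃ S.H)
      (hxy : T.Adjacent x y) (hf : T.IsRegluing U (Equiv.swap x y) f)
      (hg : T.IsMerging x y S g) :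
      StrandRelation F p (of F _ (StrandClass.mk S) -
        (of F _ (StrandClass.mk T) - of F _ (StrandClass.mk U)))

theorem StrandRelation.of_mul {F : Type*} [Field F] {p : ℕ} (m : StrandClass p)
    (x : MonoidAlgebra F (StrandClass p)) (hx : StrandRelation F p x) :
    StrandRelation F p (of F _ m * x) := by
  obtain ⟨A, rfl⟩ : ∃ A, StrandClass.mk A = m := Quotient.exists_rep m
  cases hx with
  | as D E h f hh hf =>
    simp only [mul_add, ← map_mul, StrandClass.mk_mul]
    refine .as _ _ (Sum.inr h) (Equiv.sumCongr (Equiv.refl _) f)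
      ((JacobiDiagram.isLeg_union_inr _ _ _).not.2 hh) ?_
    have := (StrandDiagram.IsRegluing.refl A).stack hf
    rwa [← JacobiDiagram.flip_union_inr A.toJacobiDiagram] at this
  | ihx D E G h f g hh hf hg =>
    simp only [mul_add, ← map_mul, StrandClass.mk_mul]
    refine .ihx _ _ _ (Sum.inr h) (Equiv.sumCongr (Equiv.refl _) f)
      (Equiv.sumCongr (Equiv.refl _) g) (hh.union_inr _) ?_ ?_
    · have := (StrandDiagram.IsRegluing.refl A).stack hf
      rwa [← JacobiDiagram.turn_union_inr A.toJacobiDiagram] at this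
    · have := (StrandDiagram.IsRegluing.refl A).stack hg
      rwa [← JacobiDiagram.one_sumCongr_inv,
        ← JacobiDiagram.turn_union_inr A.toJacobiDiagram] at this
  | stu S T U x y f g hxy hf hg =>
    simp only [mul_sub, ← map_mul, StrandClass.mk_mul]
    refine .stu _ _ _ (Sum.inr x) (Sum.inr y) (Equiv.sumCongr (Equiv.refl _) f) _
      (hxy.stack_inr A) ?_ (hg.stack_left hxy A)
    have := (StrandDiagram.IsRegluing.refl A).stack hf
    rwa [← JacobiDiagram.swap_inr] at this

theorem StrandRelation.mul_of {F : Type*} [Field F] {p : ℕ} (m : StrandClass p)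
    (x : MonoidAlgebra F (StrandClass p)) (hx : StrandRelation F p x) :
    StrandRelation F p (x * of F _ m) := by
  obtain ⟨A, rfl⟩ : ∃ A, StrandClass.mk A = m := Quotient.exists_rep m
  cases hx with
  | as D E h f hh hf =>
    simp only [add_mul, ← map_mul, StrandClass.mk_mul]
    refine .as _ _ (Sum.inl h) (Equiv.sumCongr f (Equiv.refl _))
      ((JacobiDiagram.isLeg_union_inl _ _ _).not.2 hh) ?_
    have := hf.stack (StrandDiagram.IsRegluing.refl A)
    rwa [← JacobiDiagram.flip_union_inl _ A.toJacobiDiagram] at this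
  | ihx D E G h f g hh hf hg =>
    simp only [add_mul, ← map_mul, StrandClass.mk_mul]
    refine .ihx _ _ _ (Sum.inl h) (Equiv.sumCongr f (Equiv.refl _))
      (Equiv.sumCongr g (Equiv.refl _)) (hh.union_inl _) ?_ ?_
    · have := hf.stack (StrandDiagram.IsRegluing.refl A)
      rwa [← JacobiDiagram.turn_union_inl _ A.toJacobiDiagram] at this
    · have := hg.stack (StrandDiagram.IsRegluing.refl A)
      rwa [← JacobiDiagram.sumCongr_one_inv,
        ← JacobiDiagram.turn_union_inl _ A.toJacobiDiagram] at this
  | stu S T U x y f g hxy hf hg =>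
    simp only [sub_mul, ← map_mul, StrandClass.mk_mul]
    refine .stu _ _ _ (Sum.inl x) (Sum.inl y) (Equiv.sumCongr f (Equiv.refl _)) _
      (hxy.stack_inl A) ?_ (hg.stack_right hxy A)
    have := hf.stack (StrandDiagram.IsRegluing.refl A)
    rwa [← JacobiDiagram.swap_inl] at this

/-- The linear span of the relations between coloured Jacobi diagrams. -/
def relationsB (F : Type*) [Field F] (p : ℕ) : Ideal (MonoidAlgebra F (JacobiClass p)) :=
  spanIdeal {x | JacobiRelation F p x} JacobiRelation.of_mul

/-- `𝓑(p)`: the vector space generated by the `p`-coloured Jacobi diagrams modulo antisymmetry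
and IHX, with the commutative multiplication given by disjoint union. -/
abbrev AlgB (F : Type*) [Field F] (p : ℕ) := MonoidAlgebra F (JacobiClass p) ⧸ relationsB F p

/-- The linear span of the relations between generalized chord diagrams. -/
def relationsA (F : Type*) [Field F] (p : ℕ) : Ideal (MonoidAlgebra F (StrandClass p)) :=
  spanIdeal {x | StrandRelation F p x} StrandRelation.of_mul

instance (F : Type*) [Field F] (p : ℕ) : (relationsA F p).IsTwoSided :=
  spanIdeal_isTwoSided StrandRelation.mul_of

/-- `𝓐(p)`: the vector space generated by the generalized chord diagrams on `p` strands modulo the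
STU relation and its consequences antisymmetry and IHX, with the multiplication given by
stacking. -/
abbrev AlgA (F : Type*) [Field F] (p : ℕ) := MonoidAlgebra F (StrandClass p) ⧸ relationsA F p

/-- The class of a coloured Jacobi diagram in `𝓑(p)`. -/
noncomputable def AlgB.mk (F : Type*) [Field F] {p : ℕ} (D : JacobiDiagram p) : AlgB F p :=
  Ideal.Quotient.mk (relationsB F p) (of F _ (JacobiClass.mk D))

/-- The class of a generalized chord diagram in `𝓐(p)`. -/
noncomputable def AlgA.mk (F : Type*) [Field F] {p : ℕ} (D : StrandDiagram p) : AlgA F p :=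
  Ideal.Quotient.mk (relationsA F p) (of F _ (StrandClass.mk D))

theorem AlgA.mk_eq_zero {F : Type*} [Field F] {p : ℕ} {x : MonoidAlgebra F (StrandClass p)}
    (h : StrandRelation F p x) : Ideal.Quotient.mk (relationsA F p) x = 0 :=
  Ideal.Quotient.eq_zero_iff_mem.2 (Submodule.subset_span h)

end Algebras

/-! ## The symmetrization map -/

/-- All ways to attach the legs of `D` to the strands. -/
abbrev JacobiDiagram.Attachment {p : ℕ} (D : JacobiDiagram p) : Type :=
  {lt : D.H → D.H → Prop // D.IsAttachment lt}

namespace JacobiDiagram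

variable {p : ℕ}

instance (D : JacobiDiagram p) : Finite D.Attachment := by
  have := D.finite
  exact Subtype.finite

/-- The generalized chord diagram given by `D` and an attachment of its legs. -/
def attach (D : JacobiDiagram p) (r : D.Attachment) : StrandDiagram p := ⟨D, r.1, r.2⟩

/-- The average, in `𝓐(p)`, of all ways to attach the legs of `D` to the strands according to their
colours. If `D` has `k i` legs of colour `i`, there are `∏ i, (k i)!` ways. -/
noncomputable def symmetrize (F : Type*) [Field F] (D : JacobiDiagram p) : AlgA F p :=
  (Nat.card D.Attachment : F)⁻¹ • ∑ᶠ r : D.Attachment, AlgA.mk F (D.attach r)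

theorem IsAttachment.transport {D E : JacobiDiagram p} {π : Equiv.Perm D.H} {f : D.H ≃ E.H}
    (hf : D.IsRegluing E π f) (lt : D.H → D.H → Prop) :
    D.IsAttachment lt ↔ E.IsAttachment (fun a b => lt (f.symm a) (f.symm b)) := by
  constructor
  · intro h
    constructor
    · intro a b hab
      obtain ⟨h1, h2, h3⟩ := h.legs _ _ hab
      have h4 := hf.color _ h1
      have h5 := hf.color _ h2
      rw [← hf.isLeg_iff] at h1 h2
      rw [f.apply_symm_apply] at h1 h2 h4 h5
      exact ⟨h1, h2, by rw [h4, h5, h3]⟩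
    · intro a
      exact h.irrefl _
    · intro a b c
      exact h.trans _ _ _
    · intro a b ha hb hc hab
      rw [← f.apply_symm_apply a, hf.isLeg_iff] at ha
      rw [← f.apply_symm_apply b, hf.isLeg_iff] at hb
      refine h.total _ _ ha hb ?_ (fun e => hab (f.symm.injective e))
      rw [← hf.color _ ha, ← hf.color _ hb, f.apply_symm_apply, f.apply_symm_apply, hc]
  · intro h
    have key : ∀ a b, lt a b ↔ lt (f.symm (f a)) (f.symm (f b)) := by simp
    constructor
    · intro a b hab
      obtain ⟨h1, h2, h3⟩ := h.legs (f a) (f b) ((key a b).1 hab)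
      rw [hf.isLeg_iff] at h1 h2
      refine ⟨h1, h2, ?_⟩
      rw [← hf.color a h1, ← hf.color b h2, h3]
    · intro a ha
      exact h.irrefl (f a) ((key a a).1 ha)
    · intro a b c h1 h2
      exact (key a c).2 (h.trans (f a) (f b) (f c) ((key a b).1 h1) ((key b c).1 h2))
    · intro a b ha hb hc hab
      rw [key a b, key b a]
      refine h.total (f a) (f b) ((hf.isLeg_iff a).2 ha) ((hf.isLeg_iff b).2 hb) ?_
        (fun e => hab (f.injective e))
      rw [hf.color a ha, hf.color b hb, hc]

/-- Attachments of a diagram correspond to attachments of a reglued diagram. -/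
def IsRegluing.attachmentEquiv {D E : JacobiDiagram p} {π : Equiv.Perm D.H} {f : D.H ≃ E.H}
    (hf : D.IsRegluing E π f) : D.Attachment ≃ E.Attachment :=
  Equiv.subtypeEquiv
    ⟨fun lt a b => lt (f.symm a) (f.symm b), fun lt a b => lt (f a) (f b),
      fun lt => by funext a b; simp, fun lt => by funext a b; simp⟩
    (IsAttachment.transport hf)

theorem IsRegluing.attach {D E : JacobiDiagram p} {π : Equiv.Perm D.H} {f : D.H ≃ E.H}
    (hf : D.IsRegluing E π f) (r : D.Attachment) :
    (D.attach r).IsRegluing (E.attach (hf.attachmentEquiv r)) π f := by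
  refine ⟨hf, fun a b => ?_⟩
  have key : ∀ a b : D.H, r.1 (f.symm (f a)) (f.symm (f b)) ↔ r.1 a b := by simp
  exact key a b

theorem IsRegluing.symmetrize (F : Type*) [Field F] {D E : JacobiDiagram p}
    {π : Equiv.Perm D.H} {f : D.H ≃ E.H} (hf : D.IsRegluing E π f) :
    E.symmetrize F = (Nat.card D.Attachment : F)⁻¹ •
      ∑ᶠ r : D.Attachment, AlgA.mk F (E.attach (hf.attachmentEquiv r)) := by
  rw [JacobiDiagram.symmetrize, Nat.card_congr hf.attachmentEquiv]
  exact congrArg _ (finsum_comp_equiv hf.attachmentEquiv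
    (f := fun r : E.Attachment => AlgA.mk F (E.attach r))).symm

theorem Iso.symmetrize_eq (F : Type*) [Field F] {D E : JacobiDiagram p} (h : Iso D E) :
    D.symmetrize F = E.symmetrize F := by
  obtain ⟨f, hf⟩ := h
  rw [hf.symmetrize F, JacobiDiagram.symmetrize]
  congr 1
  refine finsum_congr fun r => ?_
  have : StrandClass.mk (D.attach r) = StrandClass.mk (E.attach (hf.attachmentEquiv r)) :=
    Quotient.sound ⟨f, hf.attach r⟩
  rw [AlgA.mk, AlgA.mk, this]

end JacobiDiagram

/-- `JacobiDiagram.symmetrize` on isomorphism classes. -/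
noncomputable def JacobiClass.symmetrize (F : Type*) [Field F] {p : ℕ} :
    JacobiClass p → AlgA F p :=
  Quotient.lift (JacobiDiagram.symmetrize F) fun _ _ => JacobiDiagram.Iso.symmetrize_eq F

/-- The symmetrization map before passing to the quotient `𝓑(p)`. -/
noncomputable def preChi (F : Type*) [Field F] (p : ℕ) :
    MonoidAlgebra F (JacobiClass p) →ₗ[F] AlgA F p :=
  Finsupp.linearCombination F (JacobiClass.symmetrize F) ∘ₗ
    (MonoidAlgebra.coeffLinearEquiv F).toLinearMap

theorem preChi_of (F : Type*) [Field F] {p : ℕ} (D : JacobiDiagram p) :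
    preChi F p (MonoidAlgebra.of F _ (JacobiClass.mk D)) = D.symmetrize F := by
  have h : (MonoidAlgebra.coeffLinearEquiv F) (MonoidAlgebra.of F _ (JacobiClass.mk D)) =
      Finsupp.single (JacobiClass.mk D) (1 : F) := rfl
  rw [preChi, LinearMap.comp_apply, LinearEquiv.coe_coe, h, Finsupp.linearCombination_single,
    one_smul]
  rfl

theorem preChi_relation (F : Type*) [Field F] (p : ℕ) (x : MonoidAlgebra F (JacobiClass p))
    (hx : JacobiRelation F p x) : preChi F p x = 0 := by
  cases hx with
  | as D E h f hh hf =>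
    rw [map_add, preChi_of, preChi_of, hf.symmetrize F, JacobiDiagram.symmetrize, ← smul_add,
      ← finsum_add_distrib (Set.toFinite _) (Set.toFinite _),
      finsum_eq_zero_of_forall_eq_zero, smul_zero]
    intro r
    rw [AlgA.mk, AlgA.mk, ← map_add]
    exact AlgA.mk_eq_zero (.as (D.attach r) _ h f hh (hf.attach r))
  | ihx D E G h f g hh hf hg =>
    rw [map_add, map_add, preChi_of, preChi_of, preChi_of, hf.symmetrize F, hg.symmetrize F,
      JacobiDiagram.symmetrize, ← smul_add, ← smul_add,
      ← finsum_add_distrib (Set.toFinite _) (Set.toFinite _),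
      ← finsum_add_distrib (Set.toFinite _) (Set.toFinite _),
      finsum_eq_zero_of_forall_eq_zero, smul_zero]
    intro r
    rw [AlgA.mk, AlgA.mk, AlgA.mk, ← map_add, ← map_add]
    exact AlgA.mk_eq_zero (.ihx (D.attach r) _ _ h f g hh (hf.attach r) (hg.attach r))

/-- The symmetrization map `χ : 𝓑(p) → 𝓐(p)`. It sends the class of a coloured Jacobi diagram `D`
to `D.symmetrize F`. -/
noncomputable def chi (F : Type*) [Field F] (p : ℕ) : AlgB F p →ₗ[F] AlgA F p :=
  ((relationsB F p).restrictScalars F).liftQ (preChi F p)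
      (Submodule.span_le.2 (preChi_relation F p)) ∘ₗ
    (Submodule.Quotient.restrictScalarsEquiv F (relationsB F p)).symm.toLinearMap

theorem chi_mk (F : Type*) [Field F] {p : ℕ} (D : JacobiDiagram p) :
    chi F p (AlgB.mk F D) = D.symmetrize F :=
  preChi_of F D

/-! ## Deframing for two strands -/

/-- The subalgebra `𝓑'(2)` of `𝓑(2)` generated by all connected Jacobi diagrams except the struts
`b₁` and `b₂`, whose two legs have the same colour. -/
noncomputable def subB (F : Type*) [Field F] : Subalgebra F (AlgB F 2) :=
  Algebra.adjoin F {x | ∃ D : JacobiDiagram 2, D.Connected ∧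
    (∀ i, ¬ D.Iso (JacobiDiagram.strut i)) ∧ x = AlgB.mk F D}

/-- The subalgebra `𝓐'(2)` of `𝓐(2)` generated by all connected diagrams (that is, whose graph
without the strands is connected) except the diagrams `a₁` and `a₂`, which consist of one chord with
both ends on the same strand. -/
noncomputable def subA (F : Type*) [Field F] : Subalgebra F (AlgA F 2) :=
  Algebra.adjoin F {x | ∃ D : StrandDiagram 2, D.toJacobiDiagram.Connected ∧
    (∀ i, ¬ D.Iso (StrandDiagram.chord i)) ∧ x = AlgA.mk F D}

/-- The two-sided ideal `⟨a₁, a₂⟩` of `𝓐(2)` (the 1-term relations). -/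
noncomputable def oneTermIdeal (F : Type*) [Field F] : TwoSidedIdeal (AlgA F 2) :=
  TwoSidedIdeal.span (Set.range fun i : Fin 2 => AlgA.mk F (StrandDiagram.chord i))

/-- The next half-edge in the wheel with seven legs: `(i, 0)` is the half-edge at the `i`-th leg,
`(i, 1)` is the inner end of this leg, and `(i, 2)`, `(i, 3)` are the half-edges of the rim that
lead from the `i`-th vertex of the rim to the following and to the preceding one. -/
def wheelNext : ZMod 7 × Fin 4 → ZMod 7 × Fin 4
  | (i, 0) => (i, 0)
  | (i, 1) => (i, 2)
  | (i, 2) => (i, 3)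
  | (i, 3) => (i, 1)

/-- The edges of the wheel with seven legs. -/
def wheelEdge : ZMod 7 × Fin 4 → ZMod 7 × Fin 4
  | (i, 0) => (i, 1)
  | (i, 1) => (i, 0)
  | (i, 2) => (i + 1, 3)
  | (i, 3) => (i - 1, 2)

/-- The heptapus: a circle with seven outward legs, coloured cyclically by
`1, 1, 2, 1, 2, 2, 2` (here the colours 1 and 2 are written `0` and `1`). -/
def heptapus : JacobiDiagram 2 where
  H := ZMod 7 × Fin 4
  finite := inferInstanceAs (Finite (Fin 7 × Fin 4))
  edge := ⟨wheelEdge, wheelEdge, by decide, by decide⟩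
  next := ⟨wheelNext, wheelNext ∘ wheelNext, by decide, by decide⟩
  color := fun h => (![0, 0, 1, 0, 1, 1, 1] : Fin 7 → Fin 2) h.1
  edge_edge := by decide
  edge_ne := by decide
  next_next_next := by decide
  legged := by
    have h0 : ∀ i : ZMod 7, wheelNext (i, 0) = (i, 0) := by decide
    rintro ⟨i, k⟩
    refine ⟨(i, 0), h0 i, ?_⟩
    have h1 : Relation.EqvGen (fun a b => b = wheelEdge a ∨ b = wheelNext a) (i, 1) (i, 0) :=
      .rel _ _ (Or.inl rfl)
    have h3 : Relation.EqvGen (fun a b => b = wheelEdge a ∨ b = wheelNext a) (i, 3) (i, 0) :=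
      .trans _ _ _ (.rel _ _ (Or.inr rfl)) h1
    have h2 : Relation.EqvGen (fun a b => b = wheelEdge a ∨ b = wheelNext a) (i, 2) (i, 0) :=
      .trans _ _ _ (.rel _ _ (Or.inr rfl)) h3
    fin_cases k
    · exact .refl _
    · exact h1
    · exact h2
    · exact h3

/-! The proof constructs an inverse `σ` of `χ` and follows the framing chords through both maps.

Inverse. An element of `𝓐(p)` is represented by a Jacobi diagram `D` with an ordering of its legs. A
single list of all the legs, of all colours, is used, because exchanging legs of different colours
has no effect on the strands. By STU, exchanging neighbouring legs of equal colour changes the class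
by the diagram in which the two legs are merged, and this diagram has one leg less. So `σ` can be
defined by recursion on the number of legs: for fixed `D` one needs a function of the orderings with
prescribed differences under adjacent exchanges. The relations between adjacent transpositions
follow from the Coxeter relations, so such a function exists if the prescribed differences satisfy
three identities (`List.exists_potential`). Antisymmetry gives the one for `s² = 1`. The one for
distant exchanges holds because merging two disjoint pairs of legs can be done in either order. IHX,
read as the Jacobi identity for merging, gives the braid relation. The function is unique up to a
constant, and the constant is fixed by requiring that the average over all attachments be `D` itself
(`IsNormalized`).

In characteristic zero, a function of the orderings vanishes if its differences and its average
vanish (`IsListing.eq_zero`). Applied inductively, this shows that `σ` respects isomorphism, AS and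
IHX (`SigmaProps.succ`), and that `χ σ = 1` (`chi_sigma`). The equation `σ χ = 1` is the
normalization.

Subalgebras. `subA` and `subB` are the spans of the diagrams without a strut whose ends have equal
colours (`subA_eq_span`, `subB_eq_span`). On the side of `𝓐(2)` this holds because, up to diagrams
with fewer legs, the components can be moved until they are stacked. Attaching legs does not change
the graph, and merging legs never creates a strut (`NoStrut.merge`). Hence `χ` and `σ` both preserve
these spans, which is the Lemma. The heptapus contains no strut.

Quotient. Surjectivity of `𝓐'(2) → 𝓐(2)/⟨a₁, a₂⟩` is again an induction on legs: up to fewer legs, a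
framing chord can be moved to the front. For injectivity, the operator `Δᵢ` that removes framing
chords on strand `i` in all possible ways is well defined on `𝓐(2)`, locally nilpotent, zero on
`𝓐'(2)`, and satisfies `[Δᵢ, aⱼ] = 2 δᵢⱼ`. The chords are central (`chord_mul_comm`), so the ideal
is `a₁ 𝓐 + a₂ 𝓐`, and a Taylor expansion in `aᵢ` with respect to `Δᵢ` shows that it meets `𝓐'(2)`
only in zero (`exists_eq_mul_of_locallyNilpotent`). -/

/-! ## Linear orders as lists -/

namespace List

variable {α β V : Type*}

/-- Some occurrence of `a` in the list precedes an occurrence of `b`. -/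
def Before (a b : α) : List α → Prop
  | [] => False
  | c :: l => (a = c ∧ b ∈ l) ∨ Before a b l

@[simp] theorem not_before_nil (a b : α) : ¬ Before a b [] := id

theorem before_cons {a b c : α} {l : List α} :
    Before a b (c :: l) ↔ (a = c ∧ b ∈ l) ∨ Before a b l := Iff.rfl

theorem Before.mem {a b : α} {l : List α} (h : Before a b l) : a ∈ l ∧ b ∈ l := by
  induction l with
  | nil => exact h.elim
  | cons c l ih =>
    rcases h with ⟨rfl, h⟩ | h
    · simp [h]
    · simp [ih h]

theorem before_append {a b : α} {u v : List α} :
    Before a b (u ++ v) ↔ Before a b u ∨ (a ∈ u ∧ b ∈ v) ∨ Before a b v := by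
  induction u with
  | nil => simp
  | cons c u ih => simp only [cons_append, before_cons, ih, mem_append, mem_cons]; tauto

theorem before_map {f : α → β} (hf : Function.Injective f) {a b : α} {l : List α} :
    Before (f a) (f b) (l.map f) ↔ Before a b l := by
  induction l with
  | nil => simp
  | cons c l ih => simp [before_cons, ih, hf.eq_iff]

theorem Nodup.not_before_self {l : List α} (h : l.Nodup) (a : α) : ¬ Before a a l := by
  induction l with
  | nil => simp
  | cons c l ih =>
    rw [nodup_cons] at h
    rintro (⟨rfl, h1⟩ | h1)
    · exact h.1 h1
    · exact ih h.2 h1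

theorem Before.trans {a b c : α} {l : List α} (hl : l.Nodup) (h1 : Before a b l)
    (h2 : Before b c l) : Before a c l := by
  induction l with
  | nil => exact h1.elim
  | cons d l ih =>
    rw [nodup_cons] at hl
    rcases h1 with ⟨rfl, h1⟩ | h1 <;> rcases h2 with ⟨rfl, h2⟩ | h2
    · exact Or.inl ⟨rfl, h2⟩
    · exact Or.inl ⟨rfl, h2.mem.2⟩
    · exact (hl.1 h1.mem.2).elim
    · exact Or.inr (ih hl.2 h1 h2)

theorem before_total {a b : α} {l : List α} (ha : a ∈ l) (hb : b ∈ l) (hab : a ≠ b) :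
    Before a b l ∨ Before b a l := by
  induction l with
  | nil => simp at ha
  | cons c l ih => simp only [mem_cons] at ha hb; simp only [before_cons]; grind

theorem Pairwise.of_before {R : α → α → Prop} {l : List α} (h : l.Pairwise R) {a b : α}
    (hab : Before a b l) : R a b := by
  induction l with
  | nil => exact hab.elim
  | cons c l ih =>
    rw [pairwise_cons] at h
    rcases hab with ⟨rfl, hb⟩ | hab
    · exact h.1 b hb
    · exact ih h.2 hab

/-- Adjacent exchanges generate all permutations, so it suffices to control `θ` modulo `W` under
them. The prefix `u` carries the induction on `List.Perm`: the `cons` case transfers the common head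
to `u`. -/
theorem sub_mem_of_perm [AddCommGroup V] (W : AddSubgroup V) (θ : List α → V) {l l' : List α}
    (h : l.Perm l') : ∀ u : List α, (∀ w x y v, (w ++ x :: y :: v).Perm (u ++ l) →
      θ (w ++ x :: y :: v) - θ (w ++ y :: x :: v) ∈ W) → θ (u ++ l) - θ (u ++ l') ∈ W := by
  induction h with
  | nil => intro u _; simp
  | cons a _ ih =>
    intro u hW
    have := ih (u ++ [a]) (by simpa using hW)
    simpa using this
  | swap x y l =>
    intro u hW
    exact hW _ _ _ _ (.refl _)
  | trans h1 h2 ih1 ih2 =>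
    intro u hW
    have h3 := ih1 u hW
    have h4 := ih2 u fun w x y v hp => hW w x y v (hp.trans (h1.symm.append_left u))
    have := W.add_mem h3 h4
    rwa [sub_add_sub_cancel] at this

/-! ### Functions of the orderings with prescribed differences -/

section Potential

variable [AddCommGroup V]

/-- The sum of the values of `c` at the exchanges that move `m` from between `u` and the following
list to the end. -/
def moveSum (c : List α → α → α → List α → V) (m : α) : List α → List α → V
  | _, [] => 0
  | u, z :: v => c u m z v + moveSum c m (u ++ [z]) v

/-- The letter `m` can travel to the end before or after the exchange of `x` and `y`, which lie to
its left. The two routes bound a ladder of squares, one for each letter that `m` passes, and the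
square identities add up. The list `w` collects the letters between `y` and the current position of
`m`. -/
theorem moveSum_comm_left {c : List α → α → α → List α → V} {m x y : α} {u : List α} :
    ∀ (v w : List α),
    (∀ w' z v', (w' ++ z :: v').Perm (w ++ v) →
      c u x y (w' ++ m :: z :: v') + c (u ++ y :: x :: w') m z v' =
        c (u ++ x :: y :: w') m z v' + c u x y (w' ++ z :: m :: v')) →
    moveSum c m (u ++ x :: y :: w) v + c u x y (w ++ v ++ [m]) =
      c u x y (w ++ m :: v) + moveSum c m (u ++ y :: x :: w) v
  | [], w, _ => by simp [moveSum]
  | z :: v, w, h => by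
    have h1 := moveSum_comm_left (c := c) (m := m) (x := x) (y := y) (u := u) v (w ++ [z])
      (by simpa using h)
    have h2 := h w z v (.refl _)
    simp only [moveSum, append_assoc, cons_append, nil_append] at h1 ⊢
    rw [add_assoc, h1, ← add_assoc, ← h2]
    abel

/-- Let `c u x y v` be the cost of passing from `u x y v` to `u y x v`. The three hypotheses say
that the cost around the closed paths of the Coxeter presentation of the symmetric group is zero:
involution, commuting distant generators, braid relation. The potential is built by induction on the
length. Its value at `u m v` is the cost of carrying `m` to the end, plus the potential of `u v` for
the costs of exchanges made while `m` stands at the end. -/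
theorem exists_potential (l₀ : List α) : ∀ (_ : l₀.Nodup) (c : List α → α → α → List α → V)
    (_ : ∀ u x y v, (u ++ x :: y :: v).Perm l₀ → c u y x v = - c u x y v)
    (_ : ∀ u x y v z w t, (u ++ x :: y :: (v ++ z :: w :: t)).Perm l₀ →
      c u x y (v ++ z :: w :: t) + c (u ++ y :: x :: v) z w t =
        c (u ++ x :: y :: v) z w t + c u x y (v ++ w :: z :: t))
    (_ : ∀ u x y z v, (u ++ x :: y :: z :: v).Perm l₀ →
      c u x y (z :: v) + c (u ++ [y]) x z v + c u y z (x :: v) =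
        c (u ++ [x]) y z v + c u x z (y :: v) + c (u ++ [z]) x y v),
    ∃ φ : List α → V, ∀ u x y v, (u ++ x :: y :: v).Perm l₀ →
      φ (u ++ x :: y :: v) - φ (u ++ y :: x :: v) = c u x y v := by
  classical
  induction l₀ with
  | nil => exact fun _ _ _ _ _ => ⟨0, fun u x y v h => by simp at h⟩
  | cons m l₁ ih =>
    intro hn c anti square hexagon
    rw [nodup_cons] at hn
    have hm : ∀ l : List α, l.Perm l₁ → (l ++ [m]).Perm (m :: l₁) := fun l h =>
      (perm_append_singleton m l).trans (h.cons m)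
    obtain ⟨φ, hφ⟩ := ih hn.2 (fun u x y v => c u x y (v ++ [m]))
      (fun u x y v h => anti u x y _ (by simpa using hm _ h))
      (fun u x y v z w t h => by
        simpa using square u x y v z w (t ++ [m]) (by simpa using hm _ h))
      (fun u x y z v h => hexagon u x y z (v ++ [m]) (by simpa using hm _ h))
    let ψ : List α → V := fun l =>
      moveSum c m (l.takeWhile (· ≠ m)) (l.dropWhile (· ≠ m)).tail +
        φ (l.takeWhile (· ≠ m) ++ (l.dropWhile (· ≠ m)).tail)
    have hψ : ∀ u v, m ∉ u → ψ (u ++ m :: v) = moveSum c m u v + φ (u ++ v) := by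
      intro u v hu
      have h1 : ∀ a ∈ u, decide (a ≠ m) = true := fun a ha => by
        simpa using fun e : a = m => hu (e ▸ ha)
      have h2 : (u ++ m :: v).takeWhile (· ≠ m) = u := by
        rw [takeWhile_append_of_pos h1]; simp
      have h3 : (u ++ m :: v).dropWhile (· ≠ m) = m :: v := by
        rw [dropWhile_append_of_pos h1]; simp
      simp only [ψ, h2, h3, tail_cons]
    -- Exchange to the left of `m`: a ladder of squares.
    have claim₂ : ∀ u x y w v, (u ++ x :: y :: (w ++ m :: v)).Perm (m :: l₁) →
        moveSum c m (u ++ x :: y :: w) v + c u x y (w ++ v ++ [m]) =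
          c u x y (w ++ m :: v) + moveSum c m (u ++ y :: x :: w) v := by
      intro u x y w v h
      refine moveSum_comm_left v w fun w' z v' h' => square _ _ _ _ _ _ _ ?_
      refine Perm.trans ?_ h
      refine Perm.append_left u (.cons x (.cons y ?_))
      exact perm_middle.trans ((h'.cons m).trans perm_middle.symm)
    -- Exchange to the right of `m`: squares until `m` reaches `x`, one hexagon while it passes `x`
    -- and `y`, then the ladder of `claim₂`.
    have claim₁ : ∀ u₂ u₁ x y v, (u₁ ++ m :: (u₂ ++ x :: y :: v)).Perm (m :: l₁) →
        moveSum c m u₁ (u₂ ++ x :: y :: v) + c (u₁ ++ u₂) x y (v ++ [m]) =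
          c (u₁ ++ m :: u₂) x y v + moveSum c m u₁ (u₂ ++ y :: x :: v) := by
      intro u₂
      induction u₂ with
      | nil =>
        intro u₁ x y v h
        have h1 := claim₂ u₁ x y [] v (Perm.trans (Perm.append_left u₁ (by
          exact ((Perm.swap m y v).cons x).trans (Perm.swap m x _))) h)
        have h2 := hexagon u₁ m x y v h
        simp only [moveSum, append_assoc, cons_append, nil_append, append_nil] at h1 h2 ⊢
        rw [add_assoc, add_assoc, h1, ← add_assoc, ← add_assoc, h2]
        abel
      | cons z u₂ ih₂ =>
        intro u₁ x y v h
        have h1 := ih₂ (u₁ ++ [z]) x y v (Perm.trans (by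
          simpa using Perm.append_left u₁ (Perm.swap m z _)) h)
        have h2 := square u₁ m z u₂ x y v h
        simp only [moveSum, append_assoc, cons_append, nil_append] at h1 h2 ⊢
        rw [add_assoc, h1, ← add_assoc, h2]
        abel
    refine ⟨ψ, fun u x y v h => ?_⟩
    have hnd : (u ++ x :: y :: v).Nodup := h.nodup_iff.2 (nodup_cons.2 hn)
    have hmem : m ∈ u ++ x :: y :: v := h.mem_iff.2 (by simp)
    rw [nodup_append] at hnd
    obtain ⟨hu, hv, huv⟩ := hnd
    -- If `m` itself takes part in the exchange, the difference is a single summand of `moveSum`;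
    -- its sign is corrected by `anti` when `m` is the second of the two letters.
    by_cases hxm : x = m
    · subst hxm
      have h1 : x ∉ u := fun hx => huv x hx x (by simp) rfl
      have h2 : x ∉ u ++ [y] := by
        simp only [mem_append, mem_singleton, not_or]
        exact ⟨h1, fun e => by simp [e] at hv⟩
      have h3 := hψ (u ++ [y]) v h2
      rw [append_assoc, singleton_append] at h3
      rw [hψ u _ h1, h3]
      simp [moveSum]
    by_cases hym : y = m
    · subst hym
      have h1 : y ∉ u := fun hx => huv y hx y (by simp) rfl
      have h2 : y ∉ u ++ [x] := by
        simp only [mem_append, mem_singleton, not_or]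
        exact ⟨h1, fun e => hxm e.symm⟩
      have h3 := hψ (u ++ [x]) v h2
      rw [append_assoc, singleton_append] at h3
      rw [hψ u _ h1, h3]
      have h4 := anti u x y v h
      simp [moveSum, h4]
    simp only [mem_append, mem_cons] at hmem
    have hmem : m ∈ u ∨ m ∈ v := by
      rcases hmem with h | h | h | h
      · exact Or.inl h
      · exact (hxm h.symm).elim
      · exact (hym h.symm).elim
      · exact Or.inr h
    rcases hmem with hmu | hmv
    · obtain ⟨u₁, u₂, rfl⟩ := append_of_mem hmu
      have h1 : m ∉ u₁ := by
        rw [nodup_append] at hu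
        exact fun hx => hu.2.2 m hx m (by simp) rfl
      have h2 := claim₁ u₂ u₁ x y v (by simpa using h)
      have h3 := hφ (u₁ ++ u₂) x y v (by
        have := (by simpa using h : (u₁ ++ m :: (u₂ ++ x :: y :: v)).Perm (m :: l₁))
        simpa using (perm_middle.symm.trans this).cons_inv)
      simp only [append_assoc, cons_append] at h2 h3 ⊢
      rw [hψ _ _ h1, hψ _ _ h1]
      rw [sub_eq_iff_eq_add] at h3
      rw [h3, ← add_assoc, h2]
      abel
    · obtain ⟨w, v, rfl⟩ := append_of_mem hmv
      have hmw : m ∉ w := by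
        simp only [nodup_cons, nodup_append] at hv
        exact fun hx => hv.2.2.2.2 m hx m (by simp) rfl
      have hmu : m ∉ u := fun hx => huv m hx m (by simp) rfl
      have h1 : m ∉ u ++ x :: y :: w := by simp; tauto
      have h1' : m ∉ u ++ y :: x :: w := by simp; tauto
      have h2 := claim₂ u x y w v h
      have h3 := hφ u x y (w ++ v) (by
        have : (m :: (u ++ x :: y :: (w ++ v))).Perm (m :: l₁) := Perm.trans (by
          simpa using (perm_middle (a := m) (l₁ := u ++ x :: y :: w) (l₂ := v)).symm) h
        exact this.cons_inv)
      have e1 := hψ (u ++ x :: y :: w) v h1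
      have e2 := hψ (u ++ y :: x :: w) v h1'
      simp only [append_assoc, cons_append] at e1 e2 h2 h3 ⊢
      rw [e1, e2]
      rw [sub_eq_iff_eq_add] at h3
      rw [h3, ← add_assoc, h2]
      abel

end Potential

end List

/-! ## Merging two legs -/

namespace JacobiDiagram

variable {p : ℕ}

/-- `x` and `y` are two different legs. -/
structure LegPair (D : JacobiDiagram p) (x y : D.H) : Prop where
  left : D.IsLeg x
  right : D.IsLeg y
  ne : x ≠ y

theorem LegPair.symm {D : JacobiDiagram p} {x y : D.H} (h : D.LegPair x y) : D.LegPair y x :=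
  ⟨h.right, h.left, h.ne.symm⟩

theorem IsLeg.of_next {D : JacobiDiagram p} {x h : D.H} (hx : D.IsLeg x) (hh : D.next h = x) :
    h = x := D.next.injective (hh.trans hx.symm)

open Classical in
/-- The vertices of the diagram in which the legs `x`, `y` are merged. -/
noncomputable def mergeNext (D : JacobiDiagram p) (x y : D.H) : Equiv.Perm (D.H ⊕ Bool) :=
  -- Read from right to left: `D.next` fixes the legs `x` and `y`, and the two swaps then form the
  -- cycle `stem ↦ y ↦ x ↦ stem`.
  Equiv.swap (.inr false) (.inl y) * Equiv.swap (.inl y) (.inl x) *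
    Equiv.sumCongr D.next (1 : Equiv.Perm Bool)

section

variable {D : JacobiDiagram p} {x y : D.H}

theorem LegPair.mergeNext_inl (hxy : D.LegPair x y) {h : D.H} (hx : h ≠ x) (hy : h ≠ y) :
    D.mergeNext x y (.inl h) = .inl (D.next h) := by
  have h1 : D.next h ≠ x := fun e => hx (hxy.left.of_next e)
  have h2 : D.next h ≠ y := fun e => hy (hxy.right.of_next e)
  simp [mergeNext, Equiv.swap_apply_of_ne_of_ne, h1, h2]

theorem LegPair.mergeNext_left (hxy : D.LegPair x y) :
    D.mergeNext x y (.inl x) = .inr false := by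
  have h := hxy.left
  simp only [IsLeg] at h
  simp [mergeNext, h]

theorem LegPair.mergeNext_right (hxy : D.LegPair x y) :
    D.mergeNext x y (.inl y) = .inl x := by
  have h := hxy.right
  simp only [IsLeg] at h
  simp [mergeNext, h, Equiv.swap_apply_of_ne_of_ne, hxy.ne]

theorem mergeNext_stem (D : JacobiDiagram p) (x y : D.H) :
    D.mergeNext x y (.inr false) = .inl y := by
  simp [mergeNext, Equiv.swap_apply_of_ne_of_ne]

theorem mergeNext_foot (D : JacobiDiagram p) (x y : D.H) :
    D.mergeNext x y (.inr true) = .inr true := by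
  simp [mergeNext, Equiv.swap_apply_of_ne_of_ne]

end

theorem Joined.next {D : JacobiDiagram p} (h : D.H) : D.Joined h (D.next h) :=
  .rel _ _ (Or.inr rfl)

theorem Joined.edge {D : JacobiDiagram p} (h : D.H) : D.Joined h (D.edge h) :=
  .rel _ _ (Or.inl rfl)

/-- The diagram in which the legs `x`, `y` are merged into one: there is a new trivalent vertex
`(stem, y, x)` with `stem = inr false`, whose stem leads to the new leg `inr true`. -/
noncomputable def merge (D : JacobiDiagram p) (x y : D.H) (hxy : D.LegPair x y) :
    JacobiDiagram p where
  H := D.H ⊕ Bool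
  finite := by
    have := D.finite
    infer_instance
  edge := Equiv.sumCongr D.edge Equiv.boolNot
  next := D.mergeNext x y
  -- Merging makes sense as an operation on graphs even if the colours differ; the new leg then
  -- takes the colour of `x`.
  color := Sum.elim D.color fun _ => D.color x
  edge_edge := by rintro (h | h) <;> simp [D.edge_edge]
  edge_ne := by rintro (h | h) <;> simp [D.edge_ne]
  next_next_next := by
    rintro (h | _ | _)
    · by_cases hx : h = x
      · subst hx
        rw [hxy.mergeNext_left, mergeNext_stem, hxy.mergeNext_right]
      · by_cases hy : h = y
        · subst hy
          rw [hxy.mergeNext_right, hxy.mergeNext_left, mergeNext_stem]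
        · have h1 : D.next h ≠ x := fun e => hx (hxy.left.of_next e)
          have h2 : D.next h ≠ y := fun e => hy (hxy.right.of_next e)
          have h3 : D.next (D.next h) ≠ x := fun e => h1 (hxy.left.of_next e)
          have h4 : D.next (D.next h) ≠ y := fun e => h2 (hxy.right.of_next e)
          rw [hxy.mergeNext_inl hx hy, hxy.mergeNext_inl h1 h2, hxy.mergeNext_inl h3 h4,
            D.next_next_next]
    · rw [mergeNext_stem, hxy.mergeNext_right, hxy.mergeNext_left]
    · rw [mergeNext_foot, mergeNext_foot, mergeNext_foot]
  legged := by
    set R := fun a b : D.H ⊕ Bool =>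
      b = Equiv.sumCongr D.edge Equiv.boolNot a ∨ b = D.mergeNext x y a
    have stem : Relation.EqvGen R (.inr false) (.inr true) := .rel _ _ (Or.inl rfl)
    have left : Relation.EqvGen R (.inl x) (.inr true) :=
      .trans _ _ _ (.rel _ _ (Or.inr hxy.mergeNext_left.symm)) stem
    have right : Relation.EqvGen R (.inl y) (.inr true) :=
      .trans _ _ _ (.rel _ _ (Or.inr hxy.mergeNext_right.symm)) left
    rintro (h | _ | _)
    · obtain ⟨l, hl, hc⟩ := D.legged h
      have hj : Relation.EqvGen R (.inl h) (.inl l) := by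
        clear hl
        induction hc with
        | rel a b hab =>
          rcases hab with rfl | rfl
          · exact .rel _ _ (Or.inl rfl)
          · by_cases hx : a = x
            · subst hx
              rw [show D.next a = a from hxy.left]
              exact .refl _
            · by_cases hy : a = y
              · subst hy
                rw [show D.next a = a from hxy.right]
                exact .refl _
              · exact .rel _ _ (Or.inr (hxy.mergeNext_inl hx hy).symm)
        | refl a => exact .refl _
        | symm a b _ ih => exact .symm _ _ ih
        | trans a b c _ _ ih1 ih2 => exact .trans _ _ _ ih1 ih2
      by_cases hx : l = x
      · subst hx
        exact ⟨_, mergeNext_foot D _ _, .trans _ _ _ hj left⟩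
      · by_cases hy : l = y
        · subst hy
          exact ⟨_, mergeNext_foot D _ _, .trans _ _ _ hj right⟩
        · exact ⟨.inl l, by rw [hxy.mergeNext_inl hx hy, hl], hj⟩
    · exact ⟨_, mergeNext_foot D _ _, stem⟩
    · exact ⟨_, mergeNext_foot D _ _, .refl _⟩

section

variable {D : JacobiDiagram p} {x y : D.H} (hxy : D.LegPair x y)

/-- The new leg of a merged diagram. -/
def foot : (D.merge x y hxy).H := (Sum.inr true : D.H ⊕ Bool)

/-- The half-edge at the new trivalent vertex of a merged diagram that leads to the new leg. -/
def stem : (D.merge x y hxy).H := (Sum.inr false : D.H ⊕ Bool)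

/-- A half-edge of the original diagram, as a half-edge of a merged diagram. -/
def old (h : D.H) : (D.merge x y hxy).H := (Sum.inl h : D.H ⊕ Bool)

theorem old_injective : Function.Injective (old hxy) := Sum.inl_injective

theorem old_ne_foot (h : D.H) : old hxy h ≠ foot hxy := Sum.inl_ne_inr

@[elab_as_elim]
theorem merge_cases {P : (D.merge x y hxy).H → Prop} (h1 : ∀ h, h ≠ x → h ≠ y → P (old hxy h))
    (h2 : P (old hxy x)) (h3 : P (old hxy y)) (h4 : P (stem hxy)) (h5 : P (foot hxy)) (h : (D.merge x y hxy).H) :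
    P h := by
  obtain (h | _ | _) := h
  · by_cases hx : h = x
    · subst hx; exact h2
    · by_cases hy : h = y
      · subst hy; exact h3
      · exact h1 h hx hy
  · exact h4
  · exact h5

theorem merge_edge_old (h : D.H) :
    (D.merge x y hxy).edge (old hxy h) = old hxy (D.edge h) := rfl

theorem merge_edge_stem : (D.merge x y hxy).edge (stem hxy) = foot hxy := rfl

theorem merge_edge_foot : (D.merge x y hxy).edge (foot hxy) = stem hxy := rfl

theorem merge_next_old {h : D.H} (hx : h ≠ x) (hy : h ≠ y) :
    (D.merge x y hxy).next (old hxy h) = old hxy (D.next h) := hxy.mergeNext_inl hx hy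

theorem merge_next_left : (D.merge x y hxy).next (old hxy x) = stem hxy := hxy.mergeNext_left

theorem merge_next_right : (D.merge x y hxy).next (old hxy y) = old hxy x := hxy.mergeNext_right

theorem merge_next_stem : (D.merge x y hxy).next (stem hxy) = old hxy y := mergeNext_stem D x y

theorem merge_next_foot : (D.merge x y hxy).next (foot hxy) = foot hxy := mergeNext_foot D x y

theorem merge_color_old (h : D.H) : (D.merge x y hxy).color (old hxy h) = D.color h := rfl

theorem merge_color_foot : (D.merge x y hxy).color (foot hxy) = D.color x := rfl

theorem isLeg_foot : (D.merge x y hxy).IsLeg (foot hxy) := merge_next_foot hxy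

theorem isLeg_old {h : D.H} : (D.merge x y hxy).IsLeg (old hxy h) ↔
    D.IsLeg h ∧ h ≠ x ∧ h ≠ y := by
  by_cases hx : h = x
  · subst hx
    simp only [IsLeg, merge_next_left, ne_eq, not_true_eq_false, false_and, and_false, iff_false]
    exact fun e => Sum.inr_ne_inl e
  · by_cases hy : h = y
    · subst hy
      simp only [IsLeg, merge_next_right, ne_eq, not_true_eq_false, and_false, iff_false]
      exact fun e => hxy.ne (old_injective hxy e)
    · simp only [IsLeg, merge_next_old hxy hx hy, (old_injective hxy).eq_iff]
      tauto

theorem not_isLeg_stem : ¬ (D.merge x y hxy).IsLeg (stem hxy) := by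
  simp only [IsLeg, merge_next_stem]
  exact fun e => Sum.inl_ne_inr e

end

theorem IsRegluing.legPair {D E : JacobiDiagram p} {π : Equiv.Perm D.H} {f : D.H ≃ E.H}
    (hf : D.IsRegluing E π f) {x y : D.H} (hxy : D.LegPair x y) : E.LegPair (f x) (f y) :=
  ⟨(hf.isLeg_iff x).2 hxy.left, (hf.isLeg_iff y).2 hxy.right, f.injective.ne hxy.ne⟩

theorem IsRegluing.merge {D E : JacobiDiagram p} {π : Equiv.Perm D.H} {f : D.H ≃ E.H}
    (hf : D.IsRegluing E π f) {x y : D.H} (hxy : D.LegPair x y) :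
    (D.merge x y hxy).IsRegluing (E.merge (f x) (f y) (hf.legPair hxy))
      (Equiv.sumCongr π (1 : Equiv.Perm Bool)) (Equiv.sumCongr f (Equiv.refl Bool)) where
  next := by
    have hE := hf.legPair hxy
    refine fun h => merge_cases hxy ?_ ?_ ?_ ?_ ?_ h
    · intro h hx hy
      rw [merge_next_old hxy hx hy]
      exact (merge_next_old hE (f.injective.ne hx) (f.injective.ne hy)).trans
        (congrArg _ (hf.next h))
    · rw [merge_next_left]
      exact merge_next_left hE
    · rw [merge_next_right]
      exact merge_next_right hE
    · rw [merge_next_stem]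
      exact merge_next_stem hE
    · rw [merge_next_foot]
      exact merge_next_foot hE
  edge := by
    rintro (h | h)
    · exact congrArg Sum.inl (hf.edge h)
    · rfl
  color := by
    rintro (h | h) hh
    · exact hf.color h ((isLeg_old hxy).1 hh).1
    · exact hf.color x hxy.left

theorem IsRegluing.one_merge {D E : JacobiDiagram p} {f : D.H ≃ E.H}
    (hf : D.IsRegluing E 1 f) {x y : D.H} (hxy : D.LegPair x y) :
    (D.merge x y hxy).IsRegluing (E.merge (f x) (f y) (hf.legPair hxy)) 1
      (Equiv.sumCongr f (Equiv.refl Bool)) := by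
  have h := hf.merge hxy
  rwa [show Equiv.sumCongr (1 : Equiv.Perm D.H) (1 : Equiv.Perm Bool) = 1 from
    Equiv.Perm.sumCongr_one] at h

theorem ne_of_not_isLeg {D : JacobiDiagram p} {h x : D.H} (hh : ¬ D.IsLeg h) (hx : D.IsLeg x) :
    h ≠ x := fun e => hh (e ▸ hx)

theorem not_isLeg_next {D : JacobiDiagram p} {h : D.H} (hh : ¬ D.IsLeg h) :
    ¬ D.IsLeg (D.next h) := fun e => hh (D.next.injective e)

theorem merge_next_old_of_not_isLeg {D : JacobiDiagram p} {x y : D.H} (hxy : D.LegPair x y)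
    {h : D.H} (hh : ¬ D.IsLeg h) :
    (D.merge x y hxy).next (old hxy h) = old hxy (D.next h) :=
  merge_next_old hxy (ne_of_not_isLeg hh hxy.left) (ne_of_not_isLeg hh hxy.right)

theorem not_isLeg_old {D : JacobiDiagram p} {x y : D.H} (hxy : D.LegPair x y)
    {h : D.H} (hh : ¬ D.IsLeg h) : ¬ (D.merge x y hxy).IsLeg (old hxy h) :=
  fun e => hh ((isLeg_old hxy).1 e).1

/-- Merging legs leaves the trivalent vertices of `D` untouched. So an AS or IHX relation for `D`
induces the same relation for the merged diagrams, which the induction on the number of legs uses.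
-/
theorem flip_merge {D : JacobiDiagram p} {x y : D.H} (hxy : D.LegPair x y) {h : D.H}
    (hh : ¬ D.IsLeg h) : (D.merge x y hxy).flip (old hxy h) =
      Equiv.sumCongr (D.flip h) (1 : Equiv.Perm Bool) := by
  unfold flip
  rw [merge_next_old_of_not_isLeg hxy hh, merge_next_old_of_not_isLeg hxy (not_isLeg_next hh)]
  exact swap_inl _ _

theorem turn_merge {D : JacobiDiagram p} {x y : D.H} (hxy : D.LegPair x y) {h : D.H}
    (hh : D.IsInner h) : (D.merge x y hxy).turn (old hxy h) =
      Equiv.sumCongr (D.turn h) (1 : Equiv.Perm Bool) := by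
  unfold turn
  rw [merge_next_old_of_not_isLeg hxy hh.1, merge_next_old_of_not_isLeg hxy (not_isLeg_next hh.1),
    merge_edge_old, merge_next_old_of_not_isLeg hxy hh.2.1]
  exact (congrArg₂ (· * ·) (swap_inl (β := Bool) _ _) (swap_inl (β := Bool) _ _)).trans
    (Equiv.Perm.sumCongr_mul _ _ _ _)

theorem IsInner.merge {D : JacobiDiagram p} {x y : D.H} (hxy : D.LegPair x y) {h : D.H}
    (hh : D.IsInner h) : (D.merge x y hxy).IsInner (old hxy h) := by
  refine ⟨not_isLeg_old hxy hh.1, not_isLeg_old hxy hh.2.1, ?_, ?_⟩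
  · rw [merge_next_old_of_not_isLeg hxy hh.1]
    exact (old_injective hxy).ne hh.2.2.1
  · rw [merge_next_old_of_not_isLeg hxy hh.1,
      merge_next_old_of_not_isLeg hxy (not_isLeg_next hh.1)]
    exact (old_injective hxy).ne hh.2.2.2

/-- A regluing can be described in two ways: keep the vertices and move the edges by `π`, or keep
the edges and move the vertices by `π⁻¹`. The second one suits merged diagrams, whose edges
correspond under an evident bijection `e`. -/
theorem IsRegluing.of_conj {D E : JacobiDiagram p} (π : Equiv.Perm D.H) (e : D.H ≃ E.H)
    (next : ∀ h, E.next (e (π⁻¹ h)) = e (π⁻¹ (D.next h))) (edge : ∀ h, E.edge (e h) = e (D.edge h))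
    (color : ∀ h, D.IsLeg h → E.color (e (π⁻¹ h)) = D.color h) :
    D.IsRegluing E π ((π⁻¹ : Equiv.Perm D.H).trans e) where
  next := next
  edge h := by simp [edge]
  color := color

/-- The half-edges of a merged diagram as half-edges of the other merged diagram. -/
def mergeSymm {D : JacobiDiagram p} {x y : D.H} (hxy : D.LegPair x y) :
    (D.merge x y hxy).H ≃ (D.merge y x hxy.symm).H := Equiv.refl (D.H ⊕ Bool)

-- The new vertices `(stem, y, x)` and `(stem, x, y)` have opposite cyclic orders, so AS applies.
-- The colours must agree because the new leg inherits the colour of the first argument of `merge`.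
open Classical in
theorem isRegluing_merge_symm {D : JacobiDiagram p} {x y : D.H} (hxy : D.LegPair x y)
    (hc : D.color x = D.color y) :
    (D.merge x y hxy).IsRegluing (D.merge y x hxy.symm) ((D.merge x y hxy).flip (stem hxy))
      (((D.merge x y hxy).flip (stem hxy))⁻¹.trans (mergeSymm hxy)) := by
  have hinv : ((D.merge x y hxy).flip (stem hxy))⁻¹ = (D.merge x y hxy).flip (stem hxy) :=
    Equiv.swap_inv _ _
  have hx : ((D.merge x y hxy).flip (stem hxy)) (old hxy x) = old hxy y := by
    simp [flip, merge_next_stem, merge_next_right]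
  have hy : ((D.merge x y hxy).flip (stem hxy)) (old hxy y) = old hxy x := by
    simp [flip, merge_next_stem, merge_next_right]
  have hold : ∀ h, h ≠ x → h ≠ y → ((D.merge x y hxy).flip (stem hxy)) (old hxy h) = old hxy h := by
    intro h h1 h2
    simp only [flip, merge_next_stem, merge_next_right]
    exact Equiv.swap_apply_of_ne_of_ne ((old_injective hxy).ne h2) ((old_injective hxy).ne h1)
  have hs : ((D.merge x y hxy).flip (stem hxy)) (stem hxy) = stem hxy := by
    simp only [flip, merge_next_stem, merge_next_right]
    exact Equiv.swap_apply_of_ne_of_ne Sum.inr_ne_inl Sum.inr_ne_inl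
  have hft : ((D.merge x y hxy).flip (stem hxy)) (foot hxy) = foot hxy := by
    simp only [flip, merge_next_stem, merge_next_right]
    exact Equiv.swap_apply_of_ne_of_ne Sum.inr_ne_inl Sum.inr_ne_inl
  have hxy' := hxy.symm
  refine IsRegluing.of_conj _ _ ?_ (fun h => rfl) ?_ <;> rw [hinv]
  · refine fun h => merge_cases hxy ?_ ?_ ?_ ?_ ?_ h
    · intro h h1 h2
      have h3 : D.next h ≠ x := fun e => h1 (hxy.left.of_next e)
      have h4 : D.next h ≠ y := fun e => h2 (hxy.right.of_next e)
      rw [hold h h1 h2, merge_next_old hxy h1 h2, hold _ h3 h4]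
      exact merge_next_old hxy' h2 h1
    · rw [hx, merge_next_left, hs]
      exact merge_next_left hxy'
    · rw [hy, merge_next_right, hx]
      exact merge_next_right hxy'
    · rw [hs, merge_next_stem, hy]
      exact merge_next_stem hxy'
    · rw [hft, merge_next_foot, hft]
      exact merge_next_foot hxy'
  · refine fun h => merge_cases hxy ?_ ?_ ?_ ?_ ?_ h
    · intro h h1 h2 _
      rw [hold h h1 h2]
      rfl
    · intro h
      exact absurd rfl ((isLeg_old hxy).1 h).2.1
    · intro h
      exact absurd rfl ((isLeg_old hxy).1 h).2.2
    · intro h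
      exact absurd h (not_isLeg_stem hxy)
    · intro _
      rw [hft]
      exact hc.symm

theorem LegPair.old {D : JacobiDiagram p} {x y z w : D.H} (hxy : D.LegPair x y)
    (hzw : D.LegPair z w) (hxz : z ≠ x) (hyz : z ≠ y) (hxw : w ≠ x) (hyw : w ≠ y) :
    (D.merge x y hxy).LegPair (old hxy z) (old hxy w) :=
  ⟨(isLeg_old hxy).2 ⟨hzw.left, hxz, hyz⟩, (isLeg_old hxy).2 ⟨hzw.right, hxw, hyw⟩,
    (old_injective hxy).ne hzw.ne⟩

theorem LegPair.foot_old {D : JacobiDiagram p} {x y z : D.H} (hxy : D.LegPair x y)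
    (hz : D.IsLeg z) (hx : z ≠ x) (hy : z ≠ y) :
    (D.merge x y hxy).LegPair (foot hxy) (JacobiDiagram.old hxy z) :=
  ⟨isLeg_foot hxy, (isLeg_old hxy).2 ⟨hz, hx, hy⟩, (old_ne_foot hxy z).symm⟩

/-- The exchange of the summands of type `Bool`. -/
def sumRightComm (α : Type) : (α ⊕ Bool) ⊕ Bool ≃ (α ⊕ Bool) ⊕ Bool :=
  (Equiv.sumAssoc α Bool Bool).trans ((Equiv.sumCongr (Equiv.refl α) (Equiv.sumComm Bool Bool)).trans
    (Equiv.sumAssoc α Bool Bool).symm)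

/-- The two new vertices do not interact; only the order in which they are adjoined differs. This
closes the squares in `SigmaProps.square`. -/
theorem isRegluing_merge_comm {D : JacobiDiagram p} {x y z w : D.H} (hxy : D.LegPair x y)
    (hzw : D.LegPair z w) (hxz : z ≠ x) (hyz : z ≠ y) (hxw : w ≠ x) (hyw : w ≠ y) :
    ((D.merge x y hxy).merge _ _ (hxy.old hzw hxz hyz hxw hyw)).IsRegluing
      ((D.merge z w hzw).merge _ _ (hzw.old hxy hxz.symm hxw.symm hyz.symm hyw.symm)) 1
      (sumRightComm D.H) where
  next := by
    have h1 := hxy.old hzw hxz hyz hxw hyw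
    have h2 := hzw.old hxy hxz.symm hxw.symm hyz.symm hyw.symm
    refine fun h => merge_cases h1 ?_ ?_ ?_ ?_ ?_ h
    · refine fun h => merge_cases hxy ?_ ?_ ?_ ?_ ?_ h
      · intro h hx hy hz hw
        rw [merge_next_old h1 hz hw, merge_next_old hxy hx hy]
        have hz' : h ≠ z := fun e => hz (e ▸ rfl)
        have hw' : h ≠ w := fun e => hw (e ▸ rfl)
        exact (merge_next_old h2 ((old_injective hzw).ne hx) ((old_injective hzw).ne hy)).trans
          (congrArg _ (merge_next_old hzw hz' hw'))
      · intro hz hw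
        rw [merge_next_old h1 hz hw, merge_next_left]
        exact merge_next_left h2
      · intro hz hw
        rw [merge_next_old h1 hz hw, merge_next_right]
        exact merge_next_right h2
      · intro hz hw
        rw [merge_next_old h1 hz hw, merge_next_stem]
        exact merge_next_stem h2
      · intro hz hw
        rw [merge_next_old h1 hz hw, merge_next_foot]
        exact merge_next_foot h2
    · rw [merge_next_left]
      exact (merge_next_old h2 ((old_injective hzw).ne hxz) ((old_injective hzw).ne hyz)).trans
        (congrArg _ (merge_next_left hzw))
    · rw [merge_next_right]
      exact (merge_next_old h2 ((old_injective hzw).ne hxw) ((old_injective hzw).ne hyw)).trans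
        (congrArg _ (merge_next_right hzw))
    · rw [merge_next_stem]
      refine (merge_next_old h2 (h := stem hzw) Sum.inr_ne_inl Sum.inr_ne_inl).trans
        (congrArg _ (merge_next_stem hzw))
    · rw [merge_next_foot]
      exact (merge_next_old h2 (h := foot hzw) Sum.inr_ne_inl Sum.inr_ne_inl).trans
        (congrArg _ (merge_next_foot hzw))
  edge := by
    rintro ((h | h) | h) <;> rfl
  color := by
    rintro ((h | h) | h) _ <;> rfl

end JacobiDiagram

/-! ### Merging three legs: IHX as a Jacobi identity -/

namespace JacobiDiagram

variable {p : ℕ}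

theorem LegPair.old_foot {D : JacobiDiagram p} {x y z : D.H} (hxy : D.LegPair x y)
    (hz : D.IsLeg z) (hx : z ≠ x) (hy : z ≠ y) :
    (D.merge x y hxy).LegPair (JacobiDiagram.old hxy z) (foot hxy) := (hxy.foot_old hz hx hy).symm

section Jacobi

variable {D : JacobiDiagram p} {x y z : D.H} (hxy : D.LegPair x y) (hxz : D.LegPair x z)
  (hyz : D.LegPair y z)

/-- The diagram where `x` and `y` are merged, and the result is merged with `z`. -/
noncomputable def mergeThree : JacobiDiagram p :=
  (D.merge x y hxy).merge _ _ (hxy.foot_old hyz.right hxz.ne.symm hyz.ne.symm)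

theorem stem_ne_foot : stem hxy ≠ foot hxy := fun e => Bool.false_ne_true (Sum.inr_injective e)

/-- The half-edge of `mergeThree` in the middle of the tree formed by the new vertices. -/
noncomputable def midEdge : (mergeThree hxy hxz hyz).H :=
  old (hxy.foot_old hyz.right hxz.ne.symm hyz.ne.symm) (foot hxy)

theorem isInner_midEdge : (mergeThree hxy hxz hyz).IsInner (midEdge hxy hxz hyz) := by
  have h1 := hxy.foot_old hyz.right hxz.ne.symm hyz.ne.symm
  refine ⟨?_, ?_, ?_, ?_⟩
  · exact fun h => ((isLeg_old h1).1 h).2.1 rfl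
  · exact fun h => not_isLeg_stem hxy ((isLeg_old h1).1 h).1
  · rw [show (mergeThree hxy hxz hyz).next (midEdge hxy hxz hyz) = stem h1 from merge_next_left h1]
    exact Sum.inl_ne_inr
  · rw [show (mergeThree hxy hxz hyz).next (midEdge hxy hxz hyz) = stem h1 from merge_next_left h1,
      show (mergeThree hxy hxz hyz).next (stem h1) = old h1 (old hxy z) from merge_next_stem h1]
    exact fun e => Sum.inr_ne_inl (Sum.inl_injective e)

/-- The diagram where `y` is merged with the result of merging `x` and `z`. -/
noncomputable def mergeThreeLeft : JacobiDiagram p :=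
  (D.merge x z hxz).merge _ _ (hxz.old_foot hyz.left hxy.ne.symm hyz.ne)

/-- The vertices of `mergeThree`. -/
noncomputable def threeNext (z : D.H) : Equiv.Perm ((D.H ⊕ Bool) ⊕ Bool) :=
  (D.merge x y hxy).mergeNext (foot hxy) (old hxy z)

/-- The vertices of `mergeThreeLeft`. -/
noncomputable def threeNextLeft (y : D.H) : Equiv.Perm ((D.H ⊕ Bool) ⊕ Bool) :=
  (D.merge x z hxz).mergeNext (old hxz y) (foot hxz)

/-- Let `s`, `f` be the stem and the foot of the first merging and `s'` the stem of the second. The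
new vertices are `(s, y, x)` and `(f, s', z)`, and the inner edge is `{f, s}`. -/
theorem threeNext_table (hxy : D.LegPair x y) (hxz : D.LegPair x z)
    (hyz : D.LegPair y z) : (∀ h, h ≠ x → h ≠ y → h ≠ z →
      threeNext hxy z (.inl (.inl h)) = .inl (.inl (D.next h))) ∧
    threeNext hxy z (.inl (.inl x)) = .inl (.inr false) ∧
    threeNext hxy z (.inl (.inl y)) = .inl (.inl x) ∧
    threeNext hxy z (.inl (.inl z)) = .inl (.inr true) ∧
    threeNext hxy z (.inl (.inr false)) = .inl (.inl y) ∧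
    threeNext hxy z (.inl (.inr true)) = .inr false ∧
    threeNext hxy z (.inr false) = .inl (.inl z) ∧
    threeNext hxy z (.inr true) = .inr true := by
  have h1 := hxy.foot_old hyz.right hxz.ne.symm hyz.ne.symm
  refine ⟨fun h hx hy hz => ?_, ?_, ?_, ?_, ?_, ?_, ?_, ?_⟩
  · exact (merge_next_old h1 (old_ne_foot hxy h) ((old_injective hxy).ne hz)).trans
      (congrArg _ (merge_next_old hxy hx hy))
  · exact (merge_next_old h1 (old_ne_foot hxy x) ((old_injective hxy).ne hxz.ne)).trans
      (congrArg _ (merge_next_left hxy))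
  · exact (merge_next_old h1 (old_ne_foot hxy y) ((old_injective hxy).ne hyz.ne)).trans
      (congrArg _ (merge_next_right hxy))
  · exact merge_next_right h1
  · exact (merge_next_old h1 (stem_ne_foot hxy) Sum.inr_ne_inl).trans
      (congrArg _ (merge_next_stem hxy))
  · exact merge_next_left h1
  · exact merge_next_stem h1
  · exact merge_next_foot h1

/-- In the same notation, with `x` and `z` merged first, the new vertices are `(s, z, x)` and `(y,
s', f)`. -/
theorem threeNextLeft_table (hxy : D.LegPair x y) (hxz : D.LegPair x z)
    (hyz : D.LegPair y z) : (∀ h, h ≠ x → h ≠ y → h ≠ z →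
      threeNextLeft hxz y (.inl (.inl h)) = .inl (.inl (D.next h))) ∧
    threeNextLeft hxz y (.inl (.inl x)) = .inl (.inr false) ∧
    threeNextLeft hxz y (.inl (.inl y)) = .inr false ∧
    threeNextLeft hxz y (.inl (.inl z)) = .inl (.inl x) ∧
    threeNextLeft hxz y (.inl (.inr false)) = .inl (.inl z) ∧
    threeNextLeft hxz y (.inl (.inr true)) = .inl (.inl y) ∧
    threeNextLeft hxz y (.inr false) = .inl (.inr true) ∧
    threeNextLeft hxz y (.inr true) = .inr true := by
  have h1 := hxz.old_foot hyz.left hxy.ne.symm hyz.ne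
  refine ⟨fun h hx hy hz => ?_, ?_, ?_, ?_, ?_, ?_, ?_, ?_⟩
  · exact (merge_next_old h1 ((old_injective hxz).ne hy) (old_ne_foot hxz h)).trans
      (congrArg _ (merge_next_old hxz hx hz))
  · exact (merge_next_old h1 ((old_injective hxz).ne hxy.ne) (old_ne_foot hxz x)).trans
      (congrArg _ (merge_next_left hxz))
  · exact merge_next_left h1
  · exact (merge_next_old h1 ((old_injective hxz).ne hyz.ne.symm) (old_ne_foot hxz z)).trans
      (congrArg _ (merge_next_right hxz))
  · exact (merge_next_old h1 Sum.inr_ne_inl (stem_ne_foot hxz)).trans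
      (congrArg _ (merge_next_stem hxz))
  · exact merge_next_right h1
  · exact merge_next_stem h1
  · exact merge_next_foot h1

open Classical in
/-- The cyclic permutation `y ↦ s ↦ z ↦ y`, where `s` is the second stem. -/
noncomputable def threeTurn (y z : D.H) : Equiv.Perm ((D.H ⊕ Bool) ⊕ Bool) :=
  Equiv.swap (.inr false) (.inl (.inl z)) * Equiv.swap (.inl (.inl z)) (.inl (.inl y))

theorem threeTurn_table (hyz : y ≠ z) : (∀ h, h ≠ y → h ≠ z →
      threeTurn y z (.inl (.inl h)) = .inl (.inl h)) ∧
    threeTurn y z (.inl (.inl y)) = .inr false ∧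
    threeTurn y z (.inl (.inl z)) = .inl (.inl y) ∧
    (∀ b, threeTurn y z (.inl (.inr b)) = .inl (.inr b)) ∧
    threeTurn y z (.inr false) = .inl (.inl z) ∧
    threeTurn y z (.inr true) = .inr true := by
  refine ⟨fun h hy hz => ?_, ?_, ?_, fun b => ?_, ?_, ?_⟩ <;>
    simp [threeTurn, Equiv.swap_apply_of_ne_of_ne, *]

/-- At the inner edge `{f, s}` the half-edges turned by IHX are `a = s'`, `b = z` and `c = y`. -/
theorem turn_midEdge : (mergeThree hxy hxz hyz).turn (midEdge hxy hxz hyz) = threeTurn y z := by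
  let : DecidableEq ((D.H ⊕ Bool) ⊕ Bool) := fun a b => Classical.propDecidable (a = b)
  obtain ⟨t1, t2, t3, t4, t5, t6, t7, t8⟩ := threeNext_table hxy hxz hyz
  change Equiv.swap (threeNext hxy z (.inl (.inr true)))
    (threeNext hxy z (threeNext hxy z (.inl (.inr true)))) *
    Equiv.swap (threeNext hxy z (threeNext hxy z (.inl (.inr true))))
    (threeNext hxy z (.inl (.inr false))) = _
  rw [t6, t7, t5]
  unfold threeTurn
  congr!

/-- The half-edges of `mergeThree` as half-edges of `mergeThreeLeft`. -/
def threeLeft : (mergeThree hxy hxz hyz).H ≃ (mergeThreeLeft hxy hxz hyz).H :=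
  Equiv.refl ((D.H ⊕ Bool) ⊕ Bool)

/-- The half-edges of `mergeThree` as half-edges of the diagram where the result of merging `y` and
`z` is merged with `x`. -/
def threeRight : (mergeThree hxy hxz hyz).H ≃ (mergeThree hyz hxy.symm hxz.symm).H :=
  -- The vertex `(s, y, x)` becomes the outer vertex, where `x` joins the merged pair `y`, `z`.
  -- Hence the two halves of the inner edge trade roles, which is the `boolNot`.
  Equiv.sumCongr (Equiv.sumCongr (Equiv.refl D.H) Equiv.boolNot) (Equiv.refl Bool)

theorem threeTurn_threeNextLeft (hxy : D.LegPair x y) (hxz : D.LegPair x z)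
    (hyz : D.LegPair y z) (h : (D.H ⊕ Bool) ⊕ Bool) :
    threeTurn y z (threeNextLeft hxz y h) = threeNext hxy z (threeTurn y z h) := by
  obtain ⟨t1, t2, t3, t4, t5, t6, t7, t8⟩ := threeNext_table hxy hxz hyz
  obtain ⟨l1, l2, l3, l4, l5, l6, l7, l8⟩ := threeNextLeft_table hxy hxz hyz
  obtain ⟨c1, c2, c3, c4, c5, c6⟩ := threeTurn_table hyz.ne
  rcases h with (h | _ | _) | _ | _
  · by_cases hx : h = x
    · subst hx
      rw [l2, c4, c1 _ hxy.ne hxz.ne, t2]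
    by_cases hy : h = y
    · subst hy
      rw [l3, c5, c2, t7]
    by_cases hz : h = z
    · subst hz
      rw [l4, c3, c1 _ hxy.ne hxz.ne, t3]
    have hy' : D.next h ≠ y := fun e => hy (hxy.right.of_next e)
    have hz' : D.next h ≠ z := fun e => hz (hyz.right.of_next e)
    rw [l1 h hx hy hz, c1 _ hy' hz', c1 _ hy hz, t1 h hx hy hz]
  · rw [l5, c4, c3, t5]
  · rw [l6, c4, c2, t6]
  · rw [l7, c4, c5, t4]
  · rw [l8, c6, t8]

theorem threeNext_threeTurn (hxy : D.LegPair x y) (hxz : D.LegPair x z)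
    (hyz : D.LegPair y z) (h : (D.H ⊕ Bool) ⊕ Bool) :
    threeNext hyz x (Equiv.sumCongr (Equiv.sumCongr (Equiv.refl D.H) Equiv.boolNot)
      (Equiv.refl Bool) (threeTurn y z h)) = Equiv.sumCongr (Equiv.sumCongr (Equiv.refl D.H)
      Equiv.boolNot) (Equiv.refl Bool) (threeTurn y z (threeNext hxy z h)) := by
  obtain ⟨t1, t2, t3, t4, t5, t6, t7, t8⟩ := threeNext_table hxy hxz hyz
  obtain ⟨l1, l2, l3, l4, l5, l6, l7, l8⟩ := threeNext_table hyz hxy.symm hxz.symm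
  obtain ⟨c1, c2, c3, c4, c5, c6⟩ := threeTurn_table hyz.ne
  have hx1 := hxy.ne
  have hx2 := hxz.ne
  rcases h with (h | _ | _) | _ | _
  · by_cases hx : h = x
    · subst hx
      simp [t2, c4, c1 _ hx1 hx2, l4]
    by_cases hy : h = y
    · subst hy
      simp [t3, c1 _ hx1 hx2, c2, l7]
    by_cases hz : h = z
    · subst hz
      simp [t4, c3, c4, l2]
    have hy' : D.next h ≠ y := fun e => hy (hxy.right.of_next e)
    have hz' : D.next h ≠ z := fun e => hz (hyz.right.of_next e)
    simp [c1 _ hy' hz', c1 _ hy hz, t1 h hx hy hz, l1 h hy hz hx]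
  · simp [t5, c4, c2, l6]
  · simp [t6, c4, c5, l5]
  · simp [t7, c5, c3, l3]
  · simp [t8, c6, l8]

theorem isLeg_mergeThree {h : (D.H ⊕ Bool) ⊕ Bool} (hh : (mergeThree hxy hxz hyz).IsLeg h) :
    (∃ k, k ≠ x ∧ k ≠ y ∧ k ≠ z ∧ h = .inl (.inl k)) ∨ h = .inr true := by
  change threeNext hxy z h = h at hh
  obtain ⟨t1, t2, t3, t4, t5, t6, t7, t8⟩ := threeNext_table hxy hxz hyz
  rcases h with (h | _ | _) | _ | _
  · by_cases hx : h = x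
    · subst hx
      simp [t2] at hh
    by_cases hy : h = y
    · subst hy
      simp [t3, hxy.ne] at hh
    by_cases hz : h = z
    · subst hz
      simp [t4] at hh
    exact Or.inl ⟨h, hx, hy, hz, rfl⟩
  · simp [t5] at hh
  · simp [t6] at hh
  · simp [t7] at hh
  · exact Or.inr rfl

/-- With merging read as a bracket, `mergeThree` is `[[x, y], z]`, and the other two terms of IHX at
its inner edge are `[y, [x, z]]` and, by the next lemma, `[[y, z], x]`. -/
theorem isRegluing_mergeThree_left (hc : D.color x = D.color y) :
    (mergeThree hxy hxz hyz).IsRegluing (mergeThreeLeft hxy hxz hyz) (threeTurn y z)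
      (((threeTurn y z)⁻¹ : Equiv.Perm _).trans (threeLeft hxy hxz hyz)) := by
  refine IsRegluing.of_conj (D := mergeThree hxy hxz hyz) (threeTurn y z)
    (threeLeft hxy hxz hyz) (fun h => ?_) ?_ (fun h hh => ?_)
  · change threeNextLeft hxz y ((threeTurn y z)⁻¹ h) = (threeTurn y z)⁻¹ (threeNext hxy z h)
    rw [Equiv.Perm.eq_inv_iff_eq, threeTurn_threeNextLeft hxy hxz hyz]
    exact congrArg (threeNext hxy z) (Equiv.apply_symm_apply (threeTurn y z) h)
  · rintro ((h | h) | h) <;> rfl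
  · obtain ⟨c1, c2, c3, c4, c5, c6⟩ := threeTurn_table hyz.ne
    rcases isLeg_mergeThree hxy hxz hyz hh with ⟨k, hx, hy, hz, rfl⟩ | rfl
    · change (mergeThreeLeft hxy hxz hyz).color ((threeTurn y z)⁻¹ (.inl (.inl k))) = _
      rw [Equiv.Perm.inv_eq_iff_eq.2 (c1 k hy hz).symm]
      rfl
    · change (mergeThreeLeft hxy hxz hyz).color ((threeTurn y z)⁻¹ (.inr true)) = _
      rw [Equiv.Perm.inv_eq_iff_eq.2 c6.symm]
      exact hc.symm

theorem isRegluing_mergeThree_right (hc : D.color x = D.color y) :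
    (mergeThree hxy hxz hyz).IsRegluing (mergeThree hyz hxy.symm hxz.symm) (threeTurn y z)⁻¹
      ((threeTurn y z).trans (threeRight hxy hxz hyz)) := by
  refine IsRegluing.of_conj (D := mergeThree hxy hxz hyz) (threeTurn y z)⁻¹
    (threeRight hxy hxz hyz) (fun h => ?_) ?_ (fun h hh => ?_)
  · exact threeNext_threeTurn hxy hxz hyz h
  · rintro ((h | _ | _) | h) <;> rfl
  · obtain ⟨c1, c2, c3, c4, c5, c6⟩ := threeTurn_table hyz.ne
    rcases isLeg_mergeThree hxy hxz hyz hh with ⟨k, hx, hy, hz, rfl⟩ | rfl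
    · change (mergeThree hyz hxy.symm hxz.symm).color (threeRight hxy hxz hyz
        (threeTurn y z (.inl (.inl k)))) = _
      rw [c1 k hy hz]
      rfl
    · change (mergeThree hyz hxy.symm hxz.symm).color (threeRight hxy hxz hyz
        (threeTurn y z (.inr true))) = _
      rw [c6]
      exact hc.symm

end Jacobi

end JacobiDiagram

/-! ## Listings of the legs -/

/-- Insertion sort, for a relation that need only be total on the members of the list. The order of
the legs by colour and position is of this kind. -/
theorem List.exists_perm_pairwise {α : Type*} {R : α → α → Prop} (l : List α) (hn : l.Nodup)
    (htrans : ∀ a b c, R a b → R b c → R a c)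
    (htotal : ∀ a ∈ l, ∀ b ∈ l, a ≠ b → R a b ∨ R b a) : ∃ l' : List α, l'.Perm l ∧
      l'.Pairwise R := by
  classical
  induction l with
  | nil => exact ⟨[], .refl _, .nil⟩
  | cons a t ih =>
    rw [List.nodup_cons] at hn
    obtain ⟨s, hs, hp⟩ := ih hn.2 fun b hb c hc => htotal b (by simp [hb]) c (by simp [hc])
    refine ⟨s.filter (fun b => R b a) ++ a :: s.filter (fun b => ¬ R b a), ?_, ?_⟩
    · refine List.perm_middle.trans (.cons a (Perm.trans ?_ hs))
      simpa using List.filter_append_perm (fun b => decide (R b a)) s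
    · have h2 : ∀ c ∈ s.filter (fun b => ¬ R b a), R a c := by
        intro c hc
        simp only [List.mem_filter, decide_eq_true_eq] at hc
        have hca : c ∈ t := hs.mem_iff.1 hc.1
        rcases htotal a (by simp) c (by simp [hca]) (fun e => hn.1 (e ▸ hca)) with h | h
        · exact h
        · exact (hc.2 h).elim
      rw [List.pairwise_append, List.pairwise_cons]
      refine ⟨hp.filter _, ⟨h2, hp.filter _⟩, ?_⟩
      intro b hb c hc
      simp only [List.mem_filter, decide_eq_true_eq] at hb
      rcases List.mem_cons.1 hc with rfl | hc
      · exact hb.2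
      · exact htrans _ _ _ hb.2 (h2 c hc)

theorem List.Nodup.before_mid_iff {α : Type*} {u w : List α} {x : α} (h : (u ++ x :: w).Nodup)
    (a : α) : Before a x (u ++ x :: w) ↔ a ∈ u := by
  rw [List.nodup_append, List.nodup_cons] at h
  rw [before_append, before_cons]
  constructor
  · rintro (h1 | h1 | ⟨_, h1⟩ | h1)
    · exact h1.mem.1
    · exact h1.1
    · exact (h.2.1.1 h1).elim
    · exact (h.2.1.1 h1.mem.2).elim
  · exact fun h1 => Or.inr (Or.inl ⟨h1, by simp⟩)

theorem List.Nodup.mid_before_iff {α : Type*} {u w : List α} {x : α} (h : (u ++ x :: w).Nodup)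
    (b : α) : Before x b (u ++ x :: w) ↔ b ∈ w := by
  rw [List.nodup_append, List.nodup_cons] at h
  rw [before_append, before_cons]
  constructor
  · rintro (h1 | h1 | ⟨_, h1⟩ | h1)
    · exact (h.2.2 x h1.mem.1 x (by simp) rfl).elim
    · exact (h.2.2 x h1.1 x (by simp) rfl).elim
    · exact h1
    · exact (h.2.1.1 h1.mem.1).elim
  · exact fun h1 => Or.inr (Or.inr (Or.inl ⟨rfl, h1⟩))

namespace JacobiDiagram

variable {p : ℕ}

/-- The list `l` contains every leg of `D` once. -/
structure IsListing (D : JacobiDiagram p) (l : List D.H) : Prop where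
  nodup : l.Nodup
  mem : ∀ h, h ∈ l ↔ D.IsLeg h

theorem exists_isListing (D : JacobiDiagram p) : ∃ l, D.IsListing l := by
  classical
  have := D.finite
  refine ⟨(Set.toFinite {h | D.IsLeg h}).toFinset.toList, Finset.nodup_toList _, fun h => ?_⟩
  simp

namespace IsListing

variable {D : JacobiDiagram p} {l l' : List D.H}

theorem perm (h : D.IsListing l) (h' : D.IsListing l') : l.Perm l' :=
  (List.perm_ext_iff_of_nodup h.nodup h'.nodup).2 fun a => (h.mem a).trans (h'.mem a).symm

theorem of_perm (h : D.IsListing l) (hp : l.Perm l') : D.IsListing l' :=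
  ⟨hp.nodup_iff.1 h.nodup, fun a => hp.mem_iff.symm.trans (h.mem a)⟩

theorem map {E : JacobiDiagram p} {π : Equiv.Perm D.H} {f : D.H ≃ E.H} (h : D.IsListing l)
    (hf : D.IsRegluing E π f) : E.IsListing (l.map f) := by
  refine ⟨h.nodup.map f.injective, fun a => ?_⟩
  obtain ⟨a, rfl⟩ := f.surjective a
  rw [List.mem_map_of_injective f.injective, h.mem, hf.isLeg_iff]

variable {u v : List D.H} {x y : D.H}

theorem swap (h : D.IsListing (u ++ x :: y :: v)) : D.IsListing (u ++ y :: x :: v) :=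
  h.of_perm (.append_left u (.swap y x v))

theorem legPair (h : D.IsListing (u ++ x :: y :: v)) : D.LegPair x y :=
  ⟨(h.mem x).1 (by simp), (h.mem y).1 (by simp), by
    have := h.nodup
    rw [List.nodup_append, List.nodup_cons] at this
    exact fun e => this.2.1.1 (by simp [e])⟩

end IsListing

/-- The list of legs in which `x`, `y` are replaced by the new leg of the merged diagram. -/
def mergeList {D : JacobiDiagram p} {x y : D.H} (hxy : D.LegPair x y) (u v : List D.H) :
    List (D.merge x y hxy).H :=
  u.map (old hxy) ++ foot hxy :: v.map (old hxy)

theorem foot_notMem_map_old {D : JacobiDiagram p} {x y : D.H} (hxy : D.LegPair x y)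
    (u : List D.H) : foot hxy ∉ u.map (old hxy) := by
  rw [List.mem_map]
  rintro ⟨a, _, h⟩
  exact old_ne_foot hxy a h

theorem length_mergeList {D : JacobiDiagram p} {x y : D.H} (hxy : D.LegPair x y)
    (u v : List D.H) : (mergeList hxy u v).length + 1 = (u ++ x :: y :: v).length := by
  simp [mergeList]; omega

theorem IsListing.notMem {D : JacobiDiagram p} {u v : List D.H} {x y : D.H}
    (h : D.IsListing (u ++ x :: y :: v)) : x ∉ u ∧ x ∉ v ∧ y ∉ u ∧ y ∉ v ∧ x ≠ y := by
  have := h.nodup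
  simp only [List.nodup_append, List.nodup_cons, List.mem_cons, not_or] at this
  obtain ⟨h1, ⟨⟨h2, h3⟩, h4, h5⟩, h6⟩ := this
  exact ⟨fun hx => h6 x hx x (by simp) rfl, h3, fun hy => h6 y hy y (by simp) rfl, h4, h2⟩

theorem IsListing.merge {D : JacobiDiagram p} {u v : List D.H} {x y : D.H}
    (h : D.IsListing (u ++ x :: y :: v)) :
    (D.merge x y h.legPair).IsListing (mergeList h.legPair u v) := by
  have hxy := h.legPair
  obtain ⟨h1, h2, h3, h4, h5⟩ := h.notMem
  constructor
  · have hn : (u ++ v).Nodup := by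
      refine h.nodup.sublist ?_
      exact List.Sublist.append_left (by simp) u
    have := (hn.map (old_injective hxy))
    rw [JacobiDiagram.mergeList, List.nodup_middle, List.nodup_cons, ← List.map_append]
    exact ⟨foot_notMem_map_old hxy _, this⟩
  · intro a
    rw [JacobiDiagram.mergeList, List.mem_append, List.mem_cons]
    have key : ∀ b, old hxy b ∈ u.map (old hxy) ∨ old hxy b = foot hxy ∨ old hxy b ∈ v.map (old hxy) ↔
        b ∈ u ∨ b ∈ v := fun b => by
      rw [List.mem_map_of_injective (old_injective hxy), List.mem_map_of_injective (old_injective hxy)]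
      simp [old_ne_foot]
    refine merge_cases hxy (fun b hx hy => ?_) ?_ ?_ ?_ ?_ a
    · rw [key, isLeg_old, ← h.mem b]
      simp [hx, hy]
    · rw [key, isLeg_old]
      simp [h1, h2]
    · rw [key, isLeg_old]
      simp [h3, h4]
    · refine iff_of_false ?_ (not_isLeg_stem hxy)
      simp only [List.mem_map, stem_ne_foot, false_or]
      rintro (⟨b, _, hb⟩ | ⟨b, _, hb⟩) <;> exact Sum.inl_ne_inr hb
    · exact iff_of_true (by simp) (isLeg_foot hxy)

/-- The attachment in which the legs of colour `i` are attached to strand `i` in the order of the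
list `l`. -/
def listAttachment (D : JacobiDiagram p) (l : List D.H) (hl : D.IsListing l) : D.Attachment :=
  ⟨fun a b => D.color a = D.color b ∧ l.Before a b,
    fun a b h => ⟨(hl.mem a).1 h.2.mem.1, (hl.mem b).1 h.2.mem.2, h.1⟩,
    fun a h => hl.nodup.not_before_self a h.2,
    fun _ _ _ h1 h2 => ⟨h1.1.trans h2.1, h1.2.trans hl.nodup h2.2⟩,
    fun a b ha hb hc hab => (List.before_total ((hl.mem a).2 ha) ((hl.mem b).2 hb) hab).imp
      (fun h => ⟨hc, h⟩) (fun h => ⟨hc.symm, h⟩)⟩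

instance (D : JacobiDiagram p) : Nonempty D.Attachment := by
  obtain ⟨l, hl⟩ := D.exists_isListing
  exact ⟨D.listAttachment l hl⟩

/-- The generalized chord diagram in which the legs of `D` are attached in the order of `l`. -/
def toStrand (D : JacobiDiagram p) (l : List D.H) (hl : D.IsListing l) : StrandDiagram p :=
  D.attach (D.listAttachment l hl)

theorem IsRegluing.toStrand {D E : JacobiDiagram p} {π : Equiv.Perm D.H} {f : D.H ≃ E.H}
    (hf : D.IsRegluing E π f) {l : List D.H} (hl : D.IsListing l) :
    (D.toStrand l hl).IsRegluing (E.toStrand (l.map f) (hl.map hf)) π f := by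
  refine ⟨hf, fun a b => ?_⟩
  have key : ∀ a b : D.H, E.color (f a) = E.color (f b) ∧ (l.map f).Before (f a) (f b) ↔
      D.color a = D.color b ∧ l.Before a b := fun a b => by
    rw [List.before_map f.injective]
    refine and_congr_left fun h => ?_
    rw [hf.color a ((hl.mem a).1 h.mem.1), hf.color b ((hl.mem b).1 h.mem.2)]
  exact key a b

-- Exchanging what hangs at `x` and at `y` amounts to renaming these two legs, so the reglued graph
-- is `D` again. Hence the term `U` of STU is the same graph with another order of its legs.
open Classical in
theorem LegPair.isRegluing_swap {D : JacobiDiagram p} {x y : D.H} (hxy : D.LegPair x y)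
    (hc : D.color x = D.color y) : D.IsRegluing D (Equiv.swap x y) (Equiv.swap x y) where
  next h := by
    by_cases hx : h = x
    · subst hx
      rw [show D.next h = h from hxy.left, Equiv.swap_apply_left, show D.next y = y from hxy.right]
    by_cases hy : h = y
    · subst hy
      rw [show D.next h = h from hxy.right, Equiv.swap_apply_right, show D.next x = x from hxy.left]
    rw [Equiv.swap_apply_of_ne_of_ne hx hy, Equiv.swap_apply_of_ne_of_ne
      (fun e => hx (hxy.left.of_next e)) (fun e => hy (hxy.right.of_next e))]
  edge h := by simp
  color h _ := by
    by_cases hx : h = x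
    · subst hx; rw [Equiv.swap_apply_left, hc]
    by_cases hy : h = y
    · subst hy; rw [Equiv.swap_apply_right, hc]
    rw [Equiv.swap_apply_of_ne_of_ne hx hy]

open Classical in
theorem IsListing.map_swap {D : JacobiDiagram p} {u v : List D.H} {x y : D.H}
    (h : D.IsListing (u ++ x :: y :: v)) :
    (u ++ x :: y :: v).map (Equiv.swap x y) = u ++ y :: x :: v := by
  obtain ⟨h1, h2, h3, h4, h5⟩ := h.notMem
  have key : ∀ w : List D.H, x ∉ w → y ∉ w → w.map (Equiv.swap x y) = w := fun w hx hy =>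
    (List.map_congr_left (g := id) fun a ha => Equiv.swap_apply_of_ne_of_ne
      (fun e : a = x => hx (e ▸ ha)) (fun e : a = y => hy (e ▸ ha))).trans (List.map_id w)
  simp [key u h1 h3, key v h2 h4]

theorem IsListing.adjacent {D : JacobiDiagram p} {u v : List D.H} {x y : D.H}
    (h : D.IsListing (u ++ x :: y :: v)) (hc : D.color x = D.color y) :
    (D.toStrand _ h).Adjacent x y := by
  refine ⟨⟨hc, (h.nodup.mid_before_iff y).2 (by simp)⟩, ?_⟩
  rintro ⟨z, h1, h2⟩
  have h3 := (h.nodup.mid_before_iff z).1 h1.2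
  have h4 : (u ++ [x] ++ y :: v).Nodup := by simpa using h.nodup
  have h5 : z ∈ u ++ [x] := (h4.before_mid_iff z).1 (by simpa using h2.2)
  exact (List.nodup_append.1 h4).2.2 z h5 z h3 rfl

theorem IsListing.isMerging {D : JacobiDiagram p} {u v : List D.H} {x y : D.H}
    (h : D.IsListing (u ++ x :: y :: v)) :
    (D.toStrand _ h).IsMerging x y ((D.merge x y h.legPair).toStrand _ h.merge)
      (Equiv.refl (D.H ⊕ Bool)) := by
  have hxy := h.legPair
  have hnd : (u.map (old hxy) ++ foot hxy :: v.map (old hxy)).Nodup := h.merge.nodup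
  have hmem : ∀ (w : List D.H) (a : D.H), old hxy a ∈ w.map (old hxy) ↔ a ∈ w := fun w a =>
    List.mem_map_of_injective (old_injective hxy)
  have hlt : ∀ a b : D.H, a ≠ x → a ≠ y → b ≠ x → b ≠ y →
      ((JacobiDiagram.mergeList hxy u v).Before (old hxy a) (old hxy b) ↔
        (u ++ x :: y :: v).Before a b) := by
    intro a b hax hay hbx hby
    simp only [JacobiDiagram.mergeList, List.before_append, List.before_cons, List.mem_cons,
      List.before_map (old_injective hxy), hmem]
    simp [old_ne_foot, hax, hay, hbx, hby]
  have hlt_foot : ∀ a : D.H, (JacobiDiagram.mergeList hxy u v).Before (old hxy a) (foot hxy) ↔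
      (u ++ x :: y :: v).Before a x := fun a => by
    rw [h.nodup.before_mid_iff, JacobiDiagram.mergeList, hnd.before_mid_iff, hmem]
  have hfoot_lt : ∀ b : D.H, b ≠ y →
      ((JacobiDiagram.mergeList hxy u v).Before (foot hxy) (old hxy b) ↔
        (u ++ x :: y :: v).Before x b) := fun b hby => by
    rw [h.nodup.mid_before_iff, JacobiDiagram.mergeList, hnd.mid_before_iff, hmem]
    simp [hby]
  exact
  { edge := fun _ => rfl
    edge_stem := rfl
    next := fun a hx hy => merge_next_old hxy hx hy
    next_stem := merge_next_stem hxy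
    next_y := merge_next_right hxy
    next_x := merge_next_left hxy
    next_foot := merge_next_foot hxy
    color := fun _ _ _ _ => rfl
    color_foot := rfl
    lt := fun a b hax hay hbx hby => and_congr_right fun _ => hlt a b hax hay hbx hby
    lt_foot := fun a hax hay => and_congr_right fun _ => hlt_foot a
    foot_lt := fun b hbx hby => and_congr_right fun _ => hfoot_lt b hby }

section

variable (F : Type*) [Field F]

open Classical in
/-- The class in `𝓐(p)` of the diagram in which the legs of `D` are attached in the order
of `l`. -/
noncomputable def mkList (D : JacobiDiagram p) (l : List D.H) : AlgA F p :=
  if hl : D.IsListing l then AlgA.mk F (D.toStrand l hl) else 0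

variable {F}

theorem mkList_of {D : JacobiDiagram p} {l : List D.H} (hl : D.IsListing l) :
    mkList F D l = AlgA.mk F (D.toStrand l hl) := dif_pos hl

theorem AlgA_mk_eq_of_iso {D E : StrandDiagram p} (h : D.Iso E) : AlgA.mk F D = AlgA.mk F E := by
  rw [AlgA.mk, AlgA.mk, show StrandClass.mk D = StrandClass.mk E from Quotient.sound h]

theorem AlgB_mk_eq_of_iso {D E : JacobiDiagram p} (h : D.Iso E) : AlgB.mk F D = AlgB.mk F E := by
  rw [AlgB.mk, AlgB.mk, show JacobiClass.mk D = JacobiClass.mk E from Quotient.sound h]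

theorem mkList_iso {D E : JacobiDiagram p} {f : D.H ≃ E.H} (hf : D.IsRegluing E 1 f)
    {l : List D.H} (hl : D.IsListing l) : mkList F E (l.map f) = mkList F D l := by
  rw [mkList_of hl, mkList_of (hl.map hf)]
  exact (AlgA_mk_eq_of_iso ⟨f, hf.toStrand hl⟩).symm

theorem mkList_as {D E : JacobiDiagram p} {h : D.H} {f : D.H ≃ E.H} (hh : ¬ D.IsLeg h)
    (hf : D.IsRegluing E (D.flip h) f) {l : List D.H} (hl : D.IsListing l) :
    mkList F D l + mkList F E (l.map f) = 0 := by
  rw [mkList_of hl, mkList_of (hl.map hf), AlgA.mk, AlgA.mk, ← map_add]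
  exact AlgA.mk_eq_zero (.as _ _ h f hh (hf.toStrand hl))

/-- For equal colours this is STU, written for lists. For different colours the exchange does not
alter the order on any strand, so the two attachments coincide. -/
theorem mkList_swap {D : JacobiDiagram p} {u v : List D.H} {x y : D.H}
    (h : D.IsListing (u ++ x :: y :: v)) :
    mkList F D (u ++ x :: y :: v) - mkList F D (u ++ y :: x :: v) =
      if D.color x = D.color y then mkList F (D.merge x y h.legPair) (mergeList h.legPair u v)
      else 0 := by
  classical
  split_ifs with hc
  · rw [mkList_of h, mkList_of h.swap, mkList_of h.merge, AlgA.mk, AlgA.mk, AlgA.mk, ← map_sub,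
      ← sub_eq_zero, ← map_sub, ← neg_eq_zero, ← map_neg, neg_sub]
    have key : ∀ l (hl : D.IsListing l), (u ++ x :: y :: v).map (Equiv.swap x y) = l →
        (D.toStrand _ h).IsRegluing (D.toStrand l hl) (Equiv.swap x y) (Equiv.swap x y) := by
      rintro l hl rfl
      exact (h.legPair.isRegluing_swap hc).toStrand h
    have hf := key _ h.swap h.map_swap
    exact AlgA.mk_eq_zero (.stu _ _ _ x y (Equiv.swap x y) _ (h.adjacent hc) hf h.isMerging)
  · have e : D.listAttachment _ h = D.listAttachment _ h.swap := ?_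
    · rw [mkList_of h, mkList_of h.swap, sub_eq_zero, toStrand, toStrand, e]
    refine Subtype.ext ?_
    funext a b
    refine propext (and_congr_right fun hab => ?_)
    simp only [List.before_append, List.before_cons, List.mem_cons]
    have : ¬ (a = x ∧ b = y) := by rintro ⟨rfl, rfl⟩; exact hc hab
    have : ¬ (a = y ∧ b = x) := by rintro ⟨rfl, rfl⟩; exact hc hab.symm
    tauto

end

end JacobiDiagram

/-! ### The canonical listing of the legs of a strand diagram -/

namespace StrandDiagram

variable {p : ℕ}

/-- The order of the legs first by colour and then along the strand. -/
def Precedes (T : StrandDiagram p) (a b : T.H) : Prop := T.color a < T.color b ∨ T.lt a b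

theorem Precedes.trans {T : StrandDiagram p} {a b c : T.H} (h1 : T.Precedes a b)
    (h2 : T.Precedes b c) : T.Precedes a c := by
  rcases h1 with h1 | h1 <;> rcases h2 with h2 | h2
  · exact Or.inl (h1.trans h2)
  · exact Or.inl ((T.attached.legs _ _ h2).2.2 ▸ h1)
  · exact Or.inl ((T.attached.legs _ _ h1).2.2.symm ▸ h2)
  · exact Or.inr (T.attached.trans _ _ _ h1 h2)

theorem not_precedes_self (T : StrandDiagram p) (a : T.H) : ¬ T.Precedes a a := by
  rintro (h | h)
  · exact lt_irrefl _ h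
  · exact T.attached.irrefl _ h

theorem precedes_total (T : StrandDiagram p) {a b : T.H} (ha : T.IsLeg a) (hb : T.IsLeg b)
    (hab : a ≠ b) : T.Precedes a b ∨ T.Precedes b a := by
  rcases lt_trichotomy (T.color a) (T.color b) with h | h | h
  · exact Or.inl (Or.inl h)
  · exact (T.attached.total a b ha hb h hab).imp Or.inr Or.inr
  · exact Or.inr (Or.inl h)

theorem exists_legList (T : StrandDiagram p) :
    ∃ l, T.toJacobiDiagram.IsListing l ∧ l.Pairwise T.Precedes := by
  obtain ⟨l, hl⟩ := T.toJacobiDiagram.exists_isListing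
  obtain ⟨l', hp, hw⟩ := List.exists_perm_pairwise (R := T.Precedes) l hl.nodup
    (fun _ _ _ => Precedes.trans)
    fun a ha b hb => T.precedes_total ((hl.mem a).1 ha) ((hl.mem b).1 hb)
  exact ⟨l', hl.of_perm hp.symm, hw⟩

/-- The legs, ordered first by colour and then along the strand. -/
noncomputable def legList (T : StrandDiagram p) : List T.H := T.exists_legList.choose

theorem isListing_legList (T : StrandDiagram p) : T.toJacobiDiagram.IsListing T.legList :=
  T.exists_legList.choose_spec.1

theorem pairwise_legList (T : StrandDiagram p) : T.legList.Pairwise T.Precedes :=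
  T.exists_legList.choose_spec.2

/-- A strict total order has only one increasing listing. This makes the chosen `legList` natural
under isomorphisms and regluings. -/
theorem eq_legList (T : StrandDiagram p) {l : List T.H} (hl : T.toJacobiDiagram.IsListing l)
    (hp : l.Pairwise T.Precedes) : T.legList = l :=
  List.Perm.eq_of_pairwise
    (fun a _ _ _ h1 h2 => (T.not_precedes_self a (h1.trans h2)).elim)
    T.pairwise_legList hp (T.isListing_legList.perm hl)

theorem IsRegluing.legList {D E : StrandDiagram p} {π : Equiv.Perm D.H} {f : D.H ≃ E.H}
    (hf : D.IsRegluing E π f) : E.legList = D.legList.map f := by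
  refine E.eq_legList (D.isListing_legList.map hf.1) (List.pairwise_map.2 ?_)
  refine D.pairwise_legList.imp_of_mem @fun _ _ ha hb h => ?_
  refine h.imp (fun h => ?_) (hf.2 _ _).2
  rwa [hf.1.color _ ((D.isListing_legList.mem _).1 ha),
    hf.1.color _ ((D.isListing_legList.mem _).1 hb)]

theorem toStrand_legList (T : StrandDiagram p) :
    T.toJacobiDiagram.toStrand T.legList T.isListing_legList = T := by
  have h : T.toJacobiDiagram.listAttachment T.legList T.isListing_legList = ⟨T.lt, T.attached⟩ := by
    refine Subtype.ext ?_
    funext a b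
    refine propext ⟨fun h => ?_, fun h => ?_⟩
    · exact (T.pairwise_legList.of_before h.2).resolve_left h.1.not_lt
    · obtain ⟨h1, h2, h3⟩ := T.attached.legs a b h
      refine ⟨h3, (List.before_total ((T.isListing_legList.mem a).2 h1)
        ((T.isListing_legList.mem b).2 h2) fun e => ?_).resolve_right fun h4 => ?_⟩
      · subst e
        exact T.attached.irrefl _ h
      · rcases T.pairwise_legList.of_before h4 with h5 | h5
        · exact h3.not_gt h5
        · exact T.attached.irrefl _ (T.attached.trans _ _ _ h h5)
  rw [JacobiDiagram.toStrand, h]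
  rfl

theorem mkList_legList (F : Type*) [Field F] (T : StrandDiagram p) :
    JacobiDiagram.mkList F T.toJacobiDiagram T.legList = AlgA.mk F T := by
  rw [JacobiDiagram.mkList_of T.isListing_legList, toStrand_legList]

end StrandDiagram

/-! ## The inverse of the symmetrization map -/

namespace JacobiDiagram

variable {p : ℕ}

theorem IsListing.sub_mem {V : Type*} [AddCommGroup V] {D : JacobiDiagram p} (W : AddSubgroup V)
    (θ : List D.H → V) (hstep : ∀ u x y v, D.IsListing (u ++ x :: y :: v) →
      θ (u ++ x :: y :: v) - θ (u ++ y :: x :: v) ∈ W) {l l' : List D.H} (hl : D.IsListing l)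
    (hl' : D.IsListing l') : θ l - θ l' ∈ W :=
  List.sub_mem_of_perm W θ (hl.perm hl') [] fun w x y v hp => hstep w x y v (hl.of_perm hp.symm)

/-- The uniqueness principle of the construction. Invariance under adjacent exchanges makes `θ`
constant on listings, so the sum is `θ l` times the number of attachments, which is invertible in
characteristic zero. -/
theorem IsListing.eq_zero {F V : Type*} [Field F] [CharZero F] [AddCommGroup V] [Module F V]
    {D : JacobiDiagram p} (θ : List D.H → V)
    (hstep : ∀ u x y v, D.IsListing (u ++ x :: y :: v) →
      θ (u ++ x :: y :: v) = θ (u ++ y :: x :: v))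
    (hsum : ∑ᶠ r : D.Attachment, θ (D.attach r).legList = 0) {l : List D.H} (hl : D.IsListing l) :
    θ l = 0 := by
  have h1 : ∀ r : D.Attachment, θ (D.attach r).legList = θ l := fun r => by
    have := (D.attach r).isListing_legList.sub_mem ⊥ θ
      (fun u x y v h => by rw [hstep u x y v h, sub_self]; exact AddSubgroup.zero_mem _) hl
    rwa [AddSubgroup.mem_bot, sub_eq_zero] at this
  have := Fintype.ofFinite D.Attachment
  rw [finsum_congr h1, finsum_eq_sum_of_fintype, Finset.sum_const, Finset.card_univ,
    ← Nat.cast_smul_eq_nsmul F, smul_eq_zero] at hsum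
  exact hsum.resolve_left (by simp)

end JacobiDiagram

theorem AlgB.mk_eq_zero {F : Type*} [Field F] {p : ℕ} {x : MonoidAlgebra F (JacobiClass p)}
    (h : JacobiRelation F p x) : Ideal.Quotient.mk (relationsB F p) x = 0 :=
  Ideal.Quotient.eq_zero_iff_mem.2 (Submodule.subset_span h)

namespace JacobiDiagram

variable {p : ℕ}

section

variable (F : Type*) [Field F]

theorem mk_as {D E : JacobiDiagram p} {h : D.H} {f : D.H ≃ E.H} (hh : ¬ D.IsLeg h)
    (hf : D.IsRegluing E (D.flip h) f) : AlgB.mk F D + AlgB.mk F E = 0 := by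
  rw [AlgB.mk, AlgB.mk, ← map_add]
  exact AlgB.mk_eq_zero (.as D E h f hh hf)

theorem mk_ihx {D E G : JacobiDiagram p} {h : D.H} {f : D.H ≃ E.H} {g : D.H ≃ G.H}
    (hh : D.IsInner h) (hf : D.IsRegluing E (D.turn h) f) (hg : D.IsRegluing G (D.turn h)⁻¹ g) :
    AlgB.mk F D + AlgB.mk F E + AlgB.mk F G = 0 := by
  rw [AlgB.mk, AlgB.mk, AlgB.mk, ← map_add, ← map_add]
  exact AlgB.mk_eq_zero (.ihx D E G h f g hh hf hg)

variable {F}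

/-- The function `ψ` of the order of the legs of `D` changes under the exchange of neighbouring legs
as the STU relation prescribes, if `s` gives the values on diagrams with fewer legs, and its
average is the class of `D`. -/
structure IsNormalized (s : (E : JacobiDiagram p) → List E.H → AlgB F p) (D : JacobiDiagram p)
    (ψ : List D.H → AlgB F p) : Prop where
  step : ∀ u x y v (h : D.IsListing (u ++ x :: y :: v)),
    ψ (u ++ x :: y :: v) - ψ (u ++ y :: x :: v) = if D.color x = D.color y then
      s (D.merge x y h.legPair) (mergeList h.legPair u v) else 0
  sum : ∑ᶠ r : D.Attachment, ψ (D.attach r).legList = (Nat.card D.Attachment : F) • AlgB.mk F D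

variable (F)

open Classical in
/-- The image in `𝓑(p)` of the diagram `D` with `n` legs attached in the order of a list. -/
noncomputable def sigma : ℕ → (D : JacobiDiagram p) → List D.H → AlgB F p
  | 0, D, _ => AlgB.mk F D
  -- The value is meaningful when `n + 1` is the number of legs of `D`. Then, in characteristic
  -- zero, a normalized `ψ` exists; `step` determines it on listings up to a constant, and `sum`
  -- fixes the constant, so the choice does not matter.
  | n + 1, D, l => if h : ∃ ψ, IsNormalized (sigma n) D ψ then h.choose l else 0

/-- The properties of `sigma` for diagrams with `n` legs. -/
structure SigmaProps (p n : ℕ) : Prop where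
  iso : ∀ (D E : JacobiDiagram p) (f : D.H ≃ E.H), D.IsRegluing E 1 f → ∀ l, D.IsListing l →
    l.length = n → sigma F n E (l.map f) = sigma F n D l
  as : ∀ (D E : JacobiDiagram p) (h : D.H) (f : D.H ≃ E.H), ¬ D.IsLeg h →
    D.IsRegluing E (D.flip h) f → ∀ l, D.IsListing l → l.length = n →
      sigma F n D l + sigma F n E (l.map f) = 0
  ihx : ∀ (D E G : JacobiDiagram p) (h : D.H) (f : D.H ≃ E.H) (g : D.H ≃ G.H), D.IsInner h →
    D.IsRegluing E (D.turn h) f → D.IsRegluing G (D.turn h)⁻¹ g → ∀ l, D.IsListing l →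
    l.length = n → sigma F n D l + sigma F n E (l.map f) + sigma F n G (l.map g) = 0
  -- The truncated `n - 1` is harmless for `n = 0`, since a diagram without legs admits no exchange.
  normalized : ∀ (D : JacobiDiagram p) l, D.IsListing l → l.length = n →
    IsNormalized (sigma F (n - 1)) D (sigma F n D)

variable {F}

theorem flip_stem_old {D : JacobiDiagram p} {x y a : D.H} (hxy : D.LegPair x y) (hx : a ≠ x)
    (hy : a ≠ y) : ((D.merge x y hxy).flip (stem hxy))⁻¹ (old hxy a) = old hxy a := by
  classical
  rw [Equiv.Perm.inv_eq_iff_eq]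
  simp only [flip, merge_next_stem, merge_next_right]
  exact (Equiv.swap_apply_of_ne_of_ne ((old_injective hxy).ne hy)
    ((old_injective hxy).ne hx)).symm

theorem flip_stem_foot {D : JacobiDiagram p} {x y : D.H} (hxy : D.LegPair x y) :
    ((D.merge x y hxy).flip (stem hxy))⁻¹ (foot hxy) = foot hxy := by
  classical
  rw [Equiv.Perm.inv_eq_iff_eq]
  simp only [flip, merge_next_stem, merge_next_right]
  exact (@Equiv.swap_apply_of_ne_of_ne (D.merge x y hxy).H _ _ _ _ Sum.inr_ne_inl
    Sum.inr_ne_inl).symm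

theorem map_mergeList {γ : Type*} {D E : JacobiDiagram p} {x y : D.H} {x' y' : E.H}
    (hxy : D.LegPair x y) (hxy' : E.LegPair x' y')
    (g : (D.merge x y hxy).H → (E.merge x' y' hxy').H) (α : γ → D.H) (β : γ → E.H)
    (u v : List γ) (hu : ∀ a ∈ u, g (old hxy (α a)) = old hxy' (β a))
    (hv : ∀ a ∈ v, g (old hxy (α a)) = old hxy' (β a)) (hg : g (foot hxy) = foot hxy') :
    (mergeList hxy (u.map α) (v.map α)).map g = mergeList hxy' (u.map β) (v.map β) := by
  simp only [mergeList, List.map_append, List.map_cons, List.map_map, hg]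
  congr 1
  · exact List.map_congr_left hu
  · exact congrArg _ (List.map_congr_left hv)

theorem IsListing.map_mergeSymm {D : JacobiDiagram p} {u v : List D.H} {x y : D.H}
    (h : D.IsListing (u ++ x :: y :: v)) :
    (mergeList h.legPair u v).map
      (((D.merge x y h.legPair).flip (stem h.legPair))⁻¹.trans (mergeSymm h.legPair)) =
      mergeList h.legPair.symm u v := by
  obtain ⟨h1, h2, h3, h4, h5⟩ := h.notMem
  have key : ∀ a, a ≠ x → a ≠ y →
      (((D.merge x y h.legPair).flip (stem h.legPair))⁻¹.trans (mergeSymm h.legPair))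
        (old h.legPair a) = old h.legPair.symm a := fun a hx hy =>
    congrArg (mergeSymm h.legPair) (flip_stem_old h.legPair hx hy)
  have := map_mergeList h.legPair h.legPair.symm _ id id u v
    (fun a ha => key a (fun e => h1 (e ▸ ha)) (fun e => h3 (e ▸ ha)))
    (fun a ha => key a (fun e => h2 (e ▸ ha)) (fun e => h4 (e ▸ ha)))
    (congrArg (mergeSymm h.legPair) (flip_stem_foot h.legPair))
  rwa [List.map_id, List.map_id] at this

variable (F) in
open Classical in
/-- The difference of the values of `sigma` that the STU relation prescribes. -/
noncomputable def sigmaStep (n : ℕ) (D : JacobiDiagram p) (u : List D.H) (x y : D.H)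
    (v : List D.H) : AlgB F p :=
  if h : D.IsListing (u ++ x :: y :: v) then if D.color x = D.color y then
    sigma F n (D.merge x y h.legPair) (mergeList h.legPair u v) else 0 else 0

theorem sigmaStep_of (n : ℕ) {D : JacobiDiagram p} {u v : List D.H} {x y : D.H}
    (h : D.IsListing (u ++ x :: y :: v)) : sigmaStep F n D u x y v = if D.color x = D.color y then
    sigma F n (D.merge x y h.legPair) (mergeList h.legPair u v) else 0 := by
  simp [sigmaStep, h]

/-- Exchanging the legs back merges them in the other order, which reverses the cyclic order at the
new vertex; AS for the merged diagrams gives the sign. -/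
theorem SigmaProps.anti {n : ℕ} (hn : SigmaProps F p n) {D : JacobiDiagram p} {u v : List D.H}
    {x y : D.H} (h : D.IsListing (u ++ x :: y :: v)) (hl : (u ++ x :: y :: v).length = n + 1) :
    sigmaStep F n D u y x v = - sigmaStep F n D u x y v := by
  rw [sigmaStep_of n h, sigmaStep_of n h.swap]
  by_cases hc : D.color x = D.color y
  · rw [if_pos hc, if_pos hc.symm, eq_neg_iff_add_eq_zero, add_comm, ← h.map_mergeSymm]
    refine hn.as _ _ _ _ (not_isLeg_stem _) (isRegluing_merge_symm _ hc) _ h.merge ?_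
    have := length_mergeList h.legPair u v
    omega
  · rw [if_neg hc, if_neg (fun e => hc e.symm), neg_zero]

theorem SigmaProps.step {n : ℕ} (hn : SigmaProps F p n) {D : JacobiDiagram p} {u v : List D.H}
    {x y : D.H} (h : D.IsListing (u ++ x :: y :: v)) (hl : (u ++ x :: y :: v).length = n) :
    sigma F n D (u ++ x :: y :: v) - sigma F n D (u ++ y :: x :: v) =
      if D.color x = D.color y then
      sigma F (n - 1) (D.merge x y h.legPair) (mergeList h.legPair u v) else 0 :=
  (hn.normalized D _ h hl).step u x y v h

theorem mergeList_append {D : JacobiDiagram p} {x y : D.H} (hxy : D.LegPair x y)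
    (u v : List D.H) (z w : D.H) (t : List D.H) : mergeList hxy u (v ++ z :: w :: t) =
      mergeList hxy u v ++ old hxy z :: old hxy w :: t.map (old hxy) := by
  simp [mergeList]

theorem append_mergeList {D : JacobiDiagram p} {x y : D.H} (hxy : D.LegPair x y)
    (u v : List D.H) (z w : D.H) (t : List D.H) : mergeList hxy (u ++ z :: w :: v) t =
      u.map (old hxy) ++ old hxy z :: old hxy w :: mergeList hxy v t := by
  simp [mergeList]

theorem mergeList_cons {D : JacobiDiagram p} {x y : D.H} (hxy : D.LegPair x y)
    (u v : List D.H) (z : D.H) : mergeList hxy u (z :: v) =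
      u.map (old hxy) ++ foot hxy :: old hxy z :: v.map (old hxy) := by
  simp [mergeList]

theorem mergeList_concat {D : JacobiDiagram p} {x y : D.H} (hxy : D.LegPair x y)
    (u v : List D.H) (z : D.H) : mergeList hxy (u ++ [z]) v =
      u.map (old hxy) ++ old hxy z :: foot hxy :: v.map (old hxy) := by
  simp [mergeList]

/-- Opposite sides of the square differ by STU for a diagram with one pair already merged. Both
differences are the value at the diagram with both pairs merged, and the order of these mergings is
irrelevant up to isomorphism. -/
theorem SigmaProps.square {n : ℕ} (hn : SigmaProps F p n) {D : JacobiDiagram p}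
    {u v t : List D.H} {x y z w : D.H} (h : D.IsListing (u ++ x :: y :: (v ++ z :: w :: t)))
    (hl : (u ++ x :: y :: (v ++ z :: w :: t)).length = n + 1) (hn' : SigmaProps F p (n - 1)) :
    sigmaStep F n D u x y (v ++ z :: w :: t) + sigmaStep F n D (u ++ y :: x :: v) z w t =
      sigmaStep F n D (u ++ x :: y :: v) z w t + sigmaStep F n D u x y (v ++ w :: z :: t) := by
  have h1 : D.IsListing (u ++ x :: y :: v ++ z :: w :: t) := by simpa using h
  have h2 : D.IsListing (u ++ x :: y :: (v ++ w :: z :: t)) := by simpa using h1.swap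
  have h3 : D.IsListing (u ++ y :: x :: v ++ z :: w :: t) := by simpa using h.swap
  have hxy := h.legPair
  have hzw := h1.legPair
  obtain ⟨n1, n2, n3, n4, n5⟩ := h.notMem
  have hzx : z ≠ x := fun e => n2 (by simp [e])
  have hzy : z ≠ y := fun e => n4 (by simp [e])
  have hwx : w ≠ x := fun e => n2 (by simp [e])
  have hwy : w ≠ y := fun e => n4 (by simp [e])
  have len1 := length_mergeList hxy u (v ++ z :: w :: t)
  have len2 := length_mergeList hzw (u ++ x :: y :: v) t
  rw [sigmaStep_of n h, sigmaStep_of n h1, sigmaStep_of n h2, sigmaStep_of n h3,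
    ← sub_eq_sub_iff_add_eq_add]
  have hm1 := h.merge
  have hm2 := h1.merge
  rw [mergeList_append] at hm1
  have e2 : mergeList hzw (u ++ x :: y :: v) t = _ := append_mergeList hzw u v x y t
  rw [e2] at hm2
  have s1 := hn.step hm1 (by rw [← mergeList_append]; omega)
  have s2 := hn.step hm2 (by rw [← e2]; simp at len2 hl ⊢; omega)
  rw [← mergeList_append, ← mergeList_append] at s1
  rw [← e2, ← append_mergeList hzw u v y x t] at s2
  simp only [merge_color_old] at s1 s2
  have key : sigma F (n - 1) _ (mergeList hm2.legPair (u.map (old hzw)) (mergeList hzw v t)) =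
      sigma F (n - 1) _ (mergeList hm1.legPair (mergeList hxy u v) (t.map (old hxy))) := by
    rw [← hn'.iso _ _ _ (isRegluing_merge_comm hxy hzw hzx hzy hwx hwy) _ hm1.merge]
    · congr 1
      simp only [mergeList, List.map_append, List.map_cons, List.map_map, List.append_assoc,
        List.cons_append]
      rfl
    · have len3 := length_mergeList hm1.legPair (mergeList hxy u v) (t.map (old hxy))
      rw [← mergeList_append] at len3
      omega
  by_cases hA : D.color x = D.color y <;> by_cases hB : D.color z = D.color w <;>
    simp only [hA, hB, if_true, if_false] at s1 s2 ⊢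
  · exact s1.trans (key.symm.trans s2.symm)
  · rw [sub_zero]; exact s1
  · rw [sub_zero]; exact s2.symm

theorem threeTurn_of_ne {D : JacobiDiagram p} {y z a : D.H} (hyz : y ≠ z) (hy : a ≠ y)
    (hz : a ≠ z) : (threeTurn y z)⁻¹ (.inl (.inl a)) = .inl (.inl a) := by
  rw [Equiv.Perm.inv_eq_iff_eq, (threeTurn_table hyz).1 a hy hz]

/-- Opposite sides of the hexagon exchange the same two legs, before and after the third leg passes
them. By STU for the merged diagram, they differ by a diagram in which all three legs are merged.
The three diagrams obtained in this way are the terms of IHX. -/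
theorem SigmaProps.hexagon {n : ℕ} (hn : SigmaProps F p n) {D : JacobiDiagram p}
    {u v : List D.H} {x y z : D.H} (h : D.IsListing (u ++ x :: y :: z :: v))
    (hl : (u ++ x :: y :: z :: v).length = n + 1) (hn' : SigmaProps F p (n - 1)) :
    sigmaStep F n D u x y (z :: v) + sigmaStep F n D (u ++ [y]) x z v +
        sigmaStep F n D u y z (x :: v) =
      sigmaStep F n D (u ++ [x]) y z v + sigmaStep F n D u x z (y :: v) +
        sigmaStep F n D (u ++ [z]) x y v := by
  have h1 : D.IsListing (u ++ [x] ++ y :: z :: v) := by simpa using h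
  have h2 : D.IsListing (u ++ x :: z :: y :: v) := by simpa using h1.swap
  have h3 : D.IsListing (u ++ [z] ++ x :: y :: v) := by simpa using h2.swap
  have h4 : D.IsListing (u ++ [y] ++ x :: z :: v) := by simpa using h.swap
  have h5 : D.IsListing (u ++ y :: z :: x :: v) := by simpa using h4.swap
  have hxy := h.legPair
  have hxz := h2.legPair
  have hyz := h5.legPair
  obtain ⟨-, nx, -, ny, -⟩ := h.notMem
  obtain ⟨nx1, nx2, ny1, ny2, -⟩ := h3.notMem
  obtain ⟨nz1, nz2, -, -, -⟩ := h5.swap.notMem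
  have len1 := length_mergeList hxy u (z :: v)
  have len2 := length_mergeList hxz u (y :: v)
  have len3 := length_mergeList hyz u (x :: v)
  simp only [List.length_append, List.length_cons] at len1 len2 len3 hl
  rw [sigmaStep_of n h, sigmaStep_of n h1, sigmaStep_of n h2, sigmaStep_of n h3,
    sigmaStep_of n h4, sigmaStep_of n h5, mergeList_cons, mergeList_cons, mergeList_cons,
    mergeList_concat, mergeList_concat, mergeList_concat]
  have hm1 := h.merge
  have hm2 := h4.merge
  have hm3 := h5.merge
  rw [mergeList_cons] at hm1 hm3
  rw [mergeList_concat] at hm2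
  have s1 := hn.step hm1 (by simp at hl ⊢; omega)
  have s2 := hn.step hm2 (by simp at hl ⊢; omega)
  have s3 := hn.step hm3 (by simp at hl ⊢; omega)
  simp only [merge_color_old, merge_color_foot] at s1 s2 s3
  have key : D.color x = D.color y →
      sigma F (n - 1) _ (mergeList hm1.legPair (u.map (old hxy)) (v.map (old hxy))) +
      sigma F (n - 1) _ (mergeList hm2.legPair (u.map (old hxz)) (v.map (old hxz))) +
      sigma F (n - 1) _ (mergeList hm3.legPair (u.map (old hyz)) (v.map (old hyz))) = 0 := by
    intro hc
    obtain ⟨c1, c2, c3, c4, c5, c6⟩ := threeTurn_table hyz.ne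
    have hf := isRegluing_mergeThree_left hxy hxz hyz hc
    have hg := isRegluing_mergeThree_right hxy hxz hyz hc
    have hu : ∀ a ∈ u, a ≠ y ∧ a ≠ z := fun a ha =>
      ⟨fun e => ny1 (by simp [← e, ha]), fun e => nz1 (e ▸ ha)⟩
    have hv : ∀ a ∈ v, a ≠ y ∧ a ≠ z := fun a ha =>
      ⟨fun e => ny2 (e ▸ ha), fun e => nz2 (by simp [← e, ha])⟩
    have hl1 : ((mergeList hm1.legPair (u.map (old hxy)) (v.map (old hxy)))).map
        (((threeTurn y z)⁻¹ : Equiv.Perm _).trans (threeLeft hxy hxz hyz)) =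
        mergeList hm2.legPair (u.map (old hxz)) (v.map (old hxz)) := by
      exact map_mergeList hm1.legPair hm2.legPair _ _ _ _ _
        (fun a ha => congrArg (threeLeft hxy hxz hyz) (threeTurn_of_ne hyz.ne (hu a ha).1 (hu a ha).2))
        (fun a ha => congrArg (threeLeft hxy hxz hyz) (threeTurn_of_ne hyz.ne (hv a ha).1 (hv a ha).2))
        (congrArg (threeLeft hxy hxz hyz) (Equiv.Perm.inv_eq_iff_eq.2 c6.symm))
    have hl2 : ((mergeList hm1.legPair (u.map (old hxy)) (v.map (old hxy)))).map
        ((threeTurn y z).trans (threeRight hxy hxz hyz)) =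
        mergeList hm3.legPair (u.map (old hyz)) (v.map (old hyz)) := by
      exact map_mergeList hm1.legPair hm3.legPair _ _ _ _ _
        (fun a ha => congrArg (threeRight hxy hxz hyz) (c1 a (hu a ha).1 (hu a ha).2))
        (fun a ha => congrArg (threeRight hxy hxz hyz) (c1 a (hv a ha).1 (hv a ha).2))
        (congrArg (threeRight hxy hxz hyz) c6)
    rw [← hl1, ← hl2]
    refine hn'.ihx (mergeThree hxy hxz hyz) (mergeThreeLeft hxy hxz hyz)
      (mergeThree hyz hxy.symm hxz.symm) (midEdge hxy hxz hyz) _ _ (isInner_midEdge hxy hxz hyz)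
      ?_ ?_ _ hm1.merge ?_
    · rw [turn_midEdge]; exact hf
    · rw [turn_midEdge]; exact hg
    · have := length_mergeList hm1.legPair (u.map (old hxy)) (v.map (old hxy))
      simp only [List.length_append, List.length_cons, List.length_map] at this
      change (mergeList hm1.legPair (u.map (old hxy)) (v.map (old hxy))).length = n - 1
      omega
  -- A merged leg passes a leg of another colour at no cost. So, unless all three colours agree,
  -- every pair of opposite sides cancels by itself.
  by_cases hA : D.color x = D.color y
  · by_cases hB : D.color x = D.color z
    · have hC : D.color y = D.color z := hA.symm.trans hB
      have hk := key hA
      simp only [hA, hC, if_true] at s1 s2 s3 ⊢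
      rw [← s1, ← s2, ← s3, ← sub_eq_zero] at hk
      rw [← sub_eq_zero, ← hk]
      abel
    · have hC : D.color y ≠ D.color z := fun e => hB (hA.trans e)
      simp only [hA, hC, if_true, if_false] at s1 s2 s3 ⊢
      rw [sub_eq_zero] at s1
      simp [s1]
  · have hA' : D.color y ≠ D.color x := fun e => hA e.symm
    simp only [hA, hA', if_false, sub_eq_zero] at s1 s2 s3 ⊢
    rw [s2, s3]
    abel

theorem isNormalized_of_potential [CharZero F] {D : JacobiDiagram p}
    (s : (E : JacobiDiagram p) → List E.H → AlgB F p) (φ : List D.H → AlgB F p)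
    (hφ : ∀ u x y v (h : D.IsListing (u ++ x :: y :: v)),
    φ (u ++ x :: y :: v) - φ (u ++ y :: x :: v) = if D.color x = D.color y then
      s (D.merge x y h.legPair) (mergeList h.legPair u v) else 0) : ∃ ψ, IsNormalized s D ψ := by
  have := Fintype.ofFinite D.Attachment
  -- Adding a constant preserves all differences; this constant makes the average equal to the class
  -- of `D`.
  refine ⟨fun l => φ l + (AlgB.mk F D - (Nat.card D.Attachment : F)⁻¹ •
    ∑ᶠ r : D.Attachment, φ (D.attach r).legList), ?_, ?_⟩
  · intro u x y v h
    rw [← hφ u x y v h]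
    abel
  · simp only [finsum_eq_sum_of_fintype]
    rw [Finset.sum_add_distrib, Finset.sum_const, Finset.card_univ, ← Nat.card_eq_fintype_card,
      ← Nat.cast_smul_eq_nsmul F, smul_sub, smul_smul, mul_inv_cancel₀ (by simp), one_smul]
    abel

theorem SigmaProps.exists_isNormalized [CharZero F] {n : ℕ} (hn : SigmaProps F p n)
    (hn' : SigmaProps F p (n - 1)) {D : JacobiDiagram p} {l : List D.H} (hl : D.IsListing l)
    (hlen : l.length = n + 1) : ∃ ψ, IsNormalized (sigma F n) D ψ := by
  have hL : ∀ {l' : List D.H}, l'.Perm l → D.IsListing l' ∧ l'.length = n + 1 := fun hp =>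
    ⟨hl.of_perm hp.symm, hp.length_eq.trans hlen⟩
  obtain ⟨φ, hφ⟩ := List.exists_potential l hl.nodup (sigmaStep F n D)
    (fun u x y v hp => hn.anti (hL hp).1 (hL hp).2)
    (fun u x y v z w t hp => hn.square (hL hp).1 (hL hp).2 hn')
    (fun u x y z v hp => hn.hexagon (hL hp).1 (hL hp).2 hn')
  exact isNormalized_of_potential _ φ fun u x y v h =>
    (hφ u x y v (h.perm hl)).trans (sigmaStep_of n h)

/-- Pulled back along regluings, the terms of a relation all become functions of the same listings,
those of `D`, and can be added. -/
theorem IsNormalized.reglue {s : (E : JacobiDiagram p) → List E.H → AlgB F p}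
    {D E : JacobiDiagram p} {ψ : List E.H → AlgB F p} (hψ : IsNormalized s E ψ)
    {π : Equiv.Perm D.H} {f : D.H ≃ E.H} (hf : D.IsRegluing E π f) :
    (∀ u x y v (h : D.IsListing (u ++ x :: y :: v)),
      ψ ((u ++ x :: y :: v).map f) - ψ ((u ++ y :: x :: v).map f) =
      if D.color x = D.color y then s (E.merge (f x) (f y) (hf.legPair h.legPair))
        ((mergeList h.legPair u v).map (Equiv.sumCongr f (Equiv.refl Bool))) else 0) ∧
    ∑ᶠ r : D.Attachment, ψ ((D.attach r).legList.map f) =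
      (Nat.card D.Attachment : F) • AlgB.mk F E := by
  constructor
  · intro u x y v h
    have h' : E.IsListing (u.map f ++ f x :: f y :: v.map f) := by simpa using h.map hf
    have := hψ.step _ _ _ _ h'
    rw [hf.color x h.legPair.left, hf.color y h.legPair.right] at this
    have e : (mergeList h.legPair u v).map (Equiv.sumCongr f (Equiv.refl Bool)) =
        mergeList (hf.legPair h.legPair) (u.map f) (v.map f) :=
      by
        have := map_mergeList h.legPair (hf.legPair h.legPair)
          (Equiv.sumCongr f (Equiv.refl Bool)) id f u v (fun _ _ => rfl) (fun _ _ => rfl) rfl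
        rwa [List.map_id, List.map_id] at this
    refine Eq.trans ?_ (if_congr Iff.rfl (congrArg (s _) e.symm) rfl)
    simpa using this
  · rw [Nat.card_congr hf.attachmentEquiv, ← hψ.sum, ← finsum_comp_equiv hf.attachmentEquiv]
    exact finsum_congr fun r => congrArg ψ (hf.attach r).legList.symm

/-- Invariance, AS and IHX each assert that some function `θ` of the listings vanishes. The
differences of `θ` are given by the same identity for merged diagrams, known for `n`, and its sum
over the attachments is a multiple of the corresponding identity in `𝓑(p)`. So `IsListing.eq_zero`
applies. -/
theorem SigmaProps.succ [CharZero F] {n : ℕ} (hn : SigmaProps F p n)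
    (hn' : SigmaProps F p (n - 1)) : SigmaProps F p (n + 1) := by
  have hnorm : ∀ (D : JacobiDiagram p) l, D.IsListing l → l.length = n + 1 →
      IsNormalized (sigma F n) D (sigma F (n + 1) D) := by
    intro D l hl hlen
    have h := hn.exists_isNormalized hn' hl hlen
    have e : sigma F (n + 1) D = h.choose := by
      funext l
      simp only [sigma, dif_pos h]
    rw [e]
    exact h.choose_spec
  have hlen : ∀ {D : JacobiDiagram p} {l u v : List D.H} {x y : D.H}
      (_ : D.IsListing l) (_ : l.length = n + 1) (h : D.IsListing (u ++ x :: y :: v)),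
      (mergeList h.legPair u v).length = n := by
    intro D l u v x y hl hlen h
    have h1 := length_mergeList h.legPair u v
    have h2 := (h.perm hl).length_eq
    omega
  have hlen' : ∀ {D E : JacobiDiagram p} {π : Equiv.Perm D.H} {f : D.H ≃ E.H} {l : List D.H},
      l.length = n + 1 → (l.map f).length = n + 1 := fun h => by rw [List.length_map, h]
  refine ⟨?_, ?_, ?_, hnorm⟩
  · intro D E f hf l hl hlenl
    have hD := hnorm D l hl hlenl
    obtain ⟨h1, h2⟩ := (hnorm E _ (hl.map hf) (by simpa using hlenl)).reglue hf
    rw [← sub_eq_zero]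
    refine hl.eq_zero (F := F) (fun l => sigma F (n + 1) E (l.map f) - sigma F (n + 1) D l) ?_ ?_
    · intro u x y v h
      rw [sub_eq_sub_iff_sub_eq_sub, h1 u x y v h, hD.step u x y v h]
      split_ifs
      · exact hn.iso _ _ _ (hf.one_merge h.legPair) _ h.merge (hlen hl hlenl h)
      · rfl
    · rw [finsum_sub_distrib (Set.toFinite _) (Set.toFinite _), h2, hD.sum,
        AlgB_mk_eq_of_iso ⟨f, hf⟩, sub_self]
  · intro D E a f ha hf l hl hlenl
    have hD := hnorm D l hl hlenl
    obtain ⟨h1, h2⟩ := (hnorm E _ (hl.map hf) (by simpa using hlenl)).reglue hf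
    refine hl.eq_zero (F := F) (fun l => sigma F (n + 1) D l + sigma F (n + 1) E (l.map f)) ?_ ?_
    · intro u x y v h
      rw [← sub_eq_zero, add_sub_add_comm, h1 u x y v h, hD.step u x y v h]
      split_ifs
      · refine hn.as _ _ (old h.legPair a) _ (not_isLeg_old _ ha) ?_ _ h.merge (hlen hl hlenl h)
        rw [flip_merge h.legPair ha]
        exact hf.merge h.legPair
      · simp
    · rw [finsum_add_distrib (Set.toFinite _) (Set.toFinite _), h2, hD.sum, ← smul_add,
        mk_as F ha hf, smul_zero]
  · intro D E G a f g ha hf hg l hl hlenl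
    have hD := hnorm D l hl hlenl
    obtain ⟨h1, h2⟩ := (hnorm E _ (hl.map hf) (by simpa using hlenl)).reglue hf
    obtain ⟨h3, h4⟩ := (hnorm G _ (hl.map hg) (by simpa using hlenl)).reglue hg
    refine hl.eq_zero (F := F) (fun l => sigma F (n + 1) D l + sigma F (n + 1) E (l.map f) +
      sigma F (n + 1) G (l.map g)) ?_ ?_
    · intro u x y v h
      rw [← sub_eq_zero, add_sub_add_comm, add_sub_add_comm, h1 u x y v h, h3 u x y v h,
        hD.step u x y v h]
      split_ifs
      · refine hn.ihx _ _ _ (old h.legPair a) _ _ (ha.merge h.legPair) ?_ ?_ _ h.merge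
          (hlen hl hlenl h)
        · rw [turn_merge h.legPair ha]
          exact hf.merge h.legPair
        · rw [turn_merge h.legPair ha]
          exact hg.merge h.legPair
      · simp
    · rw [finsum_add_distrib (Set.toFinite _) (Set.toFinite _),
        finsum_add_distrib (Set.toFinite _) (Set.toFinite _), h2, h4, hD.sum, ← smul_add,
        ← smul_add, mk_ihx F ha hf hg, smul_zero]

theorem sigmaProps_zero : SigmaProps F p 0 where
  iso D E f hf l _ _ := (AlgB_mk_eq_of_iso ⟨f, hf⟩).symm
  as D E h f hh hf l _ _ := mk_as F hh hf
  ihx D E G h f g hh hf hg l _ _ := mk_ihx F hh hf hg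
  normalized D l hl h0 := by
    refine ⟨fun u x y v h => ?_, ?_⟩
    · have := (h.perm hl).length_eq
      simp [h0] at this
    · have := Fintype.ofFinite D.Attachment
      simp only [sigma]
      rw [finsum_eq_sum_of_fintype, Finset.sum_const, Finset.card_univ,
        ← Nat.card_eq_fintype_card, Nat.cast_smul_eq_nsmul]

variable (F p) in
theorem sigmaProps [CharZero F] (n : ℕ) : SigmaProps F p n := by
  induction n using Nat.strong_induction_on with
  | _ n ih =>
    cases n with
    | zero => exact sigmaProps_zero
    -- Two predecessors are needed because squares and hexagons involve two mergings; for `n = 0`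
    -- both of them are `0`.
    | succ n => exact (ih n (by omega)).succ (ih (n - 1) (by omega))

end

end JacobiDiagram

open JacobiDiagram

/-! ### Linear maps out of `𝓐(p)` and `𝓑(p)` -/

section Span

variable {F : Type*} [Field F] {p : ℕ}

theorem AlgA.mem_span_mk (x : AlgA F p) : x ∈ Submodule.span F (Set.range (AlgA.mk F (p := p))) := by
  obtain ⟨x, rfl⟩ := Ideal.Quotient.mk_surjective x
  induction x using MonoidAlgebra.induction_on with
  | of m =>
    obtain ⟨D, rfl⟩ : ∃ D, StrandClass.mk D = m := Quotient.exists_rep m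
    exact Submodule.subset_span ⟨D, rfl⟩
  | add x y hx hy => rw [map_add]; exact Submodule.add_mem _ hx hy
  | smul r x hx => exact Submodule.smul_mem _ r hx

theorem AlgB.mem_span_mk (x : AlgB F p) : x ∈ Submodule.span F (Set.range (AlgB.mk F (p := p))) := by
  obtain ⟨x, rfl⟩ := Ideal.Quotient.mk_surjective x
  induction x using MonoidAlgebra.induction_on with
  | of m =>
    obtain ⟨D, rfl⟩ : ∃ D, JacobiClass.mk D = m := Quotient.exists_rep m
    exact Submodule.subset_span ⟨D, rfl⟩
  | add x y hx hy => rw [map_add]; exact Submodule.add_mem _ hx hy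
  | smul r x hx => exact Submodule.smul_mem _ r hx

theorem AlgA.hom_ext {V : Type*} [AddCommGroup V] [Module F V] {f g : AlgA F p →ₗ[F] V}
    (h : ∀ T, f (AlgA.mk F T) = g (AlgA.mk F T)) : f = g :=
  LinearMap.ext fun x => by
    induction AlgA.mem_span_mk x using Submodule.span_induction with
    | mem x hx => obtain ⟨T, rfl⟩ := hx; exact h T
    | zero => simp
    | add x y _ _ hx hy => rw [map_add, map_add, hx, hy]
    | smul r x _ hx => rw [map_smul, map_smul, hx]

theorem AlgB.hom_ext {V : Type*} [AddCommGroup V] [Module F V] {f g : AlgB F p →ₗ[F] V}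
    (h : ∀ D, f (AlgB.mk F D) = g (AlgB.mk F D)) : f = g :=
  LinearMap.ext fun x => by
    induction AlgB.mem_span_mk x using Submodule.span_induction with
    | mem x hx => obtain ⟨T, rfl⟩ := hx; exact h T
    | zero => simp
    | add x y _ _ hx hy => rw [map_add, map_add, hx, hy]
    | smul r x _ hx => rw [map_smul, map_smul, hx]

/-- A linear map on the span of the generalized chord diagrams that respects the relations
descends to `𝓐(p)`. -/
theorem AlgA.exists_lift {V : Type*} [AddCommGroup V] [Module F V] (φ : StrandDiagram p → V)
    (iso : ∀ D E : StrandDiagram p, D.Iso E → φ D = φ E)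
    (as : ∀ (D E : StrandDiagram p) (h : D.H) (f : D.H ≃ E.H), ¬ D.IsLeg h →
      D.IsRegluing E (D.flip h) f → φ D + φ E = 0)
    (ihx : ∀ (D E G : StrandDiagram p) (h : D.H) (f : D.H ≃ E.H) (g : D.H ≃ G.H), D.IsInner h →
      D.IsRegluing E (D.turn h) f → D.IsRegluing G (D.turn h)⁻¹ g → φ D + φ E + φ G = 0)
    (stu : ∀ (S T U : StrandDiagram p) (x y : T.H) (f : T.H ≃ U.H) (g : T.H ⊕ Bool ≃ S.H)
      (π : Equiv.Perm T.H), T.Adjacent x y → π x = y → π y = x → (∀ a, a ≠ x → a ≠ y → π a = a) →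
      T.IsRegluing U π f → T.IsMerging x y S g → φ S = φ T - φ U) :
    ∃ Φ : AlgA F p →ₗ[F] V, ∀ T, Φ (AlgA.mk F T) = φ T := by
  classical
  let q : StrandClass p → V := Quotient.lift φ iso
  let pre : MonoidAlgebra F (StrandClass p) →ₗ[F] V :=
    Finsupp.linearCombination F q ∘ₗ
      (MonoidAlgebra.coeffLinearEquiv F).toLinearMap
  have hpre : ∀ T, pre (MonoidAlgebra.of F _ (StrandClass.mk T)) = φ T := by
    intro T
    have h : (MonoidAlgebra.coeffLinearEquiv F) (MonoidAlgebra.of F _ (StrandClass.mk T)) =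
      Finsupp.single (StrandClass.mk T) (1 : F) := rfl
    simp only [pre]
    rw [LinearMap.comp_apply, LinearEquiv.coe_coe, h, Finsupp.linearCombination_single, one_smul]
    rfl
  have hrel : ∀ x, StrandRelation F p x → pre x = 0 := by
    intro x hx
    cases hx with
    | as D E h f hh hf => rw [map_add, hpre, hpre, as D E h f hh hf]
    | ihx D E G h f g hh hf hg => rw [map_add, map_add, hpre, hpre, hpre, ihx D E G h f g hh hf hg]
    | stu S T U x y f g hxy hf hg =>
      rw [map_sub, map_sub, hpre, hpre, hpre, stu S T U x y f g _ hxy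
        (@Equiv.swap_apply_left _ (fun a b => Classical.propDecidable _) _ _)
        (@Equiv.swap_apply_right _ (fun a b => Classical.propDecidable _) _ _)
        (fun a => @Equiv.swap_apply_of_ne_of_ne _ (fun a b => Classical.propDecidable _) _ _ _)
        hf hg, sub_self]
  refine ⟨((relationsA F p).restrictScalars F).liftQ pre (Submodule.span_le.2 hrel) ∘ₗ
    (Submodule.Quotient.restrictScalarsEquiv F (relationsA F p)).symm.toLinearMap, hpre⟩

end Span

/-! ### The STU relation in terms of canonical listings -/

namespace StrandDiagram

variable {p : ℕ}

/-- Sorting by colour first makes the legs of one colour consecutive, so a leg listed between `x`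
and `y` would lie between them on their strand. -/
theorem Adjacent.exists_legList {T : StrandDiagram p} {x y : T.H} (h : T.Adjacent x y) :
    ∃ u v, T.legList = u ++ x :: y :: v := by
  obtain ⟨hx, hy, hc⟩ := T.attached.legs x y h.1
  have hp := T.pairwise_legList
  obtain ⟨u, w, e⟩ := List.append_of_mem ((T.isListing_legList.mem x).2 hx)
  have hyw : y ∈ w := by
    have hy' := (T.isListing_legList.mem y).2 hy
    rw [e, List.mem_append, List.mem_cons] at hy'
    rcases hy' with h1 | rfl | h1
    · rw [e, List.pairwise_append] at hp
      have h2 := hp.2.2 y h1 x (by simp)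
      exact (T.not_precedes_self x (StrandDiagram.Precedes.trans (Or.inr h.1) h2)).elim
    · exact (T.attached.irrefl _ h.1).elim
    · exact h1
  obtain ⟨w₁, v, rfl⟩ := List.append_of_mem hyw
  cases w₁ with
  | nil => exact ⟨u, v, e⟩
  | cons z w₁ =>
    exfalso
    rw [e, List.pairwise_append] at hp
    obtain ⟨-, hp, -⟩ := hp
    rw [List.pairwise_cons] at hp
    have h1 : T.Precedes x z := hp.1 z (by simp)
    have h2 : T.Precedes z y := by
      have := hp.2
      rw [List.cons_append, List.pairwise_cons] at this
      exact this.1 y (by simp)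
    rcases h1 with h1 | h1
    · rcases h2 with h2 | h2
      · exact (h1.trans h2).ne hc
      · exact h1.ne (hc.trans (T.attached.legs _ _ h2).2.2.symm)
    · rcases h2 with h2 | h2
      · exact h2.ne ((T.attached.legs _ _ h1).2.2.symm.trans hc)
      · exact h.2 ⟨z, h1, h2⟩

/-- Every merging allowed in STU is isomorphic to the standard `merge`, so what is known about
`sigma` on the latter applies to the term `S`. -/
theorem IsMerging.isRegluing {T S : StrandDiagram p} {x y : T.H} {g : T.H ⊕ Bool ≃ S.H}
    (hg : T.IsMerging x y S g) (hxy : T.LegPair x y) :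
    (T.merge x y hxy).IsRegluing S.toJacobiDiagram 1 g where
  next h := by
    refine merge_cases hxy (fun h hx hy => ?_) ?_ ?_ ?_ ?_ h
    · rw [merge_next_old hxy hx hy]; exact hg.next h hx hy
    · rw [merge_next_left]; exact hg.next_x
    · rw [merge_next_right]; exact hg.next_y
    · rw [merge_next_stem]; exact hg.next_stem
    · rw [merge_next_foot]; exact hg.next_foot
  edge h := by
    rcases h with h | _ | _
    · exact hg.edge h
    · exact hg.edge_stem
    · have := S.edge_edge (g (.inr false))
      rw [hg.edge_stem] at this
      exact this
  color h := by
    refine merge_cases hxy (fun h hx hy hh => ?_) ?_ ?_ ?_ ?_ h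
    · exact hg.color h ((isLeg_old hxy).1 hh).1 hx hy
    · exact fun hh => (((isLeg_old hxy).1 hh).2.1 rfl).elim
    · exact fun hh => (((isLeg_old hxy).1 hh).2.2 rfl).elim
    · exact fun hh => (not_isLeg_stem hxy hh).elim
    · exact fun _ => hg.color_foot

/-- The new leg takes the place of the neighbours `x` and `y` in the order by colour and position,
and the canonical listing is determined by that order. -/
theorem IsMerging.legList {T S : StrandDiagram p} {x y : T.H} {g : T.H ⊕ Bool ≃ S.H}
    (hg : T.IsMerging x y S g) {u v : List T.H} (h : T.IsListing (u ++ x :: y :: v))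
    (he : T.legList = u ++ x :: y :: v) :
    S.legList = (mergeList h.legPair u v).map g := by
  have hxy := h.legPair
  obtain ⟨h1, h2, h3, h4, h5⟩ := h.notMem
  have hp := T.pairwise_legList
  rw [he, List.pairwise_append, List.pairwise_cons, List.pairwise_cons] at hp
  obtain ⟨hu, ⟨hx, -, hv⟩, huv⟩ := hp
  have ne_u : ∀ a ∈ u, T.IsLeg a ∧ a ≠ x ∧ a ≠ y := fun a ha =>
    ⟨(h.mem a).1 (by simp [ha]), fun e => h1 (e ▸ ha), fun e => h3 (e ▸ ha)⟩
  have ne_v : ∀ a ∈ v, T.IsLeg a ∧ a ≠ x ∧ a ≠ y := fun a ha =>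
    ⟨(h.mem a).1 (by simp [ha]), fun e => h2 (e ▸ ha), fun e => h4 (e ▸ ha)⟩
  have key : ∀ a b, (T.IsLeg a ∧ a ≠ x ∧ a ≠ y) → (T.IsLeg b ∧ b ≠ x ∧ b ≠ y) →
      T.Precedes a b → S.Precedes (g (.inl a)) (g (.inl b)) := by
    intro a b ha hb hab
    refine hab.imp (fun hc => ?_) (hg.lt a b ha.2.1 ha.2.2 hb.2.1 hb.2.2).2
    rwa [hg.color a ha.1 ha.2.1 ha.2.2, hg.color b hb.1 hb.2.1 hb.2.2]
  refine S.eq_legList (h.merge.map (hg.isRegluing hxy)) ?_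
  have hpw : ((u.map fun a => g (.inl a)) ++ g (.inr true) ::
      v.map fun a => g (.inl a)).Pairwise S.Precedes := by
    simp only [List.pairwise_append, List.pairwise_cons, List.pairwise_map, List.mem_map,
      List.mem_cons]
    refine ⟨hu.imp_of_mem fun ha hb => key _ _ (ne_u _ ha) (ne_u _ hb), ⟨?_, hv.imp_of_mem
      fun ha hb => key _ _ (ne_v _ ha) (ne_v _ hb)⟩, ?_⟩
    · rintro _ ⟨b, hb, rfl⟩
      obtain ⟨b1, b2, b3⟩ := ne_v b hb
      refine (hx b (by simp [hb])).imp (fun hc => ?_) (hg.foot_lt b b2 b3).2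
      rwa [hg.color_foot, hg.color b b1 b2 b3]
    · rintro _ ⟨a, ha, rfl⟩ c hc
      obtain ⟨a1, a2, a3⟩ := ne_u a ha
      rcases hc with rfl | ⟨b, hb, rfl⟩
      · refine (huv a ha x (by simp)).imp (fun hc => ?_) (hg.lt_foot a a2 a3).2
        rwa [hg.color_foot, hg.color a a1 a2 a3]
      · exact key _ _ (ne_u a ha) (ne_v b hb) (huv a ha b (by simp [hb]))
  refine Eq.subst (motive := fun l => List.Pairwise S.Precedes l) ?_ hpw
  refine (Eq.trans (List.map_append (f := g)) ?_).symm
  exact congrArg₂ (· ++ ·) List.map_map (congrArg _ List.map_map)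

end StrandDiagram

/-- The term `U` of STU has the same underlying graph as `T`, through the renaming that exchanges
`x` and `y`; only the order of the legs distinguishes them. -/
theorem JacobiDiagram.IsRegluing.exchange {p : ℕ} {D E : JacobiDiagram p} {π : Equiv.Perm D.H}
    {f : D.H ≃ E.H} (hf : D.IsRegluing E π f) {x y : D.H} (hxy : D.LegPair x y)
    (hc : D.color x = D.color y) (hx : π x = y) (hy : π y = x)
    (h : ∀ a, a ≠ x → a ≠ y → π a = a) : D.IsRegluing E 1 (π.trans f) := by
  classical
  have e : π = Equiv.swap x y := by
    ext a
    by_cases h1 : a = x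
    · rw [h1, hx, Equiv.swap_apply_left]
    by_cases h2 : a = y
    · rw [h2, hy, Equiv.swap_apply_right]
    rw [h a h1 h2, Equiv.swap_apply_of_ne_of_ne h1 h2]
  have hs := hxy.isRegluing_swap hc
  rw [← e] at hs
  refine ⟨fun a => ?_, fun a => hf.edge a, fun a ha => ?_⟩
  · exact (hf.next (π a)).trans (congrArg f (hs.next a))
  · exact (hf.color (π a) ((hs.isLeg_iff a).2 ha)).trans (hs.color a ha)

/-! ### The maps `χ` and `σ` are inverse to each other -/

section Inverse

variable (F : Type*) [Field F] {p : ℕ}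

/-- The image of a generalized chord diagram under the inverse of the symmetrization map. -/
noncomputable def StrandDiagram.sigma (T : StrandDiagram p) : AlgB F p :=
  JacobiDiagram.sigma F T.legList.length T.toJacobiDiagram T.legList

variable (p)

/-- Since `legList` is natural, isomorphism invariance, AS and IHX are fields of `SigmaProps`. STU
is the condition `step` at the exchange of two neighbours in the canonical listing. -/
theorem exists_sigmaHom [CharZero F] : ∃ Φ : AlgA F p →ₗ[F] AlgB F p, ∀ T,
    Φ (AlgA.mk F T) = T.sigma F := by
  have hs := sigmaProps p F
  refine AlgA.exists_lift _ ?_ ?_ ?_ ?_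
  · rintro D E ⟨f, hf⟩
    rw [StrandDiagram.sigma, StrandDiagram.sigma, hf.legList, List.length_map,
      (hs _).iso _ _ f hf.1 _ D.isListing_legList rfl]
  · intro D E h f hh hf
    rw [StrandDiagram.sigma, StrandDiagram.sigma, hf.legList, List.length_map,
      (hs _).as _ _ h f hh hf.1 _ D.isListing_legList rfl]
  · intro D E G h f g hh hf hg
    rw [StrandDiagram.sigma, StrandDiagram.sigma, StrandDiagram.sigma, hf.legList, hg.legList,
      List.length_map, List.length_map,
      (hs _).ihx _ _ _ h f g hh hf.1 hg.1 _ D.isListing_legList rfl]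
  · intro S T U x y f g π hxy hx hy hπ hf hg
    obtain ⟨u, v, he⟩ := hxy.exists_legList
    have hl := T.isListing_legList
    rw [he] at hl
    have hc := (T.attached.legs x y hxy.1).2.2
    have hU := hf.1.exchange hl.legPair hc hx hy hπ
    -- Through the renaming, `U` carries the canonical listing of `T` with `x` and `y` exchanged.
    have eU : U.legList = (u ++ y :: x :: v).map (π.trans f) := by
      obtain ⟨h1, h2, h3, h4, h5⟩ := hl.notMem
      have hid : ∀ w : List T.H, x ∉ w → y ∉ w → w.map (fun a => f (π a)) = w.map f := fun w a b =>
        List.map_congr_left fun c hc => by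
          rw [hπ c (fun e => a (e ▸ hc)) (fun e => b (e ▸ hc))]
      rw [hf.legList, he]
      have h6 := hid u h1 h3
      have h7 := hid v h2 h4
      simp only [List.map_append, List.map_cons, hx, hy, Equiv.coe_trans,
        Function.comp_def, h6, h7]
    have eS := hg.legList hl he
    have eS' : S.sigma F = JacobiDiagram.sigma F (mergeList hl.legPair u v).length
        (T.merge x y hl.legPair) (mergeList hl.legPair u v) := by
      rw [StrandDiagram.sigma, eS, ← (hs _).iso _ _ g (hg.isRegluing hl.legPair) _ hl.merge rfl]
      exact congrArg (fun n => JacobiDiagram.sigma F n _ _) (List.length_map (as := mergeList _ u v) _)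
    rw [eS', StrandDiagram.sigma, StrandDiagram.sigma, he, eU, List.length_map,
      (hs _).iso _ _ _ hU _ hl.swap rfl]
    have h1 := length_mergeList hl.legPair u v
    have h2 : (u ++ y :: x :: v).length = (u ++ x :: y :: v).length := by simp
    have h3 := (hs _).step hl rfl
    rw [if_pos hc] at h3
    rw [h2, h3, ← h1, Nat.add_sub_cancel]

/-- The inverse of the symmetrization map. -/
noncomputable def sigmaHom [CharZero F] : AlgA F p →ₗ[F] AlgB F p := (exists_sigmaHom F p).choose

variable {p}

theorem sigmaHom_mk [CharZero F] (T : StrandDiagram p) : sigmaHom F p (AlgA.mk F T) = T.sigma F :=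
  (exists_sigmaHom F p).choose_spec T

/-- Both sides change under exchanges as STU prescribes, with equal changes by induction. Both have
the same sum over attachments: the left side by normalization, the right side because `χ` is the
average over attachments. So their difference vanishes. -/
theorem JacobiDiagram.chi_sigma [CharZero F] (n : ℕ) : ∀ (D : JacobiDiagram p) (l : List D.H),
    D.IsListing l → l.length = n → chi F p (JacobiDiagram.sigma F n D l) = mkList F D l := by
  induction n using Nat.strong_induction_on with
  | _ n ih =>
    intro D l hl hlen
    have hn := (sigmaProps p F n).normalized D l hl hlen
    rw [← sub_eq_zero]
    refine hl.eq_zero (F := F)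
      (fun l => chi F p (JacobiDiagram.sigma F n D l) - mkList F D l) ?_ ?_
    · intro u x y v h
      rw [sub_eq_sub_iff_sub_eq_sub, ← map_sub, hn.step u x y v h, mkList_swap h]
      split_ifs
      · have h1 := length_mergeList h.legPair u v
        have h2 := (h.perm hl).length_eq
        exact ih (n - 1) (by omega) _ _ h.merge (by omega)
      · simp
    · have := Fintype.ofFinite D.Attachment
      rw [finsum_sub_distrib (Set.toFinite _) (Set.toFinite _)]
      have h1 : ∑ᶠ r : D.Attachment, chi F p (JacobiDiagram.sigma F n D (D.attach r).legList) =
          chi F p (∑ᶠ r : D.Attachment, JacobiDiagram.sigma F n D (D.attach r).legList) := by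
        rw [finsum_eq_sum_of_fintype, finsum_eq_sum_of_fintype, map_sum]
      have h2 : ∑ᶠ r : D.Attachment, mkList F D (D.attach r).legList =
          ∑ᶠ r : D.Attachment, AlgA.mk F (D.attach r) :=
        finsum_congr fun r => (D.attach r).mkList_legList F
      rw [h1, h2, hn.sum, map_smul, chi_mk, symmetrize, smul_smul, mul_inv_cancel₀ (by simp),
        one_smul, sub_self]

theorem chi_sigmaHom [CharZero F] (x : AlgA F p) : chi F p (sigmaHom F p x) = x := by
  have : (chi F p) ∘ₗ (sigmaHom F p) = LinearMap.id := AlgA.hom_ext fun T => by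
    rw [LinearMap.comp_apply, sigmaHom_mk, LinearMap.id_apply, StrandDiagram.sigma,
      chi_sigma (F := F) _ _ _ T.isListing_legList rfl, T.mkList_legList F]
  exact LinearMap.congr_fun this x

/-- The normalization of `sigma` says that its average over the attachments of `D` is the class of
`D`. -/
theorem sigmaHom_chi [CharZero F] (x : AlgB F p) : sigmaHom F p (chi F p x) = x := by
  have : (sigmaHom F p) ∘ₗ (chi F p) = LinearMap.id := AlgB.hom_ext fun D => by
    have := Fintype.ofFinite D.Attachment
    obtain ⟨l, hl⟩ := D.exists_isListing
    have hn := (sigmaProps p F _).normalized D l hl rfl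
    have h1 : ∀ r : D.Attachment, sigmaHom F p (AlgA.mk F (D.attach r)) =
        JacobiDiagram.sigma F l.length D (D.attach r).legList := fun r => by
      rw [sigmaHom_mk, StrandDiagram.sigma, ((D.attach r).isListing_legList.perm hl).length_eq]
      rfl
    rw [LinearMap.comp_apply, chi_mk, LinearMap.id_apply, symmetrize, map_smul,
      finsum_eq_sum_of_fintype, map_sum, Finset.sum_congr rfl fun r _ => h1 r,
      ← finsum_eq_sum_of_fintype, hn.sum, smul_smul, inv_mul_cancel₀ (by simp), one_smul]
  exact LinearMap.congr_fun this x

theorem chi_bijective [CharZero F] : Function.Bijective (chi F p) :=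
  ⟨Function.LeftInverse.injective (sigmaHom_chi F), Function.RightInverse.surjective (chi_sigmaHom F)⟩

end Inverse

/-! ## Connected components -/

namespace List

variable {α β : Type*} {l : List α} {m : List β}

theorem inl_mem_map_append_map {a : α} : Sum.inl a ∈ l.map Sum.inl ++ m.map Sum.inr ↔ a ∈ l := by
  simp

theorem inr_mem_map_append_map {b : β} : Sum.inr b ∈ l.map Sum.inl ++ m.map Sum.inr ↔ b ∈ m := by
  simp

theorem nodup_map_inl_append_map_inr (hl : l.Nodup) (hm : m.Nodup) :
    (l.map Sum.inl ++ m.map Sum.inr).Nodup := by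
  refine List.nodup_append.2 ⟨hl.map Sum.inl_injective, hm.map Sum.inr_injective, ?_⟩
  simp

theorem before_inl_inl {a b : α} :
    (l.map Sum.inl ++ m.map Sum.inr).Before (Sum.inl a) (Sum.inl b) ↔ l.Before a b := by
  rw [before_append, before_map Sum.inl_injective]
  have h : ¬ (m.map Sum.inr).Before (Sum.inl a) (Sum.inl b) := fun h => by simpa using h.mem.1
  simp [h]

theorem before_inl_inr {a : α} {b : β} :
    (l.map Sum.inl ++ m.map Sum.inr).Before (Sum.inl a) (Sum.inr b) ↔ a ∈ l ∧ b ∈ m := by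
  rw [before_append]
  have h1 : ¬ (l.map Sum.inl).Before (Sum.inl a) (Sum.inr b) := fun h => by simpa using h.mem.2
  have h2 : ¬ (m.map Sum.inr).Before (Sum.inl a) (Sum.inr b) := fun h => by simpa using h.mem.1
  simp [h1, h2]

theorem not_before_inr_inl {a : α} {b : β} :
    ¬ (l.map Sum.inl ++ m.map Sum.inr).Before (Sum.inr b) (Sum.inl a) := by
  rw [before_append]
  have h1 : ¬ (l.map Sum.inl).Before (Sum.inr b) (Sum.inl a) := fun h => by simpa using h.mem.1
  have h2 : ¬ (m.map Sum.inr).Before (Sum.inr b) (Sum.inl a) := fun h => by simpa using h.mem.2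
  simp [h1, h2]

theorem before_inr_inr {a b : β} :
    (l.map Sum.inl ++ m.map Sum.inr).Before (Sum.inr a) (Sum.inr b) ↔ m.Before a b := by
  rw [before_append, before_map Sum.inr_injective]
  have h : ¬ (l.map Sum.inl).Before (Sum.inr a) (Sum.inr b) := fun h => by simpa using h.mem.1
  simp [h]

end List

namespace JacobiDiagram

variable {p : ℕ}

/-- The set of half-edges `P` is a union of connected components. -/
structure Saturated (D : JacobiDiagram p) (P : D.H → Prop) : Prop where
  edge : ∀ h, P (D.edge h) ↔ P h
  next : ∀ h, P (D.next h) ↔ P h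

theorem Saturated.compl {D : JacobiDiagram p} {P : D.H → Prop} (hP : D.Saturated P) :
    D.Saturated fun h => ¬ P h :=
  ⟨fun h => not_congr (hP.edge h), fun h => not_congr (hP.next h)⟩

theorem saturated_joined (D : JacobiDiagram p) (a : D.H) : D.Saturated (D.Joined a) :=
  ⟨fun h => ⟨fun h1 => .trans _ _ _ h1 (.symm _ _ (Joined.edge h)), fun h1 => .trans _ _ _ h1 (Joined.edge h)⟩,
    fun h => ⟨fun h1 => .trans _ _ _ h1 (.symm _ _ (Joined.next h)), fun h1 => .trans _ _ _ h1 (Joined.next h)⟩⟩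

/-- A path that starts in `P` never leaves `P`, so it is also a path in the restricted graph. -/
theorem Saturated.joined {D : JacobiDiagram p} {P : D.H → Prop} (hP : D.Saturated P) {a b : D.H}
    (h : D.Joined a b) : (P a ↔ P b) ∧ ∀ (ha : P a) (hb : P b), Relation.EqvGen
      (fun a b : {h // P h} => b = D.edge.subtypePerm hP.edge a ∨ b = D.next.subtypePerm hP.next a)
      ⟨a, ha⟩ ⟨b, hb⟩ := by
  induction h with
  | rel a b hab =>
    rcases hab with rfl | rfl
    · exact ⟨(hP.edge a).symm, fun _ _ => .rel _ _ (Or.inl rfl)⟩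
    · exact ⟨(hP.next a).symm, fun _ _ => .rel _ _ (Or.inr rfl)⟩
  | refl a => exact ⟨Iff.rfl, fun _ _ => .refl _⟩
  | symm a b _ ih => exact ⟨ih.1.symm, fun ha hb => .symm _ _ (ih.2 hb ha)⟩
  | trans a b c _ _ ih1 ih2 =>
    exact ⟨ih1.1.trans ih2.1, fun ha hc => .trans _ _ _ (ih1.2 ha (ih1.1.1 ha))
      (ih2.2 (ih1.1.1 ha) hc)⟩

/-- The union of some of the connected components of `D`. -/
def restrict (D : JacobiDiagram p) (P : D.H → Prop) (hP : D.Saturated P) : JacobiDiagram p where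
  H := {h // P h}
  finite := by
    have := D.finite
    infer_instance
  edge := D.edge.subtypePerm hP.edge
  next := D.next.subtypePerm hP.next
  color h := D.color h
  edge_edge h := Subtype.ext (D.edge_edge h)
  edge_ne h e := D.edge_ne h (congrArg Subtype.val e)
  next_next_next h := Subtype.ext (D.next_next_next h)
  legged := by
    rintro ⟨h, hh⟩
    obtain ⟨l, hl, hc⟩ := D.legged h
    obtain ⟨h1, h2⟩ := hP.joined hc
    exact ⟨⟨l, h1.1 hh⟩, Subtype.ext hl, h2 hh _⟩

theorem isLeg_restrict {D : JacobiDiagram p} {P : D.H → Prop} (hP : D.Saturated P)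
    (h : (D.restrict P hP).H) : (D.restrict P hP).IsLeg h ↔ D.IsLeg h.1 := Subtype.ext_iff

theorem connected_restrict_joined (D : JacobiDiagram p) (a : D.H) :
    (D.restrict _ (D.saturated_joined a)).Connected :=
  ⟨⟨⟨a, .refl _⟩⟩, fun ⟨_, hb⟩ ⟨_, hc⟩ =>
    ((D.saturated_joined a).joined (.trans _ _ _ (.symm _ _ hb) hc)).2 hb hc⟩

open Classical in
theorem isRegluing_restrict_union (D : JacobiDiagram p) (P : D.H → Prop) (hP : D.Saturated P) :
    ((D.restrict P hP).union (D.restrict _ hP.compl)).IsRegluing D 1 (Equiv.sumCompl P) := by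
  constructor <;> rintro (h | h) <;> first | rfl | exact fun _ => rfl

/-- Diagrams are taken apart one component at a time; the half-edge `c` records that the component
split off is the one containing `a`. -/
theorem exists_iso_connected_union (D : JacobiDiagram p) (a : D.H) :
    ∃ (C E : JacobiDiagram p) (f : (C.union E).H ≃ D.H) (c : C.H), C.Connected ∧
      (C.union E).IsRegluing D 1 f ∧ f (.inl c) = a :=
  ⟨_, _, _, (⟨a, .refl _⟩ : {h // D.Joined a h}), D.connected_restrict_joined a,
    D.isRegluing_restrict_union _ (D.saturated_joined a), rfl⟩

theorem Connected.of_saturated {D : JacobiDiagram p} (hD : D.Connected) {P : D.H → Prop}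
    (hP : D.Saturated P) {a : D.H} (ha : P a) (b : D.H) : P b :=
  (hP.joined (hD.2 a b)).1.1 ha

/-- The half-edge `h` belongs to a strut of colour `i`. -/
structure IsStrut (D : JacobiDiagram p) (i : Fin p) (h : D.H) : Prop where
  left : D.IsLeg h
  right : D.IsLeg (D.edge h)
  color_left : D.color h = i
  color_right : D.color (D.edge h) = i

/-- No component of `D` is a strut whose ends have the same colour. -/
def NoStrut (D : JacobiDiagram p) : Prop := ∀ i h, ¬ D.IsStrut i h

theorem IsStrut.edge {D : JacobiDiagram p} {i : Fin p} {h : D.H} (hh : D.IsStrut i h) :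
    D.IsStrut i (D.edge h) :=
  ⟨hh.right, by rw [D.edge_edge]; exact hh.left, hh.color_right,
    by rw [D.edge_edge]; exact hh.color_left⟩

theorem IsStrut.saturated {D : JacobiDiagram p} {i : Fin p} {h : D.H} (hh : D.IsStrut i h) :
    D.Saturated fun a => a = h ∨ a = D.edge h where
  edge a := by
    have h1 : D.edge a = h ↔ a = D.edge h := by
      constructor <;> rintro rfl <;> rw [D.edge_edge]
    rw [h1, D.edge.injective.eq_iff, or_comm]
  next a := by
    have h1 : D.next a = h ↔ a = h := ⟨fun e => hh.left.of_next e, by rintro rfl; exact hh.left⟩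
    have h2 : D.next a = D.edge h ↔ a = D.edge h :=
      ⟨fun e => hh.right.of_next e, by rintro rfl; exact hh.right⟩
    rw [h1, h2]

theorem Connected.exists_isRegluing_strut {D : JacobiDiagram p} (hD : D.Connected) {i : Fin p}
    {h : D.H} (hh : D.IsStrut i h) : ∃ f : Bool ≃ D.H, (strut i).IsRegluing D 1 f ∧
      f false = h ∧ f true = D.edge h := by
  have hinj : Function.Bijective fun b : Bool => bif b then D.edge h else h := by
    constructor
    · rintro (_ | _) (_ | _) e
      · rfl
      · exact (D.edge_ne h e.symm).elim
      · exact (D.edge_ne h e).elim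
      · rfl
    · intro a
      rcases hD.of_saturated hh.saturated (Or.inl rfl) a with rfl | rfl
      · exact ⟨false, rfl⟩
      · exact ⟨true, rfl⟩
  refine ⟨Equiv.ofBijective _ hinj, ⟨?_, ?_, ?_⟩, rfl, rfl⟩
  · rintro (_ | _)
    · exact hh.left
    · exact hh.right
  · rintro (_ | _)
    · rfl
    · exact D.edge_edge h
  · rintro (_ | _) _
    · exact hh.color_left
    · exact hh.color_right

theorem IsRegluing.isStrut_iff {D E : JacobiDiagram p} {f : D.H ≃ E.H} (hf : D.IsRegluing E 1 f)
    {i : Fin p} {h : D.H} : E.IsStrut i (f h) ↔ D.IsStrut i h := by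
  have he : E.edge (f h) = f (D.edge h) := hf.edge h
  constructor
  · rintro ⟨h1, h2, h3, h4⟩
    rw [he] at h2 h4
    rw [hf.isLeg_iff] at h1 h2
    rw [hf.color _ h1] at h3
    rw [hf.color _ h2] at h4
    exact ⟨h1, h2, h3, h4⟩
  · rintro ⟨h1, h2, h3, h4⟩
    rw [← hf.color _ h1] at h3
    rw [← hf.color _ h2] at h4
    rw [← hf.isLeg_iff] at h1 h2
    rw [← he] at h2 h4
    exact ⟨h1, h2, h3, h4⟩

theorem NoStrut.iso {D E : JacobiDiagram p} {f : D.H ≃ E.H} (hE : E.NoStrut)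
    (hf : D.IsRegluing E 1 f) : D.NoStrut :=
  fun i h hh => hE i (f h) (hf.isStrut_iff.2 hh)

theorem isStrut_union_inl {D E : JacobiDiagram p} {i : Fin p} {h : D.H} :
    (D.union E).IsStrut i (.inl h) ↔ D.IsStrut i h :=
  ⟨fun ⟨h1, h2, h3, h4⟩ => ⟨Sum.inl_injective h1, Sum.inl_injective h2, h3, h4⟩,
    fun ⟨h1, h2, h3, h4⟩ => ⟨congrArg Sum.inl h1, congrArg Sum.inl h2, h3, h4⟩⟩

theorem isStrut_union_inr {D E : JacobiDiagram p} {i : Fin p} {h : E.H} :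
    (D.union E).IsStrut i (.inr h) ↔ E.IsStrut i h :=
  ⟨fun ⟨h1, h2, h3, h4⟩ => ⟨Sum.inr_injective h1, Sum.inr_injective h2, h3, h4⟩,
    fun ⟨h1, h2, h3, h4⟩ => ⟨congrArg Sum.inr h1, congrArg Sum.inr h2, h3, h4⟩⟩

theorem noStrut_union {D E : JacobiDiagram p} :
    (D.union E).NoStrut ↔ D.NoStrut ∧ E.NoStrut :=
  ⟨fun h => ⟨fun i a ha => h i (.inl a) (isStrut_union_inl.2 ha),
    fun i a ha => h i (.inr a) (isStrut_union_inr.2 ha)⟩, fun h i a => by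
    rcases a with a | a
    · exact fun ha => h.1 i a (isStrut_union_inl.1 ha)
    · exact fun ha => h.2 i a (isStrut_union_inr.1 ha)⟩

theorem isStrut_merge_old {D : JacobiDiagram p} {x y : D.H} (hxy : D.LegPair x y) {i : Fin p}
    {h : D.H} : (D.merge x y hxy).IsStrut i (old hxy h) ↔
      D.IsStrut i h ∧ h ≠ x ∧ h ≠ y ∧ D.edge h ≠ x ∧ D.edge h ≠ y := by
  constructor
  · rintro ⟨h1, h2, h3, h4⟩
    rw [merge_edge_old] at h2 h4
    rw [isLeg_old] at h1 h2
    exact ⟨⟨h1.1, h2.1, h3, h4⟩, h1.2.1, h1.2.2, h2.2⟩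
  · rintro ⟨⟨h1, h2, h3, h4⟩, h5, h6, h7, h8⟩
    exact ⟨(isLeg_old hxy).2 ⟨h1, h5, h6⟩, (isLeg_old hxy).2 ⟨h2, h7, h8⟩, h3, h4⟩

theorem not_isStrut_stem {D : JacobiDiagram p} {x y : D.H} (hxy : D.LegPair x y) {i : Fin p} :
    ¬ (D.merge x y hxy).IsStrut i (stem hxy) := fun h => not_isLeg_stem hxy h.left

theorem not_isStrut_foot {D : JacobiDiagram p} {x y : D.H} (hxy : D.LegPair x y) {i : Fin p} :
    ¬ (D.merge x y hxy).IsStrut i (foot hxy) := fun h => not_isLeg_stem hxy h.right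

/-- The new leg hangs on a trivalent vertex and `x`, `y` cease to be legs, so merging can destroy
struts but never creates one. This is why STU is compatible with the deframing subalgebras. -/
theorem NoStrut.merge {D : JacobiDiagram p} (hD : D.NoStrut) {x y : D.H} (hxy : D.LegPair x y) :
    (D.merge x y hxy).NoStrut := by
  rintro i (h | _ | _) hh
  · exact hD i h ((isStrut_merge_old hxy).1 hh).1
  · exact not_isStrut_stem hxy hh
  · exact not_isStrut_foot hxy hh

theorem Connected.noStrut {D : JacobiDiagram p} (hD : D.Connected)
    (h : ∀ i, ¬ D.Iso (strut i)) : D.NoStrut := fun i a ha => by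
  obtain ⟨f, hf, -⟩ := hD.exists_isRegluing_strut ha
  exact h i ⟨_, hf.symm⟩

theorem isStrut_strut (i : Fin p) (b : Bool) : (strut i).IsStrut i b := ⟨rfl, rfl, rfl, rfl⟩

theorem NoStrut.not_iso_strut {D : JacobiDiagram p} (hD : D.NoStrut) (i : Fin p) :
    ¬ D.Iso (strut i) := fun ⟨f, hf⟩ =>
  hD i (f.symm (show Bool from false)) (hf.isStrut_iff.1 (isStrut_strut i _))

theorem noStrut_empty (p : ℕ) : (empty p).NoStrut := fun _ h => h.elim

theorem iso_empty {D : JacobiDiagram p} [IsEmpty D.H] : D.Iso (empty p) :=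
  ⟨Equiv.equivEmpty _, ⟨fun h => isEmptyElim h, fun h => isEmptyElim h, fun h => isEmptyElim h⟩⟩

/-! ## Products -/

/-- The legs of the first diagram, followed by those of the second. -/
def unionList {D E : JacobiDiagram p} (l : List D.H) (m : List E.H) : List (D.union E).H :=
  l.map Sum.inl ++ m.map Sum.inr

theorem length_unionList {D E : JacobiDiagram p} (l : List D.H) (m : List E.H) :
    (unionList l m).length = l.length + m.length := by
  rw [unionList]
  exact List.length_append.trans (congrArg₂ _ (List.length_map _) (List.length_map _))

theorem IsListing.union {D E : JacobiDiagram p} {l : List D.H} {m : List E.H} (hl : D.IsListing l)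
    (hm : E.IsListing m) : (D.union E).IsListing (unionList l m) := by
  constructor
  · exact List.nodup_map_inl_append_map_inr hl.nodup hm.nodup
  · rintro (h | h)
    · rw [isLeg_union_inl, ← hl.mem]
      exact List.inl_mem_map_append_map
    · rw [isLeg_union_inr, ← hm.mem]
      exact List.inr_mem_map_append_map

theorem Connected.exists_isLeg {D : JacobiDiagram p} (hD : D.Connected) : ∃ h, D.IsLeg h := by
  obtain ⟨l, hl, -⟩ := D.legged hD.1.some
  exact ⟨l, hl⟩

theorem Connected.length_pos {D : JacobiDiagram p} (hD : D.Connected) {l : List D.H}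
    (hl : D.IsListing l) : 0 < l.length := by
  obtain ⟨h, hh⟩ := hD.exists_isLeg
  exact List.length_pos_of_mem ((hl.mem h).2 hh)

section

variable {F : Type*} [Field F]

theorem AlgB_mk_mul (D E : JacobiDiagram p) : AlgB.mk F D * AlgB.mk F E = AlgB.mk F (D.union E) := by
  rw [AlgB.mk, AlgB.mk, ← map_mul, ← map_mul]
  rfl

theorem AlgB_mk_empty : AlgB.mk F (empty p) = 1 := rfl

theorem AlgA_mk_mul (S T : StrandDiagram p) :
    AlgA.mk F S * AlgA.mk F T = AlgA.mk F (S.stack T) := by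
  rw [AlgA.mk, AlgA.mk, ← map_mul, ← map_mul]
  rfl

theorem AlgA_mk_empty : AlgA.mk F (StrandDiagram.empty p) = 1 := rfl

theorem AlgA_mk_of_isEmpty (T : StrandDiagram p) [IsEmpty T.H] : AlgA.mk F T = 1 :=
  AlgA_mk_eq_of_iso ⟨Equiv.equivEmpty _, ⟨⟨fun h => isEmptyElim h, fun h => isEmptyElim h,
    fun h => isEmptyElim h⟩, fun h => isEmptyElim h⟩⟩

/-- If all the legs of `D` precede those of `E` in one list, they do so on every strand, and this is
stacking. -/
theorem mkList_union {D E : JacobiDiagram p} {l : List D.H} {m : List E.H} (hl : D.IsListing l)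
    (hm : E.IsListing m) : mkList F (D.union E) (unionList l m) =
      mkList F D l * mkList F E m := by
  rw [mkList_of hl, mkList_of hm, mkList_of (hl.union hm), AlgA_mk_mul]
  refine AlgA_mk_eq_of_iso ⟨Equiv.refl _, .refl _, fun a b => ?_⟩
  rcases a with a | a <;> rcases b with b | b
  · exact and_congr_right fun _ => List.before_inl_inl.symm
  · change (D.IsLeg a ∧ E.IsLeg b ∧ D.color a = E.color b) ↔ (D.color a = E.color b ∧
      (l.map Sum.inl ++ m.map Sum.inr).Before (Sum.inl a) (Sum.inr b))
    rw [List.before_inl_inr, hl.mem, hm.mem, and_comm, and_assoc, and_left_comm, and_comm (a := E.IsLeg b)]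
  · exact iff_of_false (fun h => h) fun h => List.not_before_inr_inl h.2
  · exact and_congr_right fun _ => List.before_inr_inr.symm

end

end JacobiDiagram

/-! ## The deframing subalgebras as spans -/

namespace JacobiDiagram

variable {p : ℕ}

/-- A property of diagrams that is multiplicative, invariant under isomorphisms, true for the empty
diagram and for certain connected ones, holds for the disjoint unions of these. -/
theorem noStrut_induction {P : JacobiDiagram p → Prop} (empty : ∀ D, IsEmpty D.H → P D)
    (iso : ∀ (D E : JacobiDiagram p) (f : D.H ≃ E.H), D.IsRegluing E 1 f → P D → P E)
    (connected : ∀ D : JacobiDiagram p, D.Connected → D.NoStrut → P D)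
    (union : ∀ D E : JacobiDiagram p, P D → P E → P (D.union E))
    (D : JacobiDiagram p) (hD : D.NoStrut) : P D := by
  induction hn : Nat.card D.H using Nat.strong_induction_on generalizing D with
  | _ n ih =>
    subst hn
    rcases isEmpty_or_nonempty D.H with h | ⟨⟨a⟩⟩
    · exact empty D h
    obtain ⟨C, E, f, c, hC, hf, -⟩ := D.exists_iso_connected_union a
    have h1 := noStrut_union.1 (hD.iso hf)
    have := D.finite
    have := C.finite
    have := E.finite
    have h2 : Nat.card D.H = Nat.card C.H + Nat.card E.H := by
      rw [← Nat.card_sum]; exact (Nat.card_congr f).symm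
    have h3 : 0 < Nat.card C.H := Nat.card_pos_iff.2 ⟨⟨c⟩, inferInstance⟩
    exact iso _ _ f hf (union C E (connected C hC h1.1) (ih _ (by omega) E h1.2 rfl))

end JacobiDiagram

section

variable (F : Type*) [Field F]

/-- A connected diagram that is not a framing chord contains no framing chord. -/
theorem StrandDiagram.noStrut_of_connected {T : StrandDiagram 2} (hT : T.Connected)
    (h : ∀ i, ¬ T.Iso (StrandDiagram.chord i)) : T.NoStrut := by
  intro i a ha
  obtain ⟨b, hb, hlt⟩ : ∃ b, T.IsStrut i b ∧ T.lt b (T.edge b) := by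
    rcases T.attached.total a (T.edge a) ha.left ha.right (ha.color_left.trans ha.color_right.symm)
      (T.edge_ne a).symm with h1 | h1
    · exact ⟨a, ha, h1⟩
    · exact ⟨T.edge a, ha.edge, by rwa [T.edge_edge]⟩
  obtain ⟨f, hf, h0, h1⟩ := hT.exists_isRegluing_strut hb
  have hf' : (StrandDiagram.chord i).IsRegluing T 1 f := by
    refine ⟨hf, ?_⟩
    have h2 : ¬ T.lt (T.edge b) b := fun h => T.attached.irrefl _ (T.attached.trans _ _ _ h hlt)
    rintro (_ | _) (_ | _)
    · exact iff_of_false (T.attached.irrefl _) (by rintro ⟨_, h⟩; cases h)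
    · refine iff_of_true ?_ ⟨rfl, rfl⟩
      rw [← h1, ← h0] at hlt
      exact hlt
    · refine iff_of_false ?_ (by rintro ⟨h, _⟩; cases h)
      rw [← h1, ← h0] at h2
      exact h2
    · exact iff_of_false (T.attached.irrefl _) (by rintro ⟨h, _⟩; cases h)
  exact h i ⟨_, hf'.symm⟩

variable {F}

theorem AlgB.mk_mem_subB (D : JacobiDiagram 2) (hD : D.NoStrut) : AlgB.mk F D ∈ subB F := by
  refine noStrut_induction (P := fun D => AlgB.mk F D ∈ subB F) (fun D h => ?_)
    (fun D E f hf hD => ?_) (fun D hD hs => ?_) (fun D E hD hE => ?_) D hD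
  · rw [AlgB_mk_eq_of_iso iso_empty, AlgB_mk_empty]
    exact one_mem _
  · rwa [← AlgB_mk_eq_of_iso ⟨f, hf⟩]
  · exact Algebra.subset_adjoin ⟨D, hD, hs.not_iso_strut, rfl⟩
  · rw [← AlgB_mk_mul]
    exact mul_mem hD hE

/-- Up to isomorphism, the disjoint unions of the generators are exactly the diagrams none of whose
components is a strut with ends of equal colour. -/
theorem subB_eq_span : Subalgebra.toSubmodule (subB F) =
    Submodule.span F {x | ∃ D : JacobiDiagram 2, D.NoStrut ∧ x = AlgB.mk F D} := by
  refine le_antisymm ?_ (Submodule.span_le.2 ?_)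
  · rw [subB, Algebra.adjoin_eq_span]
    refine Submodule.span_mono fun x hx => ?_
    induction hx using Submonoid.closure_induction with
    | mem x hx =>
      obtain ⟨D, hD, hs, rfl⟩ := hx
      exact ⟨D, hD.noStrut hs, rfl⟩
    | one => exact ⟨_, noStrut_empty 2, AlgB_mk_empty.symm⟩
    | mul x y _ _ hx hy =>
      obtain ⟨D, hD, rfl⟩ := hx
      obtain ⟨E, hE, rfl⟩ := hy
      exact ⟨_, noStrut_union.2 ⟨hD, hE⟩, AlgB_mk_mul D E⟩
  · rintro _ ⟨D, hD, rfl⟩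
    exact AlgB.mk_mem_subB D hD

/-- By STU, a change of the order of the legs costs only diagrams with fewer legs, again without
framing struts. So one convenient order is enough: with the legs of one component first, the diagram
is a generator times a diagram with fewer legs. -/
theorem mkList_mem_subA (n : ℕ) : ∀ (D : JacobiDiagram 2) (l : List D.H), D.NoStrut →
    D.IsListing l → l.length = n → mkList F D l ∈ subA F := by
  induction n using Nat.strong_induction_on with
  | _ n ih =>
    intro D l hD hl hn
    suffices h : ∃ l', D.IsListing l' ∧ mkList F D l' ∈ subA F by
      obtain ⟨l', hl', h⟩ := h
      have := IsListing.sub_mem (Subalgebra.toSubmodule (subA F)).toAddSubgroup (mkList F D)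
        (fun u x y v h => ?_) hl hl'
      · simpa using add_mem (S := Subalgebra F _) this h
      · rw [mkList_swap h]
        split_ifs
        · have h1 := length_mergeList h.legPair u v
          have h2 := (h.perm hl).length_eq
          exact ih (n - 1) (by omega) _ _ (hD.merge _) h.merge (by omega)
        · exact zero_mem _
    rcases isEmpty_or_nonempty D.H with h | ⟨⟨a⟩⟩
    · refine ⟨l, hl, ?_⟩
      rw [mkList_of hl]
      have : IsEmpty (D.toStrand l hl).H := h
      rw [AlgA_mk_of_isEmpty]
      exact one_mem _
    · obtain ⟨C, E, f, c, hC, hf, -⟩ := D.exists_iso_connected_union a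
      obtain ⟨u, hu⟩ := C.exists_isListing
      obtain ⟨v, hv⟩ := E.exists_isListing
      obtain ⟨h1, h2⟩ := noStrut_union.1 (hD.iso hf)
      refine ⟨_, (hu.union hv).map hf, ?_⟩
      rw [mkList_iso hf (hu.union hv), mkList_union hu hv]
      refine mul_mem ?_ (ih _ ?_ E v h2 hv rfl)
      · rw [mkList_of hu]
        exact Algebra.subset_adjoin ⟨_, hC, fun i ⟨g, hg⟩ => h1.not_iso_strut i ⟨g, hg.1⟩, rfl⟩
      · have h3 := (hl.perm ((hu.union hv).map hf)).length_eq
        rw [List.length_map, length_unionList] at h3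
        have := hC.length_pos hu
        omega

theorem AlgA.mk_mem_subA (T : StrandDiagram 2) (hT : T.NoStrut) : AlgA.mk F T ∈ subA F := by
  rw [← T.mkList_legList F]
  exact mkList_mem_subA _ _ _ hT T.isListing_legList rfl

theorem subA_eq_span : Subalgebra.toSubmodule (subA F) =
    Submodule.span F {x | ∃ T : StrandDiagram 2, T.NoStrut ∧ x = AlgA.mk F T} := by
  refine le_antisymm ?_ (Submodule.span_le.2 ?_)
  · rw [subA, Algebra.adjoin_eq_span]
    refine Submodule.span_mono fun x hx => ?_
    induction hx using Submonoid.closure_induction with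
    | mem x hx =>
      obtain ⟨D, hD, hs, rfl⟩ := hx
      exact ⟨D, StrandDiagram.noStrut_of_connected hD hs, rfl⟩
    | one => exact ⟨_, noStrut_empty 2, AlgA_mk_empty.symm⟩
    | mul x y _ _ hx hy =>
      obtain ⟨D, hD, rfl⟩ := hx
      obtain ⟨E, hE, rfl⟩ := hy
      exact ⟨_, noStrut_union.2 ⟨hD, hE⟩, AlgA_mk_mul D E⟩
  · rintro _ ⟨D, hD, rfl⟩
    exact AlgA.mk_mem_subA D hD

/-! ## Symmetrization and the deframing subalgebras -/

/-- Attaching the legs does not change the graph, so every term of the average is free of framing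
chords. -/
theorem chi_mk_mem_subA {D : JacobiDiagram 2} (hD : D.NoStrut) :
    chi F 2 (AlgB.mk F D) ∈ subA F := by
  have := Fintype.ofFinite D.Attachment
  rw [chi_mk, symmetrize, finsum_eq_sum_of_fintype]
  exact Subalgebra.smul_mem _ (sum_mem fun r _ => AlgA.mk_mem_subA (D.attach r) hD) _

variable [CharZero F]

/-- By induction on the legs, the values on any two listings are congruent modulo `subB`. Over all
attachments they add up to a multiple of the class of `D`, so dividing by the number of attachments
puts each of them in `subB`. -/
theorem sigma_mem_subB (n : ℕ) : ∀ (D : JacobiDiagram 2) (l : List D.H), D.NoStrut →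
    D.IsListing l → l.length = n → JacobiDiagram.sigma F n D l ∈ subB F := by
  induction n using Nat.strong_induction_on with
  | _ n ih =>
    intro D l hD hl hlen
    have hn := (sigmaProps 2 F n).normalized D l hl hlen
    have := Fintype.ofFinite D.Attachment
    have key : ∀ r : D.Attachment,
        JacobiDiagram.sigma F n D l - JacobiDiagram.sigma F n D (D.attach r).legList ∈ subB F := by
      intro r
      refine IsListing.sub_mem (Subalgebra.toSubmodule (subB F)).toAddSubgroup
        (JacobiDiagram.sigma F n D) (fun u x y v h => ?_) hl (D.attach r).isListing_legList
      rw [hn.step u x y v h]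
      split_ifs
      · have h1 := length_mergeList h.legPair u v
        have h2 := (h.perm hl).length_eq
        exact ih (n - 1) (by omega) _ _ (hD.merge _) h.merge (by omega)
      · exact zero_mem _
    have h1 := sum_mem (t := Finset.univ) fun r _ => key r
    have h2 := hn.sum
    rw [finsum_eq_sum_of_fintype] at h2
    rw [Finset.sum_sub_distrib, h2, Finset.sum_const] at h1
    have h3 := add_mem h1 (Subalgebra.smul_mem _ (AlgB.mk_mem_subB D hD) (Nat.card D.Attachment : F))
    rw [sub_add_cancel] at h3
    have h4 := Subalgebra.smul_mem _ h3 (Fintype.card D.Attachment : F)⁻¹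
    rwa [Finset.card_univ, ← Nat.cast_smul_eq_nsmul F, smul_smul, inv_mul_cancel₀ (by simp),
      one_smul] at h4

/-- One inclusion says that `χ` preserves the spans of the diagrams without framing struts, the
other that its inverse does. -/
theorem comap_chi_subA :
    (Subalgebra.toSubmodule (subA F)).comap (chi F 2) = Subalgebra.toSubmodule (subB F) := by
  refine le_antisymm (fun x hx => ?_) ?_
  · have h : Subalgebra.toSubmodule (subA F) ≤
        (Subalgebra.toSubmodule (subB F)).comap (sigmaHom F 2) := by
      rw [subA_eq_span, Submodule.span_le]
      rintro _ ⟨T, hT, rfl⟩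
      rw [SetLike.mem_coe, Submodule.mem_comap, sigmaHom_mk]
      exact sigma_mem_subB _ _ _ hT T.isListing_legList rfl
    have := h hx
    rwa [Submodule.mem_comap, sigmaHom_chi] at this
  · rw [subB_eq_span, Submodule.span_le]
    rintro _ ⟨D, hD, rfl⟩
    exact chi_mk_mem_subA hD

end

/-! ## Removing framing chords -/

namespace JacobiDiagram

variable {p : ℕ}

open Classical in
theorem flip_apply_of_isLeg {D : JacobiDiagram p} {h a : D.H} (hh : ¬ D.IsLeg h) (ha : D.IsLeg a) :
    D.flip h a = a :=
  Equiv.swap_apply_of_ne_of_ne (ne_of_not_isLeg (not_isLeg_next hh) ha).symm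
    (ne_of_not_isLeg (not_isLeg_next (not_isLeg_next hh)) ha).symm

open Classical in
theorem turn_apply_of_isLeg {D : JacobiDiagram p} {h a : D.H} (hh : D.IsInner h) (ha : D.IsLeg a) :
    D.turn h a = a := by
  have h1 := (ne_of_not_isLeg (not_isLeg_next hh.1) ha).symm
  have h2 := (ne_of_not_isLeg (not_isLeg_next (not_isLeg_next hh.1)) ha).symm
  have h3 := (ne_of_not_isLeg (not_isLeg_next hh.2.1) ha).symm
  rw [turn, Equiv.Perm.mul_apply, Equiv.swap_apply_of_ne_of_ne h2 h3,
    Equiv.swap_apply_of_ne_of_ne h1 h2]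

theorem IsRegluing.edge_of_isStrut {D E : JacobiDiagram p} {π : Equiv.Perm D.H} {f : D.H ≃ E.H}
    (hf : D.IsRegluing E π f) (hπ : ∀ a, D.IsLeg a → π a = a) {i : Fin p} {s : D.H}
    (hs : D.IsStrut i s) : E.edge (f s) = f (D.edge s) := by
  have := hf.edge s
  rwa [hπ s hs.left, hπ _ hs.right] at this

/-- The permutations of AS and IHX fix all legs (`flip_apply_of_isLeg`, `turn_apply_of_isLeg`), so
these relations carry framing chords to framing chords. -/
theorem IsRegluing.isStrut_iff_of_fix {D E : JacobiDiagram p} {π : Equiv.Perm D.H} {f : D.H ≃ E.H}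
    (hf : D.IsRegluing E π f) (hπ : ∀ a, D.IsLeg a → π a = a) {i : Fin p} {s : D.H} :
    E.IsStrut i (f s) ↔ D.IsStrut i s := by
  constructor
  · rintro ⟨h1, h2, h3, h4⟩
    rw [hf.isLeg_iff] at h1
    have he := hf.edge s
    rw [hπ s h1] at he
    rw [he] at h2 h4
    rw [hf.isLeg_iff] at h2
    -- Here `π (D.edge s)` is a leg, hence fixed by `π`, hence equal to `D.edge s`.
    have h5 := π.injective (hπ _ h2)
    rw [h5] at h2 h4
    rw [hf.color _ h1] at h3
    rw [hf.color _ h2] at h4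
    exact ⟨h1, h2, h3, h4⟩
  · intro hs
    have he := hf.edge_of_isStrut hπ hs
    obtain ⟨h1, h2, h3, h4⟩ := hs
    rw [← hf.color _ h1] at h3
    rw [← hf.color _ h2] at h4
    rw [← hf.isLeg_iff] at h1 h2
    rw [← he] at h2 h4
    exact ⟨h1, h2, h3, h4⟩

open Classical in
theorem Saturated.flip_iff {D : JacobiDiagram p} {P : D.H → Prop} (hP : D.Saturated P) {h : D.H}
    (hh : P h) (a : D.H) : P (D.flip h a) ↔ P a := by
  have h1 := (hP.next h).2 hh
  have h2 := (hP.next _).2 h1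
  rw [flip, Equiv.swap_apply_def]
  split_ifs with h3 h4
  · subst h3; exact iff_of_true h2 h1
  · subst h4; exact iff_of_true h1 h2
  · exact Iff.rfl

open Classical in
theorem Saturated.turn_iff {D : JacobiDiagram p} {P : D.H → Prop} (hP : D.Saturated P) {h : D.H}
    (hh : P h) (a : D.H) : P (D.turn h a) ↔ P a := by
  have h1 := (hP.next h).2 hh
  have h2 := (hP.next _).2 h1
  have h3 := (hP.next _).2 ((hP.edge h).2 hh)
  have key : ∀ u v : D.H, P u → P v → ∀ a, P (Equiv.swap u v a) ↔ P a := by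
    intro u v hu hv a
    rw [Equiv.swap_apply_def]
    split_ifs with h3 h4
    · subst h3; exact iff_of_true hv hu
    · subst h4; exact iff_of_true hu hv
    · exact Iff.rfl
  exact (key _ _ h1 h2 _).trans (key _ _ h2 h3 a)

theorem swap_subtypePerm {α : Type*} {P : α → Prop} {u v : α} (hu : P u) (hv : P v)
    {_ : DecidableEq α} {inst : DecidableEq {a // P a}} (a : {a // P a}) :
    (Equiv.swap (⟨u, hu⟩ : {a // P a}) ⟨v, hv⟩ a).1 = Equiv.swap u v a.1 := by
  rw [Equiv.swap_apply_def, Equiv.swap_apply_def]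
  simp only [Subtype.ext_iff]
  split_ifs <;> rfl

theorem flip_restrict {D : JacobiDiagram p} {P : D.H → Prop} (hP : D.Saturated P) {h : D.H}
    (hh : P h) : (D.restrict P hP).flip ⟨h, hh⟩ = (D.flip h).subtypePerm (hP.flip_iff hh) := by
  refine Equiv.ext fun a => Subtype.ext ?_
  exact swap_subtypePerm ((hP.next h).2 hh) ((hP.next _).2 ((hP.next h).2 hh)) a

open Classical in
theorem turn_restrict {D : JacobiDiagram p} {P : D.H → Prop} (hP : D.Saturated P) {h : D.H}
    (hh : P h) : (D.restrict P hP).turn ⟨h, hh⟩ = (D.turn h).subtypePerm (hP.turn_iff hh) := by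
  refine Equiv.ext fun a => Subtype.ext ?_
  have h1 := (hP.next h).2 hh
  have h2 := (hP.next _).2 h1
  have h3 := (hP.next _).2 ((hP.edge h).2 hh)
  exact (swap_subtypePerm (inst := fun _ _ => Classical.propDecidable _) h1 h2 _).trans (congrArg (Equiv.swap _ _)
    (swap_subtypePerm (inst := fun _ _ => Classical.propDecidable _) h2 h3 a))

theorem IsInner.restrict {D : JacobiDiagram p} {P : D.H → Prop} (hP : D.Saturated P) {h : D.H}
    (hh : P h) (hi : D.IsInner h) : (D.restrict P hP).IsInner ⟨h, hh⟩ :=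
  ⟨fun e => hi.1 (congrArg Subtype.val e), fun e => hi.2.1 (congrArg Subtype.val e),
    fun e => hi.2.2.1 (congrArg Subtype.val e), fun e => hi.2.2.2 (congrArg Subtype.val e)⟩

end JacobiDiagram

namespace StrandDiagram

variable {p : ℕ}

/-- The part of a generalized chord diagram that consists of some of the connected components. -/
def restrict (T : StrandDiagram p) (P : T.H → Prop) (hP : T.Saturated P) : StrandDiagram p where
  toJacobiDiagram := T.toJacobiDiagram.restrict P hP
  lt a b := T.lt a.1 b.1
  attached :=
    { legs := fun a b h => by
        obtain ⟨h1, h2, h3⟩ := T.attached.legs _ _ h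
        exact ⟨Subtype.ext h1, Subtype.ext h2, h3⟩
      irrefl := fun a => T.attached.irrefl _
      trans := fun a b c => T.attached.trans _ _ _
      total := fun a b ha hb hc hab => T.attached.total _ _ (congrArg Subtype.val ha)
        (congrArg Subtype.val hb) hc fun e => hab (Subtype.ext e) }

theorem IsRegluing.restrict {T U : StrandDiagram p} {π : Equiv.Perm T.H} {f : T.H ≃ U.H}
    (hf : T.IsRegluing U π f) {P : T.H → Prop} {Q : U.H → Prop} (hP : T.Saturated P)
    (hQ : U.Saturated Q) (hPQ : ∀ a, P a ↔ Q (f a)) (hπ : ∀ a, P (π a) ↔ P a) :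
    (T.restrict P hP).IsRegluing (U.restrict Q hQ) (π.subtypePerm hπ) (f.subtypeEquiv hPQ) :=
  ⟨⟨fun h => Subtype.ext (hf.1.next h.1), fun h => Subtype.ext (hf.1.edge h.1),
    fun h hh => hf.1.color h.1 (congrArg Subtype.val hh)⟩, fun a b => hf.2 a.1 b.1⟩

/-- The diagram without the framing chord that contains `h`. -/
def remove (T : StrandDiagram p) {i : Fin p} {h : T.H} (hh : T.IsStrut i h) : StrandDiagram p :=
  T.restrict _ hh.saturated.compl

section

variable (F : Type*) [Field F]

open Classical in
/-- The class of the diagram without the framing chord that contains `h`. -/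
noncomputable def mkRemove (T : StrandDiagram p) (i : Fin p) (h : T.H) : AlgA F p :=
  if hh : T.IsStrut i h then AlgA.mk F (T.remove hh) else 0

variable {F}

theorem mkRemove_of {T : StrandDiagram p} {i : Fin p} {h : T.H} (hh : T.IsStrut i h) :
    T.mkRemove F i h = AlgA.mk F (T.remove hh) := dif_pos hh

theorem mkRemove_eq_zero {T : StrandDiagram p} {i : Fin p} {h : T.H} (hh : ¬ T.IsStrut i h) :
    T.mkRemove F i h = 0 := dif_neg hh

theorem IsRegluing.notMem_iff {T U : StrandDiagram p} {π : Equiv.Perm T.H} {f : T.H ≃ U.H}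
    (hf : T.IsRegluing U π f) (hπ : ∀ a, T.IsLeg a → π a = a) {i : Fin p} {s : T.H}
    (hs : T.IsStrut i s) (a : T.H) :
    ¬ (a = s ∨ a = T.edge s) ↔ ¬ (f a = f s ∨ f a = U.edge (f s)) := by
  rw [hf.1.edge_of_isStrut hπ hs, f.injective.eq_iff, f.injective.eq_iff]

theorem perm_notMem_iff {α : Type*} {π : Equiv.Perm α} {s t : α} (hs : π s = s) (ht : π t = t)
    (a : α) : ¬ (π a = s ∨ π a = t) ↔ ¬ (a = s ∨ a = t) := by
  have h1 : π a = s ↔ a = s := by rw [← π.injective.eq_iff (a := a), hs]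
  have h2 : π a = t ↔ a = t := by rw [← π.injective.eq_iff (a := a), ht]
  rw [h1, h2]

theorem IsRegluing.remove {T U : StrandDiagram p} {π : Equiv.Perm T.H} {f : T.H ≃ U.H}
    (hf : T.IsRegluing U π f) (hπ : ∀ a, T.IsLeg a → π a = a) {i : Fin p} {s : T.H}
    (hs : T.IsStrut i s) (hs' : U.IsStrut i (f s)) :
    (T.remove hs).IsRegluing (U.remove hs') (π.subtypePerm (perm_notMem_iff (hπ s hs.left) (hπ _ hs.right)))
      (f.subtypeEquiv (hf.notMem_iff hπ hs)) :=
  hf.restrict hs.saturated.compl hs'.saturated.compl _ _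

theorem mkRemove_iso {T U : StrandDiagram p} {f : T.H ≃ U.H} (hf : T.IsRegluing U 1 f)
    (i : Fin p) (s : T.H) : U.mkRemove F i (f s) = T.mkRemove F i s := by
  by_cases hs : T.IsStrut i s
  · have hs' := hf.1.isStrut_iff.2 hs
    rw [mkRemove_of hs, mkRemove_of hs']
    have := hf.remove (fun _ _ => rfl) hs hs'
    exact (AlgA_mk_eq_of_iso ⟨_, this⟩).symm
  · rw [mkRemove_eq_zero hs, mkRemove_eq_zero (hf.1.isStrut_iff.not.2 hs)]

theorem IsStrut.ne_of_not_isLeg {D : JacobiDiagram p} {i : Fin p} {s h : D.H}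
    (hs : D.IsStrut i s) (hh : ¬ D.IsLeg h) : ¬ (h = s ∨ h = D.edge s) := by
  rintro (rfl | rfl)
  · exact hh hs.left
  · exact hh hs.right

/-- A chord is disjoint from the trivalent vertex where the relation takes place, so removing it
leaves an AS pair. The same reason works for IHX below. -/
theorem mkRemove_as {D E : StrandDiagram p} {h : D.H} {f : D.H ≃ E.H} (hh : ¬ D.IsLeg h)
    (hf : D.IsRegluing E (D.flip h) f) (i : Fin p) (s : D.H) :
    D.mkRemove F i s + E.mkRemove F i (f s) = 0 := by
  have hπ : ∀ a, D.IsLeg a → D.flip h a = a := fun a => flip_apply_of_isLeg hh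
  by_cases hs : D.IsStrut i s
  · have hs' := (hf.1.isStrut_iff_of_fix hπ).2 hs
    rw [mkRemove_of hs, mkRemove_of hs', AlgA.mk, AlgA.mk, ← map_add]
    have := hf.remove hπ hs hs'
    have h1 := IsStrut.ne_of_not_isLeg hs hh
    have h2 := flip_restrict hs.saturated.compl h1
    refine AlgA.mk_eq_zero (.as _ _ (⟨h, h1⟩ : {h // ¬ (h = s ∨ h = D.edge s)})
      (f.subtypeEquiv (hf.notMem_iff hπ hs)) (fun e => hh (congrArg Subtype.val e)) ?_)
    exact h2 ▸ this
  · rw [mkRemove_eq_zero hs, mkRemove_eq_zero ((hf.1.isStrut_iff_of_fix hπ).not.2 hs), add_zero]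

theorem mkRemove_ihx {D E G : StrandDiagram p} {h : D.H} {f : D.H ≃ E.H} {g : D.H ≃ G.H}
    (hh : D.IsInner h) (hf : D.IsRegluing E (D.turn h) f) (hg : D.IsRegluing G (D.turn h)⁻¹ g)
    (i : Fin p) (s : D.H) :
    D.mkRemove F i s + E.mkRemove F i (f s) + G.mkRemove F i (g s) = 0 := by
  have hπ : ∀ a, D.IsLeg a → D.turn h a = a := fun a => turn_apply_of_isLeg hh
  have hπ' : ∀ a, D.IsLeg a → (D.turn h)⁻¹ a = a := fun a ha =>
    Equiv.Perm.inv_eq_iff_eq.2 (hπ a ha).symm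
  by_cases hs : D.IsStrut i s
  · have hs1 := (hf.1.isStrut_iff_of_fix hπ).2 hs
    have hs2 := (hg.1.isStrut_iff_of_fix hπ').2 hs
    rw [mkRemove_of hs, mkRemove_of hs1, mkRemove_of hs2, AlgA.mk, AlgA.mk, AlgA.mk, ← map_add,
      ← map_add]
    have h3 := hf.remove hπ hs hs1
    have h4 := hg.remove hπ' hs hs2
    have h1 := IsStrut.ne_of_not_isLeg hs hh.1
    have h2 := turn_restrict hs.saturated.compl h1
    have h5 := congrArg (·⁻¹) h2
    refine AlgA.mk_eq_zero (.ihx _ _ _ (⟨h, h1⟩ : {h // ¬ (h = s ∨ h = D.edge s)})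
      (f.subtypeEquiv (hf.notMem_iff hπ hs)) (g.subtypeEquiv (hg.notMem_iff hπ' hs))
      (hh.restrict hs.saturated.compl h1) ?_ ?_)
    · exact h2 ▸ h3
    · exact h5 ▸ h4
  · rw [mkRemove_eq_zero hs, mkRemove_eq_zero ((hf.1.isStrut_iff_of_fix hπ).not.2 hs),
      mkRemove_eq_zero ((hg.1.isStrut_iff_of_fix hπ').not.2 hs), add_zero, add_zero]

end

end StrandDiagram

theorem finsum_sum_type {α β M : Type*} [Finite α] [Finite β] [AddCommMonoid M] (f : α ⊕ β → M) :
    ∑ᶠ c, f c = ∑ᶠ a, f (.inl a) + ∑ᶠ b, f (.inr b) := by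
  have := Fintype.ofFinite α
  have := Fintype.ofFinite β
  rw [finsum_eq_sum_of_fintype, finsum_eq_sum_of_fintype, finsum_eq_sum_of_fintype,
    Fintype.sum_sum_type]

/-- An equivalence with a disjoint union, restricted to a subset that contains the second part. -/
noncomputable def sumSubtypeEquiv {α β γ : Type*} (g : α ⊕ β ≃ γ) {P : α → Prop} {Q : γ → Prop}
    (hl : ∀ a, P a ↔ Q (g (.inl a))) (hr : ∀ b, Q (g (.inr b))) : {a // P a} ⊕ β ≃ {c // Q c} :=
  Equiv.ofBijective (Sum.elim (fun a => ⟨g (.inl a.1), (hl a.1).1 a.2⟩) fun b => ⟨g (.inr b), hr b⟩) <| by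
    constructor
    · rintro (⟨a, ha⟩ | a) (⟨b, hb⟩ | b) h
      · cases g.injective (congrArg Subtype.val h); rfl
      · cases g.injective (congrArg Subtype.val h)
      · cases g.injective (congrArg Subtype.val h)
      · cases g.injective (congrArg Subtype.val h); rfl
    · rintro ⟨c, hc⟩
      obtain ⟨a | b, rfl⟩ := g.surjective c
      · exact ⟨.inl ⟨a, (hl a).2 hc⟩, rfl⟩
      · exact ⟨.inr b, rfl⟩

/-! ### Chord removal and STU -/

namespace StrandDiagram

variable {p : ℕ}

theorem Adjacent.lt_iff {T : StrandDiagram p} {x y a : T.H} (h : T.Adjacent x y) (hx : a ≠ x)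
    (hy : a ≠ y) : (T.lt a x ↔ T.lt a y) ∧ (T.lt x a ↔ T.lt y a) := by
  obtain ⟨h1, h2, h3⟩ := T.attached.legs _ _ h.1
  refine ⟨⟨fun h4 => T.attached.trans _ _ _ h4 h.1, fun h4 => ?_⟩,
    ⟨fun h4 => ?_, fun h4 => T.attached.trans _ _ _ h.1 h4⟩⟩
  · obtain ⟨h5, -, h6⟩ := T.attached.legs _ _ h4
    exact (T.attached.total a x h5 h1 (h6.trans h3.symm) hx).resolve_right fun h7 => h.2 ⟨a, h7, h4⟩
  · obtain ⟨-, h5, h6⟩ := T.attached.legs _ _ h4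
    exact (T.attached.total y a h2 h5 (h3.symm.trans h6) hy.symm).resolve_right
      fun h7 => h.2 ⟨a, h4, h7⟩

section

variable {F : Type*} [Field F]

open Classical in
theorem subtypePerm_eq_swap {α : Type*} {π : Equiv.Perm α} {x y : α} (h1 : π x = y) (h2 : π y = x)
    (h3 : ∀ a, a ≠ x → a ≠ y → π a = a) {P : α → Prop} (hx : P x) (hy : P y)
    (hπ : ∀ a, P (π a) ↔ P a) {inst : DecidableEq {a // P a}} :
    π.subtypePerm hπ = Equiv.swap ⟨x, hx⟩ ⟨y, hy⟩ := by
  refine Equiv.ext fun a => Subtype.ext ?_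
  rw [swap_subtypePerm hx hy]
  obtain ⟨a, ha⟩ := a
  change π a = Equiv.swap x y a
  by_cases hax : a = x
  · rw [hax, h1, Equiv.swap_apply_left]
  by_cases hay : a = y
  · rw [hay, h2, Equiv.swap_apply_right]
  rw [h3 _ hax hay, Equiv.swap_apply_of_ne_of_ne hax hay]

/-- A chord that avoids `x` and `y` can be removed from all three diagrams, and an STU triple
remains. A chord that ends at `x` or `y` is absorbed by the merging, so `S` contributes zero. Its
removal makes `T` and `U` isomorphic, because the neighbours `x` and `y` have the same position
relative to all the other legs. -/
theorem mkRemove_stu {S T U : StrandDiagram p} {x y : T.H} {f : T.H ≃ U.H} {g : T.H ⊕ Bool ≃ S.H}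
    {π : Equiv.Perm T.H} (h : T.Adjacent x y) (hx : π x = y) (hy : π y = x)
    (hπ : ∀ a, a ≠ x → a ≠ y → π a = a) (hf : T.IsRegluing U π f) (hg : T.IsMerging x y S g)
    (i : Fin p) (s : T.H) :
    S.mkRemove F i (g (.inl s)) = T.mkRemove F i s - U.mkRemove F i (f (π s)) := by
  obtain ⟨hxl, hyl, hc⟩ := T.attached.legs _ _ h.1
  have hxy : T.LegPair x y := ⟨hxl, hyl, fun e => T.attached.irrefl x (by
    have := h.1
    rwa [← e] at this)⟩
  have hU := hf.1.exchange hxy hc hx hy hπ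
  have hS := hg.isRegluing hxy
  have hiS : S.IsStrut i (g (.inl s)) ↔ _ := hS.isStrut_iff.trans (isStrut_merge_old hxy)
  have hiU : U.IsStrut i (f (π s)) ↔ _ := hU.isStrut_iff
  by_cases hs : T.IsStrut i s
  · have hsU := hiU.2 hs
    have heU : U.edge (f (π s)) = f (π (T.edge s)) := hU.edge s
    by_cases hgood : s ≠ x ∧ s ≠ y ∧ T.edge s ≠ x ∧ T.edge s ≠ y
    · have hsS := hiS.2 ⟨hs, hgood⟩
      obtain ⟨g1, g2, g3, g4⟩ := hgood
      have hx' : ¬ (x = s ∨ x = T.edge s) := not_or.2 ⟨g1.symm, g3.symm⟩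
      have hy' : ¬ (y = s ∨ y = T.edge s) := not_or.2 ⟨g2.symm, g4.symm⟩
      have e1 := hπ s g1 g2
      have e2 := hπ _ g3 g4
      have hl : ∀ a, ¬ (a = s ∨ a = T.edge s) ↔
          ¬ (g (.inl a) = g (.inl s) ∨ g (.inl a) = S.edge (g (.inl s))) := fun a => by
        rw [hg.edge, g.injective.eq_iff, g.injective.eq_iff, Sum.inl_injective.eq_iff,
          Sum.inl_injective.eq_iff]
      have hr : ∀ b, ¬ (g (.inr b) = g (.inl s) ∨ g (.inr b) = S.edge (g (.inl s))) := fun b => by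
        rw [hg.edge, g.injective.eq_iff, g.injective.eq_iff]
        simp
      have hPQ : ∀ a, ¬ (a = s ∨ a = T.edge s) ↔
          ¬ (f a = f (π s) ∨ f a = U.edge (f (π s))) := fun a => by
        rw [heU, e1, e2, f.injective.eq_iff, f.injective.eq_iff]
      rw [mkRemove_of hs, mkRemove_of hsS, mkRemove_of hsU, AlgA.mk, AlgA.mk, AlgA.mk, ← map_sub,
        ← sub_eq_zero, ← map_sub]
      refine AlgA.mk_eq_zero (.stu (S.remove hsS) (T.remove hs) (U.remove hsU)
        (⟨x, hx'⟩ : {a // ¬ (a = s ∨ a = T.edge s)}) (⟨y, hy'⟩ : {a // ¬ (a = s ∨ a = T.edge s)})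
        (f.subtypeEquiv hPQ) (sumSubtypeEquiv g hl hr) ⟨h.1, ?_⟩ ?_ ?_)
      · rintro ⟨z, h1, h2⟩
        exact h.2 ⟨z.1, h1, h2⟩
      · have := hf.restrict hs.saturated.compl hsU.saturated.compl hPQ (perm_notMem_iff e1 e2)
        have e := subtypePerm_eq_swap (P := fun a => ¬ (a = s ∨ a = T.edge s)) hx hy hπ hx' hy'
          (perm_notMem_iff e1 e2)
          (inst := fun _ _ => Classical.propDecidable _)
        exact e ▸ this
      · have hne : ∀ {a : {a // ¬ (a = s ∨ a = T.edge s)}} {z : T.H}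
            {hz : ¬ (z = s ∨ z = T.edge s)}, a ≠ ⟨z, hz⟩ → a.1 ≠ z :=
          fun h e => h (Subtype.ext e)
        exact
        { edge := fun a => Subtype.ext (hg.edge a.1)
          edge_stem := Subtype.ext hg.edge_stem
          next := fun a h1 h2 => Subtype.ext (hg.next a.1 (hne h1) (hne h2))
          next_stem := Subtype.ext hg.next_stem
          next_y := Subtype.ext hg.next_y
          next_x := Subtype.ext hg.next_x
          next_foot := Subtype.ext hg.next_foot
          color := fun a h0 h1 h2 => hg.color a.1 (congrArg Subtype.val h0) (hne h1) (hne h2)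
          color_foot := hg.color_foot
          lt := fun a b h1 h2 h3 h4 => hg.lt a.1 b.1 (hne h1) (hne h2) (hne h3) (hne h4)
          lt_foot := fun a h1 h2 => hg.lt_foot a.1 (hne h1) (hne h2)
          foot_lt := fun a h1 h2 => hg.foot_lt a.1 (hne h1) (hne h2) }
    · rw [mkRemove_eq_zero fun h1 => hgood (hiS.1 h1).2, mkRemove_of hs, mkRemove_of hsU, eq_comm,
        sub_eq_zero]
      have hPQ : ∀ a, ¬ (a = s ∨ a = T.edge s) ↔
          ¬ ((π.trans f) a = f (π s) ∨ (π.trans f) a = U.edge (f (π s))) := fun a => by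
        rw [heU, Equiv.trans_apply, f.injective.eq_iff, f.injective.eq_iff, π.injective.eq_iff,
          π.injective.eq_iff]
      refine AlgA_mk_eq_of_iso ⟨(π.trans f).subtypeEquiv hPQ, ⟨fun a => Subtype.ext (hU.next a.1),
        fun a => Subtype.ext (hU.edge a.1), fun a ha => hU.color a.1 (congrArg Subtype.val ha)⟩, ?_⟩
      rintro ⟨a, ha⟩ ⟨b, hb⟩
      refine (hf.2 (π a) (π b)).trans ?_
      change _ ↔ T.lt a b
      have irr := T.attached.irrefl
      -- At most one of `x` and `y` survives the removal, so their mutual order is never tested.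
      have hbad : ¬ ((a = x ∧ b = y) ∨ (a = y ∧ b = x)) := by
        rintro (⟨rfl, rfl⟩ | ⟨rfl, rfl⟩) <;> grind
      by_cases ax : a = x
      · subst ax
        by_cases bx : b = a
        · subst bx
          exact iff_of_false (irr _) (irr _)
        · have bY : b ≠ y := fun e => hbad (Or.inl ⟨rfl, e⟩)
          rw [hx, hπ b bx bY]
          exact (h.lt_iff bx bY).2.symm
      by_cases ay : a = y
      · subst ay
        by_cases bY : b = a
        · subst bY
          exact iff_of_false (irr _) (irr _)
        · have bx : b ≠ x := fun e => hbad (Or.inr ⟨rfl, e⟩)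
          rw [hy, hπ b bx bY]
          exact (h.lt_iff bx bY).2
      rw [hπ a ax ay]
      by_cases bx : b = x
      · rw [bx, hx]
        exact (h.lt_iff ax ay).1.symm
      by_cases bY : b = y
      · rw [bY, hy]
        exact (h.lt_iff ax ay).1
      rw [hπ b bx bY]
  · rw [mkRemove_eq_zero hs, mkRemove_eq_zero (hiU.not.2 hs),
      mkRemove_eq_zero fun h1 => hs (hiS.1 h1).1, sub_zero]

variable (F) in
-- The sum runs over half-edges, so bijections of half-edges match the terms of a relation one by
-- one. Every framing chord is seen from both of its ends, which causes the factor `2` in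
-- `chordDerivation_chord_mul`.
theorem exists_chordDerivation (i : Fin p) : ∃ Φ : AlgA F p →ₗ[F] AlgA F p, ∀ T : StrandDiagram p,
    Φ (AlgA.mk F T) = ∑ᶠ h : T.H, T.mkRemove F i h := by
  have hfin := fun T : StrandDiagram p => T.finite
  refine AlgA.exists_lift _ ?_ ?_ ?_ ?_
  · rintro D E ⟨f, hf⟩
    rw [← finsum_comp_equiv f]
    exact finsum_congr fun s => (mkRemove_iso hf i s).symm
  · intro D E h f hh hf
    rw [← finsum_comp_equiv f, ← finsum_add_distrib (Set.toFinite _) (Set.toFinite _)]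
    exact finsum_eq_zero_of_forall_eq_zero fun s => mkRemove_as hh hf i s
  · intro D E G h f g hh hf hg
    rw [← finsum_comp_equiv f, ← finsum_comp_equiv g,
      ← finsum_add_distrib (Set.toFinite _) (Set.toFinite _),
      ← finsum_add_distrib (Set.toFinite _) (Set.toFinite _)]
    exact finsum_eq_zero_of_forall_eq_zero fun s => mkRemove_ihx hh hf hg i s
  · intro S T U x y f g π h hx hy hπ hf hg
    obtain ⟨hxl, hyl, hc⟩ := T.attached.legs _ _ h.1
    have hxy : T.LegPair x y := ⟨hxl, hyl, fun e => T.attached.irrefl x (by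
      have := h.1
      rwa [← e] at this)⟩
    have hS := hg.isRegluing hxy
    -- The two half-edges added by the merging belong to an edge with a trivalent end, hence to no
    -- strut.
    have h0 : ∀ b, S.mkRemove F i (g (.inr b)) = 0 := by
      rintro (_ | _)
      · exact mkRemove_eq_zero fun h => not_isStrut_stem hxy (hS.isStrut_iff.1 h)
      · exact mkRemove_eq_zero fun h => not_isStrut_foot hxy (hS.isStrut_iff.1 h)
    rw [← finsum_comp_equiv g, finsum_sum_type, finsum_eq_zero_of_forall_eq_zero h0, add_zero,
      ← finsum_comp_equiv (π.trans f), ← finsum_sub_distrib (Set.toFinite _) (Set.toFinite _)]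
    exact finsum_congr fun s => mkRemove_stu h hx hy hπ hf hg i s

end

end StrandDiagram

/-! ### The operator that removes framing chords -/

section

variable (F : Type*) [Field F] {p : ℕ}

/-- The linear map that sends a diagram to the sum of the diagrams obtained by removing a
framing chord on strand `i`, each counted twice. -/
noncomputable def chordDerivation (i : Fin p) : AlgA F p →ₗ[F] AlgA F p :=
  (StrandDiagram.exists_chordDerivation F i).choose

theorem chordDerivation_mk (i : Fin p) (T : StrandDiagram p) :
    chordDerivation F i (AlgA.mk F T) = ∑ᶠ h : T.H, T.mkRemove F i h :=
  (StrandDiagram.exists_chordDerivation F i).choose_spec T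

variable {F}

theorem StrandDiagram.mkRemove_stack_inr (S T : StrandDiagram p) (i : Fin p) (s : T.H) :
    (S.stack T).mkRemove F i (.inr s) = AlgA.mk F S * T.mkRemove F i s := by
  have hiff : (S.stack T).IsStrut i (.inr s) ↔ T.IsStrut i s := isStrut_union_inr
  by_cases hs : T.IsStrut i s
  · have hs' := hiff.2 hs
    rw [mkRemove_of hs, mkRemove_of hs', AlgA_mk_mul]
    have hl : ∀ a : T.H, ¬ (a = s ∨ a = T.edge s) ↔
        ¬ ((Sum.inr a : S.H ⊕ T.H) = .inr s ∨ (Sum.inr a : S.H ⊕ T.H) = .inr (T.edge s)) :=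
      fun a => by simp
    have hr : ∀ b : S.H,
        ¬ ((Sum.inl b : S.H ⊕ T.H) = .inr s ∨ (Sum.inl b : S.H ⊕ T.H) = .inr (T.edge s)) :=
      fun b => by simp
    let e : (S.stack (T.remove hs)).H ≃ ((S.stack T).remove hs').H :=
      (Equiv.sumComm _ _).trans (sumSubtypeEquiv (Equiv.sumComm T.H S.H) hl hr)
    refine (AlgA_mk_eq_of_iso ⟨e, ⟨?_, ?_, ?_⟩, ?_⟩).symm
    · rintro (a | a) <;> rfl
    · rintro (a | a) <;> rfl
    · rintro (a | a) _ <;> rfl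
    · rintro (a | a) (b | b)
      · exact Iff.rfl
      · exact and_congr_right fun _ => and_congr_left fun _ =>
          (isLeg_restrict hs.saturated.compl b).symm
      · exact Iff.rfl
      · exact Iff.rfl
  · rw [mkRemove_eq_zero hs, mkRemove_eq_zero (hiff.not.2 hs), mul_zero]

theorem StrandDiagram.mkRemove_chord_stack (T : StrandDiagram p) (i : Fin p) (b : Bool) :
    ((chord i).stack T).mkRemove F i (.inl b) = AlgA.mk F T := by
  have hs : ((chord i).stack T).IsStrut i (.inl b) :=
    isStrut_union_inl.2 (isStrut_strut i b)
  rw [mkRemove_of hs]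
  have hne : ∀ a : T.H, ¬ ((Sum.inr a : Bool ⊕ T.H) = .inl b ∨ (Sum.inr a : Bool ⊕ T.H) = .inl (!b)) :=
    fun a => by simp
  have hbij : Function.Bijective fun a : T.H => (⟨.inr a, hne a⟩ : ((chord i).stack T |>.remove hs).H) := by
    constructor
    · intro a b h
      exact Sum.inr_injective (congrArg Subtype.val h)
    · rintro ⟨c | a, hc⟩
      · refine (hc ?_).elim
        rcases Bool.eq_or_eq_not c b with rfl | rfl
        · exact Or.inl rfl
        · exact Or.inr rfl
      · exact ⟨a, rfl⟩
  let e : T.H ≃ (((chord i).stack T).remove hs).H := Equiv.ofBijective _ hbij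
  have he : T.IsRegluing (((chord i).stack T).remove hs) 1 e :=
    ⟨⟨fun _ => rfl, fun _ => rfl, fun _ _ => rfl⟩, fun _ _ => Iff.rfl⟩
  exact (AlgA_mk_eq_of_iso ⟨e, he⟩).symm

/-- A framing chord of the product is either the first factor, found once from each of its ends if
`i = j`, or a chord of the second factor. -/
theorem chordDerivation_chord_mul (i j : Fin p) (x : AlgA F p) :
    chordDerivation F i (AlgA.mk F (StrandDiagram.chord j) * x) =
      (if i = j then 2 • x else 0) + AlgA.mk F (StrandDiagram.chord j) * chordDerivation F i x := by
  induction AlgA.mem_span_mk x using Submodule.span_induction with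
  | mem x hx =>
    obtain ⟨T, rfl⟩ := hx
    have := T.finite
    rw [AlgA_mk_mul, chordDerivation_mk, chordDerivation_mk]
    refine (finsum_sum_type (α := Bool) (β := T.H)
      (((StrandDiagram.chord j).stack T).mkRemove F i)).trans (congrArg₂ _ ?_ ?_)
    · rw [finsum_eq_sum_of_fintype, Fintype.sum_bool]
      split_ifs with h
      · subst h
        exact (congrArg₂ _ (T.mkRemove_chord_stack i true) (T.mkRemove_chord_stack i false)).trans
          (two_smul _ _).symm
      · have h0 : ∀ b : Bool, ((StrandDiagram.chord j).stack T).mkRemove F i (.inl b) = 0 :=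
          fun b => StrandDiagram.mkRemove_eq_zero fun hs => h hs.color_left.symm
        exact (congrArg₂ _ (h0 true) (h0 false)).trans (add_zero 0)
    · have := Fintype.ofFinite T.H
      rw [finsum_eq_sum_of_fintype, finsum_eq_sum_of_fintype, Finset.mul_sum]
      exact Finset.sum_congr rfl fun s _ => StrandDiagram.mkRemove_stack_inr _ _ _ _
  | zero => simp
  | add x y _ _ hx hy =>
    rw [mul_add, map_add, map_add, hx, hy, mul_add]
    split_ifs
    · rw [smul_add]; abel
    · abel
  | smul r x _ hx =>
    rw [mul_smul_comm, map_smul, map_smul, hx, mul_smul_comm, smul_add]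
    split_ifs
    · rw [smul_comm]
    · rw [smul_zero]

theorem chordDerivation_eq_zero (i : Fin 2) {x : AlgA F 2} (hx : x ∈ subA F) :
    chordDerivation F i x = 0 := by
  have h : Subalgebra.toSubmodule (subA F) ≤ (chordDerivation F i).ker := by
    rw [subA_eq_span, Submodule.span_le]
    rintro _ ⟨T, hT, rfl⟩
    rw [SetLike.mem_coe, LinearMap.mem_ker, chordDerivation_mk]
    exact finsum_eq_zero_of_forall_eq_zero fun s => StrandDiagram.mkRemove_eq_zero (hT i s)
  exact h hx

/-- Each removal lowers the number of half-edges, so the process stops. -/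
theorem chordDerivation_pow_mk (i : Fin p) (n : ℕ) : ∀ T : StrandDiagram p, Nat.card T.H ≤ n →
    (chordDerivation F i ^ (n + 1)) (AlgA.mk F T) = 0 := by
  induction n with
  | zero =>
    intro T hT
    have := T.finite
    have : IsEmpty T.H := (Nat.card_eq_zero.1 (Nat.le_zero.1 hT)).resolve_right
      (not_infinite_iff_finite.2 this)
    rw [zero_add, pow_one, chordDerivation_mk, finsum_of_isEmpty]
  | succ n ih =>
    intro T hT
    have := T.finite
    have := Fintype.ofFinite T.H
    rw [pow_succ, Module.End.mul_apply, chordDerivation_mk, finsum_eq_sum_of_fintype, map_sum]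
    refine Finset.sum_eq_zero fun s _ => ?_
    by_cases hs : T.IsStrut i s
    · rw [StrandDiagram.mkRemove_of hs]
      refine ih _ ?_
      have : Nat.card {a : T.H // ¬ (a = s ∨ a = T.edge s)} < Nat.card T.H :=
        Finite.card_subtype_lt (x := s) (by simp)
      exact Nat.lt_succ_iff.1 (this.trans_le hT)
    · rw [StrandDiagram.mkRemove_eq_zero hs, map_zero]

theorem exists_chordDerivation_pow (i : Fin p) (x : AlgA F p) :
    ∃ n, (chordDerivation F i ^ n) x = 0 := by
  have mono : ∀ {m n : ℕ} {x : AlgA F p}, m ≤ n → (chordDerivation F i ^ m) x = 0 →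
      (chordDerivation F i ^ n) x = 0 := fun h h0 => by
    rw [← Nat.sub_add_cancel h, pow_add, Module.End.mul_apply, h0, map_zero]
  induction AlgA.mem_span_mk x using Submodule.span_induction with
  | mem x hx =>
    obtain ⟨T, rfl⟩ := hx
    exact ⟨_, chordDerivation_pow_mk i _ T le_rfl⟩
  | zero => exact ⟨0, map_zero _⟩
  | add x y _ _ hx hy =>
    obtain ⟨m, hm⟩ := hx
    obtain ⟨n, hn⟩ := hy
    exact ⟨max m n, by rw [map_add, mono (le_max_left _ _) hm, mono (le_max_right _ _) hn, add_zero]⟩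
  | smul r x _ hx =>
    obtain ⟨n, hn⟩ := hx
    exact ⟨n, by rw [map_smul, hn, smul_zero]⟩

end

/-! ## Framing chords are central -/

namespace JacobiDiagram

variable {p : ℕ}

open Classical in
/-- If `x`, `y` are the ends of a strut, the diagrams in which `z` is merged with `y` or with `x`
are the same up to the cyclic order at the new vertex. -/
theorem exists_isRegluing_merge_strut {D : JacobiDiagram p} {x y z : D.H} (hyz : D.LegPair y z)
    (hxz : D.LegPair x z) (hxy : D.edge x = y) (hc : D.color x = D.color y) :
    ∃ f : (D.merge y z hyz).H ≃ (D.merge x z hxz).H,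
      (D.merge y z hyz).IsRegluing (D.merge x z hxz) ((D.merge y z hyz).flip (old hyz z)) f ∧
      f (old hyz x) = foot hxz ∧ f (foot hyz) = old hxz y ∧
      ∀ a, a ≠ x → a ≠ y → f (old hyz a) = old hxz a := by
  have hyx : D.edge y = x := by rw [← hxy, D.edge_edge]
  have hne : x ≠ y := fun e => D.edge_ne x (hxy.trans e.symm)
  set π := (D.merge y z hyz).flip (old hyz z) with hπdef
  have hπ : π = Equiv.swap (old hyz y) (stem hyz) := by
    rw [hπdef, flip, merge_next_right, merge_next_left]
  have os : ∀ a, old hyz a ≠ stem hyz := fun _ => Sum.inl_ne_inr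
  have py : π (old hyz y) = stem hyz := by rw [hπ, Equiv.swap_apply_left]
  have ps : π (stem hyz) = old hyz y := by rw [hπ, Equiv.swap_apply_right]
  have po : ∀ a, a ≠ y → π (old hyz a) = old hyz a := fun a ha => by
    rw [hπ, Equiv.swap_apply_of_ne_of_ne ((old_injective hyz).ne ha) (os a)]
  have pf : π (foot hyz) = foot hyz := by
    rw [hπ, Equiv.swap_apply_of_ne_of_ne (old_ne_foot hyz y).symm (stem_ne_foot hyz).symm]
  -- The cycle `x ↦ foot ↦ y ↦ x`. The legs `x`, `foot` of the first diagram become `foot`, `y` of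
  -- the second, matching their order along the list in `mkList_slide`.
  let f : (D.merge y z hyz).H ≃ (D.merge x z hxz).H :=
    ((Equiv.swap (.inl x) (.inl y) * Equiv.swap (.inl x) (.inr true) : Equiv.Perm (D.H ⊕ Bool)))
  have fx : f (old hyz x) = foot hxz := by
    change Equiv.swap (Sum.inl x) (Sum.inl y) (Equiv.swap (Sum.inl x) (Sum.inr true) (Sum.inl x)) =
      (Sum.inr true : D.H ⊕ Bool)
    rw [Equiv.swap_apply_left, Equiv.swap_apply_of_ne_of_ne Sum.inr_ne_inl Sum.inr_ne_inl]
  have ff : f (foot hyz) = old hxz y := by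
    change Equiv.swap (Sum.inl x) (Sum.inl y) (Equiv.swap (Sum.inl x) (Sum.inr true) (Sum.inr true)) =
      (Sum.inl y : D.H ⊕ Bool)
    rw [Equiv.swap_apply_right, Equiv.swap_apply_left]
  have fy : f (old hyz y) = old hxz x := by
    change Equiv.swap (Sum.inl x) (Sum.inl y) (Equiv.swap (Sum.inl x) (Sum.inr true) (Sum.inl y)) =
      (Sum.inl x : D.H ⊕ Bool)
    rw [Equiv.swap_apply_of_ne_of_ne (Sum.inl_injective.ne hne.symm) Sum.inl_ne_inr,
      Equiv.swap_apply_right]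
  have fs : f (stem hyz) = stem hxz := by
    change Equiv.swap (Sum.inl x) (Sum.inl y) (Equiv.swap (Sum.inl x) (Sum.inr true)
      (Sum.inr false)) = (Sum.inr false : D.H ⊕ Bool)
    rw [Equiv.swap_apply_of_ne_of_ne Sum.inr_ne_inl (Sum.inr_injective.ne (by decide)),
      Equiv.swap_apply_of_ne_of_ne Sum.inr_ne_inl Sum.inr_ne_inl]
  have fo : ∀ a, a ≠ x → a ≠ y → f (old hyz a) = old hxz a := fun a hax hay => by
    change Equiv.swap (Sum.inl x) (Sum.inl y) (Equiv.swap (Sum.inl x) (Sum.inr true)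
      (Sum.inl a)) = (Sum.inl a : D.H ⊕ Bool)
    rw [Equiv.swap_apply_of_ne_of_ne (Sum.inl_injective.ne hax) Sum.inl_ne_inr,
      Equiv.swap_apply_of_ne_of_ne (Sum.inl_injective.ne hax) (Sum.inl_injective.ne hay)]
  refine ⟨f, ⟨fun h => ?_, fun h => ?_, fun h hh => ?_⟩, fx, ff, fo⟩
  · refine merge_cases hyz (fun a hay haz => ?_) ?_ ?_ ?_ ?_ h
    · rw [merge_next_old hyz hay haz]
      by_cases hax : a = x
      · subst hax
        rw [show D.next a = a from hxz.left, fx, merge_next_foot]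
      · rw [fo a hax hay, merge_next_old hxz hax haz,
          fo _ (fun e => hax (hxz.left.of_next e)) (fun e => hay (hyz.left.of_next e))]
    · rw [merge_next_left, fy, fs, merge_next_left]
    · rw [merge_next_right, fy, fo z hxz.ne.symm hyz.ne.symm, merge_next_right]
    · rw [merge_next_stem, fs, fo z hxz.ne.symm hyz.ne.symm, merge_next_stem]
    · rw [merge_next_foot, ff, merge_next_old hxz hne.symm hyz.ne,
        show D.next y = y from hyz.left]
  · have gen : ∀ a, a ≠ y → (D.merge x z hxz).edge (f (π (old hyz a))) =
        f (π ((D.merge y z hyz).edge (old hyz a))) := by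
      intro a hay
      rw [merge_edge_old, po a hay]
      by_cases hax : a = x
      · subst hax
        rw [hxy, py, fs, fx, merge_edge_foot]
      · have h1 : D.edge a ≠ x := fun e => hay (by rw [← D.edge_edge a, e, hxy])
        have h2 : D.edge a ≠ y := fun e => hax (by rw [← D.edge_edge a, e, hyx])
        rw [po _ h2, fo a hax hay, fo _ h1 h2, merge_edge_old]
    refine merge_cases hyz (fun a hay _ => gen a hay) ?_ (gen z hyz.ne.symm) ?_ ?_ h
    · rw [merge_edge_old, hyx, py, po x hne, fs, fx, merge_edge_stem]
    · rw [merge_edge_stem, ps, pf, fy, ff, merge_edge_old, hxy]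
    · rw [merge_edge_foot, ps, pf, fy, ff, merge_edge_old, hyx]
  · revert hh
    refine merge_cases hyz (fun a hay haz hh => ?_) ?_ ?_ ?_ ?_ h
    · by_cases hax : a = x
      · subst hax
        rw [fx, merge_color_foot, merge_color_old]
      · rw [fo a hax hay, merge_color_old, merge_color_old]
    · exact fun hh => (((isLeg_old hyz).1 hh).2.1 rfl).elim
    · exact fun hh => (((isLeg_old hyz).1 hh).2.2 rfl).elim
    · exact fun hh => (not_isLeg_stem hyz hh).elim
    · intro _
      rw [ff, merge_color_foot, merge_color_old]

variable {F : Type*} [Field F]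

/-- Carrying `z` across `y` and then across `x` produces two merged diagrams. They have the same
graph with opposite cyclic orders at the new vertex, so they cancel by AS. A leg of another colour
passes freely. -/
theorem mkList_slide {D : JacobiDiagram p} {u v : List D.H} {x y z : D.H}
    (h : D.IsListing (u ++ x :: y :: z :: v)) (hxy : D.edge x = y) (hc : D.color x = D.color y) :
    mkList F D (u ++ x :: y :: z :: v) = mkList F D (u ++ z :: x :: y :: v) := by
  have h1 : D.IsListing ((u ++ [x]) ++ y :: z :: v) := by simpa using h
  have h2 : D.IsListing (u ++ x :: z :: y :: v) := by simpa using h1.swap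
  obtain ⟨n1, n2, n3, n4, n5⟩ := h.notMem
  simp only [List.mem_cons, not_or] at n2 n4
  have e1 := mkList_swap (F := F) h1
  have e2 := mkList_swap (F := F) h2
  simp only [List.append_assoc, List.singleton_append] at e1
  rw [← sub_eq_zero, ← sub_add_sub_cancel _ (mkList F D (u ++ x :: z :: y :: v)), e1, e2, hc]
  split_ifs with hcz
  · obtain ⟨f, hf, fx, ff, fo⟩ := exists_isRegluing_merge_strut h1.legPair h2.legPair hxy hc
    have key := mkList_as (F := F) (fun e => ((isLeg_old h1.legPair).1 e).2.2 rfl) hf h1.merge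
    have hid : ∀ w : List D.H, x ∉ w → y ∉ w →
        (w.map (old h1.legPair)).map f = w.map (old h2.legPair) := fun w hx hy => by
      rw [List.map_map]
      exact List.map_congr_left fun a ha => fo a (fun e => hx (e ▸ ha)) (fun e => hy (e ▸ ha))
    have e3 : (mergeList h1.legPair (u ++ [x]) v).map f = mergeList h2.legPair u (y :: v) := by
      rw [mergeList, mergeList, List.map_append, List.map_append, List.map_append]
      simp only [List.map_cons, List.map_nil, hid u n1 n3, hid v n2.2 n4.2, ff, fx, List.append_assoc, List.singleton_append]
    rwa [e3] at key
  · exact add_zero 0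

theorem mkList_strut_front {D : JacobiDiagram p} {x y : D.H} (hxy : D.edge x = y)
    (hc : D.color x = D.color y) (w : List D.H) : ∀ u v : List D.H,
    D.IsListing (u ++ x :: y :: (w ++ v)) →
    mkList F D (u ++ x :: y :: (w ++ v)) = mkList F D (u ++ w ++ x :: y :: v) := by
  induction w with
  | nil => intro u v _; simp
  | cons z w ih =>
    intro u v h
    rw [List.cons_append] at h ⊢
    have h1 : D.IsListing ((u ++ [z]) ++ x :: y :: (w ++ v)) := by
      refine h.of_perm ?_
      rw [List.append_assoc]
      exact .append_left u (List.perm_middle (l₁ := [x, y]))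
    have := ih (u ++ [z]) v h1
    rw [mkList_slide h hxy hc]
    simpa using this

end JacobiDiagram

section Central

variable {F : Type*} [Field F] {p : ℕ}

theorem isListing_strut (i : Fin p) : (strut i).IsListing [(false : Bool), true] := by
  constructor
  · exact (by decide : [false, true].Nodup)
  · rintro (_ | _)
    · exact iff_of_true (.head _) rfl
    · exact iff_of_true (.tail _ (.head _)) rfl

theorem mkList_strut (i : Fin p) :
    mkList F (strut i) [(false : Bool), true] = AlgA.mk F (StrandDiagram.chord i) := by
  rw [← (StrandDiagram.chord i).mkList_legList F]
  refine congrArg (mkList F (strut i)) (StrandDiagram.eq_legList (StrandDiagram.chord i) (isListing_strut i) ?_).symm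
  exact List.pairwise_pair.2 (Or.inr ⟨rfl, rfl⟩)

theorem chord_mul_mkList (i : Fin p) {D : JacobiDiagram p} {l : List D.H} (hl : D.IsListing l) :
    AlgA.mk F (StrandDiagram.chord i) * mkList F D l = mkList F ((strut i).union D)
      (unionList [(false : Bool), true] l) := by
  rw [mkList_union (isListing_strut i) hl, mkList_strut]

/-- In the product with the chord in front, its two ends are neighbours. Such a chord slides as a
unit past every leg of the other factor and reaches the end of the list. -/
theorem chord_mul_comm (i : Fin p) (x : AlgA F p) :
    AlgA.mk F (StrandDiagram.chord i) * x = x * AlgA.mk F (StrandDiagram.chord i) := by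
  induction AlgA.mem_span_mk x using Submodule.span_induction with
  | mem x hx =>
    obtain ⟨T, rfl⟩ := hx
    have hl := T.isListing_legList
    have hs := isListing_strut i
    have h1 := (hs.union hl)
    have h2 := mkList_iso (F := F) (isRegluing_comm T.toJacobiDiagram (strut i)) (hl.union hs)
    rw [← T.mkList_legList F, chord_mul_mkList i hl, ← mkList_strut i, ← mkList_union hl hs, ← h2]
    have e1 : (unionList [(false : Bool), true] T.legList : List ((strut i).union T.toJacobiDiagram).H) =
        [] ++ (show ((strut i).union T.toJacobiDiagram).H from .inl (false : Bool)) ::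
          (show ((strut i).union T.toJacobiDiagram).H from .inl (true : Bool)) ::
          ((T.legList.map Sum.inr : List (Bool ⊕ T.H)) ++ []) := by
      exact congrArg (fun w : List (Bool ⊕ T.H) => Sum.inl false :: Sum.inl true :: w)
        (List.append_nil _).symm
    rw [e1] at h1 ⊢
    refine (mkList_strut_front rfl rfl _ _ _ h1).trans (congrArg (mkList F _) ?_)
    refine Eq.symm ((List.map_append (f := Equiv.sumComm T.H Bool)).trans ?_)
    exact congrArg₂ (· ++ ·) List.map_map rfl
  | zero => simp
  | add x y _ _ hx hy => rw [mul_add, add_mul, hx, hy]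
  | smul r x _ hx => rw [mul_smul_comm, smul_mul_assoc, hx]

end Central

/-! ## The quotient by the framing chords -/

/-! ### Eliminating a variable by a Taylor expansion -/

section Taylor

variable {F A : Type*} [Field F] [Ring A] [Algebra F A]

/-- The operator `Δ` behaves like `2 d/da`; this is the usual commutator of a power of a derivative
with multiplication by the variable. -/
theorem pow_apply_mul {Δ : A →ₗ[F] A} {a : A} (hΔ : ∀ x, Δ (a * x) = 2 • x + a * Δ x) (m : ℕ)
    (x : A) : (Δ ^ (m + 1)) (a * x) = a * (Δ ^ (m + 1)) x + (2 * (m + 1)) • (Δ ^ m) x := by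
  induction m with
  | zero => simp [hΔ, add_comm]
  | succ m ih =>
    rw [pow_succ', Module.End.mul_apply, ih, map_add, hΔ, map_nsmul, ← Module.End.mul_apply,
      ← Module.End.mul_apply, ← pow_succ', ← pow_succ', pow_succ' Δ (m + 1)]
    simp only [add_smul, mul_add, mul_one]
    abel

/-- An element that is killed by a locally nilpotent operator `Δ` with `[Δ, a] = 2` and lies in
`a A + b A` lies in `b A`. -/
theorem exists_eq_mul_of_locallyNilpotent [CharZero F] {Δ : A →ₗ[F] A} {a b : A}
    (hΔ : ∀ x, Δ (a * x) = 2 • x + a * Δ x) (hb : ∀ x, Δ (b * x) = b * Δ x) (hab : a * b = b * a)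
    (hnil : ∀ x, ∃ n, (Δ ^ n) x = 0) {k r s : A} (hk : Δ k = 0) (h : k = a * r + b * s) :
    ∃ t, k = b * t := by
  -- With `Δ` in the role of `2 d/da`, the sum of `c m • a ^ m Δ ^ m` is the Taylor expansion that
  -- sets `a = 0`. Accordingly it kills `a A`, fixes the kernel of `Δ`, and commutes with
  -- multiplication by `b`.
  let c : ℕ → F := fun m => (-1 / 2) ^ m / m.factorial
  let P : ℕ → A → A := fun N x => ∑ m ∈ Finset.range N, c m • (a ^ m * (Δ ^ m) x)
  -- The truncated sum telescopes on `a * x`, and the remaining term is zero as soon as `Δ ^ N`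
  -- kills `x`.
  have hPa : ∀ N x, P (N + 1) (a * x) = c N • (a ^ (N + 1) * (Δ ^ N) x) := by
    intro N x
    induction N with
    | zero => simp [P]
    | succ N ih =>
      have hc : c (N + 1) * (2 * (N + 1) : ℕ) = - c N := by
        simp only [c, Nat.factorial_succ]
        have h1 : ((N : F) + 1) ≠ 0 := by exact_mod_cast Nat.succ_ne_zero N
        have h2 : (N.factorial : F) ≠ 0 := by exact_mod_cast N.factorial_ne_zero
        push_cast
        field_simp
        ring
      change ∑ m ∈ Finset.range (N + 1 + 1), _ = _
      rw [Finset.sum_range_succ]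
      change P (N + 1) (a * x) + _ = _
      rw [ih, pow_apply_mul hΔ, mul_add, smul_add, mul_smul_comm, ← Nat.cast_smul_eq_nsmul F,
        smul_smul, hc, neg_smul, ← mul_assoc, ← pow_succ]
      abel
  have hPb : ∀ N x, P N (b * x) = b * P N x := by
    intro N x
    have h1 : ∀ m, (Δ ^ m) (b * x) = b * (Δ ^ m) x := fun m => by
      induction m with
      | zero => rfl
      | succ m ih => rw [pow_succ', Module.End.mul_apply, ih, hb, Module.End.mul_apply]
    simp only [P, h1, Finset.mul_sum]
    refine Finset.sum_congr rfl fun m _ => ?_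
    have h2 : Commute (a ^ m) b := Commute.pow_left hab m
    rw [mul_smul_comm, ← mul_assoc, h2.eq, mul_assoc]
  have hPk : ∀ N, P (N + 1) k = k := by
    intro N
    have h1 : ∀ m, (Δ ^ (m + 1)) k = 0 := fun m => by
      rw [pow_succ, Module.End.mul_apply, hk, map_zero]
    simp only [P, Finset.sum_range_succ', h1]
    simp [c]
  have hadd : ∀ N x y, P N (x + y) = P N x + P N y := fun N x y => by
    simp only [P, map_add, mul_add, smul_add, Finset.sum_add_distrib]
  obtain ⟨n, hn⟩ := hnil r
  refine ⟨P (n + 1) s, ?_⟩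
  rw [← hPb, ← hPk n]
  conv_lhs => rw [h]
  rw [hadd, hPa, hn, mul_zero, smul_zero, zero_add]

end Taylor

/-! ### The deframing subalgebra as a complement of the ideal -/

section Quotient

variable {F : Type*} [Field F]

/-- The chords are central, so the sums of their right multiples already form a two-sided ideal. -/
theorem exists_of_mem_oneTermIdeal {x : AlgA F 2} (hx : x ∈ oneTermIdeal F) :
    ∃ r s, x = AlgA.mk F (StrandDiagram.chord 0) * r + AlgA.mk F (StrandDiagram.chord 1) * s := by
  let S : Set (AlgA F 2) := {x | ∃ r s, x =
      AlgA.mk F (StrandDiagram.chord 0) * r + AlgA.mk F (StrandDiagram.chord 1) * s}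
  let J : TwoSidedIdeal (AlgA F 2) := .mk' S
    ⟨0, 0, by simp⟩
    (by
      rintro _ _ ⟨r, s, rfl⟩ ⟨r', s', rfl⟩
      exact ⟨r + r', s + s', by rw [mul_add, mul_add]; abel⟩)
    (by
      rintro _ ⟨r, s, rfl⟩
      exact ⟨-r, -s, by rw [mul_neg, mul_neg, neg_add]⟩)
    (by
      rintro x _ ⟨r, s, rfl⟩
      exact ⟨x * r, x * s, by rw [mul_add, ← mul_assoc, ← mul_assoc, ← mul_assoc, ← mul_assoc,
        chord_mul_comm, chord_mul_comm]⟩)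
    (by
      rintro _ x ⟨r, s, rfl⟩
      exact ⟨r * x, s * x, by rw [add_mul, mul_assoc, mul_assoc]⟩)
  have h : oneTermIdeal F ≤ J := by
    refine TwoSidedIdeal.span_le.2 ?_
    rintro _ ⟨i, rfl⟩
    refine (TwoSidedIdeal.mem_mk' _ _ _ _ _ _ _).2 ?_
    fin_cases i
    · exact ⟨1, 0, by simp⟩
    · exact ⟨0, 1, by simp⟩
  have hS : x ∈ S := (TwoSidedIdeal.mem_mk' _ _ _ _ _ _ _).1 (h hx)
  exact hS

/-- Elements of `subA` are killed by both chord-removing operators. Eliminating the first chord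
shows that `x` is a multiple of the second one; eliminating that one, with `b = 0`, leaves nothing.
-/
theorem eq_zero_of_mem_subA_of_mem_oneTermIdeal [CharZero F] {x : AlgA F 2} (hx : x ∈ subA F)
    (hx' : x ∈ oneTermIdeal F) : x = 0 := by
  obtain ⟨r, s, h⟩ := exists_of_mem_oneTermIdeal hx'
  have hne : (0 : Fin 2) ≠ 1 := by decide
  obtain ⟨t, ht⟩ := exists_eq_mul_of_locallyNilpotent (Δ := chordDerivation F 0)
    (fun x => by rw [chordDerivation_chord_mul, if_pos rfl])
    (fun x => by rw [chordDerivation_chord_mul, if_neg hne, zero_add])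
    (chord_mul_comm _ _) (exists_chordDerivation_pow 0) (chordDerivation_eq_zero 0 hx) h
  obtain ⟨t', ht'⟩ := exists_eq_mul_of_locallyNilpotent (Δ := chordDerivation F 1) (b := 0) (r := t)
    (s := 0)
    (fun x => by rw [chordDerivation_chord_mul, if_pos rfl])
    (fun x => by simp) (by simp) (exists_chordDerivation_pow 1) (chordDerivation_eq_zero 1 hx)
    (ht.trans (by simp))
  rw [ht', zero_mul]

theorem mk_eq_zero_iff_mem_oneTermIdeal {x : AlgA F 2} :
    (oneTermIdeal F).ringCon.mk' x = 0 ↔ x ∈ oneTermIdeal F := by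
  rw [← TwoSidedIdeal.mem_ker, TwoSidedIdeal.ker_ringCon_mk']

theorem mk_chord_eq_zero (i : Fin 2) :
    (oneTermIdeal F).ringCon.mk' (AlgA.mk F (StrandDiagram.chord i)) = 0 :=
  mk_eq_zero_iff_mem_oneTermIdeal.2 (TwoSidedIdeal.subset_span ⟨i, rfl⟩)

/-- The induction is that of `mkList_mem_subA`. If there is a framing strut, an order in which it
comes first gives a multiple of a chord, which is zero in the quotient; any other order differs from
it by diagrams with fewer legs. -/
theorem mk_mkList_mem_map (n : ℕ) : ∀ (D : JacobiDiagram 2) (l : List D.H),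
    D.IsListing l → l.length = n → (oneTermIdeal F).ringCon.mk' (mkList F D l) ∈
      (subA F).toSubring.map (oneTermIdeal F).ringCon.mk' := by
  induction n using Nat.strong_induction_on with
  | _ n ih =>
    intro D l hl hn
    by_cases hD : D.NoStrut
    · exact ⟨_, mkList_mem_subA n D l hD hl hn, rfl⟩
    simp only [NoStrut, not_forall, not_not] at hD
    obtain ⟨i, a, ha⟩ := hD
    obtain ⟨C, E, f, c, hC, hf, rfl⟩ := D.exists_iso_connected_union a
    have hc : C.IsStrut i c := isStrut_union_inl.1 (hf.isStrut_iff.1 ha)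
    obtain ⟨g, hg, -⟩ := hC.exists_isRegluing_strut hc
    obtain ⟨m, hm⟩ := E.exists_isListing
    obtain ⟨e, he⟩ : ∃ e : ((strut i).union E).H ≃ D.H, ((strut i).union E).IsRegluing D 1 e :=
      ⟨_, (hg.one_union (.refl E)).trans hf⟩
    obtain ⟨L, hL, h0⟩ : ∃ L, ((strut i).union E).IsListing L ∧
        (oneTermIdeal F).ringCon.mk' (mkList F ((strut i).union E) L) = 0 :=
      ⟨_, (isListing_strut i).union hm, by
        rw [← chord_mul_mkList i hm, map_mul, mk_chord_eq_zero, zero_mul]⟩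
    rw [← mkList_iso he hL] at h0
    have := IsListing.sub_mem (((subA F).toSubring.map
      (oneTermIdeal F).ringCon.mk').toAddSubgroup.comap
      ((oneTermIdeal F).ringCon.mk' : AlgA F 2 →+ _)) (mkList F D) (fun u x y v h => ?_) hl
      (hL.map he)
    · rw [AddSubgroup.mem_comap, map_sub] at this
      refine (congrArg (· ∈ _) ?_).mp this
      exact (congrArg _ h0).trans (sub_zero _)
    · rw [mkList_swap h]
      split_ifs
      · have h1 := length_mergeList h.legPair u v
        have h2 := (h.perm hl).length_eq
        exact ih (n - 1) (by omega) _ _ h.merge (by omega)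
      · exact zero_mem _

theorem mk_oneTermIdeal_bijective [CharZero F] :
    Function.Bijective (fun x : subA F => (oneTermIdeal F).ringCon.mk' (x : AlgA F 2)) := by
  constructor
  · intro x y h
    refine Subtype.ext (sub_eq_zero.1 (eq_zero_of_mem_subA_of_mem_oneTermIdeal
      (sub_mem x.2 y.2) (mk_eq_zero_iff_mem_oneTermIdeal.1 ?_)))
    rw [map_sub]
    exact sub_eq_zero.2 h
  · intro y
    obtain ⟨x, rfl⟩ := (oneTermIdeal F).ringCon.mk'_surjective y
    suffices h : (oneTermIdeal F).ringCon.mk' x ∈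
        (subA F).toSubring.map (oneTermIdeal F).ringCon.mk' by
      obtain ⟨z, hz, h⟩ := h
      exact ⟨⟨z, hz⟩, h⟩
    induction AlgA.mem_span_mk x using Submodule.span_induction with
    | mem x hx =>
      obtain ⟨T, rfl⟩ := hx
      rw [← T.mkList_legList F]
      exact mk_mkList_mem_map _ _ _ T.isListing_legList rfl
    | zero => rw [map_zero]; exact zero_mem _
    | add x y _ _ hx hy => rw [map_add]; exact add_mem hx hy
    | smul r x _ hx =>
      rw [Algebra.smul_def, map_mul]
      exact mul_mem ⟨_, (subA F).algebraMap_mem r, rfl⟩ hx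

end Quotient

/-! ## The heptapus -/

/-- Each leg of the wheel ends at a vertex of the rim, so no edge has two univalent ends, whatever
the colours. -/
theorem heptapus_noStrut : heptapus.NoStrut := by
  rintro i ⟨j, k⟩ ⟨h1, h2, -, -⟩
  have key : ∀ a : ZMod 7 × Fin 4, ¬ (wheelNext a = a ∧ wheelNext (wheelEdge a) = wheelEdge a) := by
    decide
  exact key (j, k) ⟨h1, h2⟩

theorem mainTheorem4 (F : Type*) [Field F] [CharZero F] :
    Function.Bijective (chi F 2) ∧
    Function.Bijective (fun x : subA F => (oneTermIdeal F).ringCon.mk' (x : AlgA F 2)) ∧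
    (Subalgebra.toSubmodule (subA F)).comap (chi F 2) = Subalgebra.toSubmodule (subB F) ∧
    AlgB.mk F heptapus ∈ subB F ∧ chi F 2 (AlgB.mk F heptapus) ∈ subA F :=
  ⟨chi_bijective F, mk_oneTermIdeal_bijective, comap_chi_subA,
    AlgB.mk_mem_subB _ heptapus_noStrut, chi_mk_mem_subA heptapus_noStrut⟩
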